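/- All rings are unital (not necessarily commutative), all modules are left modules, and $0\in\mathbb N$. A clone on a set $A$ is a set of finitary operations $A^n\to A$ ($n\in\mathbb N$) that contains all projections and is closed under composition. For an $R$-module $\mathbf A$, $\mathrm{Clo}(\mathbf A)$ is the smallest clone containing the operations $+$, $0$, $-$ and $x\mapsto rx$ ($r\in R$). For modules $\mathbf A$, $\mathbf B$ (possibly over different rings), an $(\mathbf A,\mathbf B)$-clonoid is a set $C$ of finitary operations $A^n\to B$ ($n\in\mathbb N$), with $n$-ary part $C^{(n)}$, such that $g\circ(f_1,\dots,f_n)\in C^{(k)}$ whenever $f_1,\dots,f_n\in C^{(k)}$ and $g\in \mathrm{Clo}(\mathbf B)^{(n)}$, and $f\circ(g_1,\dots,g_k)\in C^{(n)}$ whenever $f\in C^{(k)}$ and $g_1,\dots,g_k\in\mathrm{Clo}(\mathbf A)^{(n)}$. The clonoid generated by a set of operations is the smallest $(\mathbf A,\mathbf B)$-clonoid containing it. Theorem. Let $F_1,\dots,F_n$ be finite fields ($n\ge 0$), let $k_1,\dots,k_n\in\mathbb N$, let $R$ be a ring, and let $D$ be a finite distributive $R$-module (i.e. its lattice of submodules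 is distributive). Let $\mathbf A=F_1^{k_1}\times\cdots\times F_n^{k_n}\times D$, regarded as a module over $F_1\times\cdots\times F_n\times R$ with the componentwise action. Let $J$ be the Jacobson radical of the ring $R/\mathrm{Ann}_R(D)$ (which is $R$ itself if $D$ is faithful), let $l$ be its nilpotence degree, i.e. the least $l\in\mathbb N$ with $J^l=0$, and put $k=\max(k_1,\dots,k_n,l)$. Let $S$ be a ring in which $|A|$ is invertible, and let $\mathbf B$ be an $S$-module. Then 1. every $(\mathbf A,\mathbf B)$-clonoid $C$ is generated by its $k$-ary part $C^{(k)}$; 2. if $\mathbf B$ is finite, then there are only finitely many $(\mathbf A,\mathbf B)$-clonoids. -/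

import Mathlib

universe u v w

/-- A set of finitary operations from `A` to `B`, given by its `n`-ary parts for `n = 0, 1, 2, …`. -/
abbrev OpSet (A : Type u) (B : Type v) : Type (max u v) :=
  ∀ n : ℕ, Set ((Fin n → A) → B)

/-- A clone on `A`: a set of operations that contains all projections and is closed under
composition. -/
structure IsClone {A : Type u} (C : OpSet A A) : Prop where
  proj_mem : ∀ (n : ℕ) (i : Fin n), (fun x : Fin n → A => x i) ∈ C n
  comp_mem : ∀ (n k : ℕ) (f : (Fin n → A) → A) (g : Fin n → (Fin k → A) → A),
    f ∈ C n → (∀ i, g i ∈ C k) → (fun x => f (fun i => g i x)) ∈ C k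

/-- `Clo(F)`: the smallest clone that contains the set of operations `F`. -/
def clo {A : Type u} (F : OpSet A A) : OpSet A A := fun n =>
  {f | ∀ C : OpSet A A, IsClone C → (∀ m, F m ⊆ C m) → f ∈ C n}

/-- The basic operations of an `R`-module `M`, regarded as the one-sorted algebra
`(M, +, 0, -, (r)_{r ∈ R})`. -/
inductive ModuleBasicOp (R : Type u) (M : Type v) [Ring R] [AddCommGroup M] [Module R M] :
    ∀ n : ℕ, ((Fin n → M) → M) → Prop
  | add : ModuleBasicOp R M 2 (fun x => x 0 + x 1)
  | zero : ModuleBasicOp R M 0 (fun _ => 0)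
  | neg : ModuleBasicOp R M 1 (fun x => -x 0)
  | smul (r : R) : ModuleBasicOp R M 1 (fun x => r • x 0)

/-- The term clone `Clo(M)` of an `R`-module `M`. -/
def moduleClone (R : Type u) (M : Type v) [Ring R] [AddCommGroup M] [Module R M] : OpSet M M :=
  clo (fun n => {f | ModuleBasicOp R M n f})

/-- `C` is a clonoid from the clone `𝒜` (on `A`) to the clone `ℬ` (on `B`). -/
structure IsClonoid {A : Type u} {B : Type v} (𝒜 : OpSet A A) (ℬ : OpSet B B)
    (C : OpSet A B) : Prop where
  comp_left : ∀ (n k : ℕ) (g : (Fin n → B) → B) (f : Fin n → (Fin k → A) → B),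
    g ∈ ℬ n → (∀ i, f i ∈ C k) → (fun x => g (fun i => f i x)) ∈ C k
  comp_right : ∀ (n k : ℕ) (f : (Fin k → A) → B) (g : Fin k → (Fin n → A) → A),
    f ∈ C k → (∀ i, g i ∈ 𝒜 n) → (fun x => f (fun i => g i x)) ∈ C n

/-- The `(𝒜, ℬ)`-clonoid generated by `F`: the smallest `(𝒜, ℬ)`-clonoid that contains `F`. -/
def generatedClonoid {A : Type u} {B : Type v} (𝒜 : OpSet A A) (ℬ : OpSet B B)
    (F : OpSet A B) : OpSet A B := fun n =>
  {f | ∀ C : OpSet A B, IsClonoid 𝒜 ℬ C → (∀ m, F m ⊆ C m) → f ∈ C n}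

/-- The `k`-ary part of `C`, as a set of operations. -/
def aryPart {A : Type u} {B : Type v} (C : OpSet A B) (k : ℕ) : OpSet A B := fun n =>
  {f | f ∈ C n ∧ n = k}

/-- The product of an `R₁`-module `M₁` and an `R₂`-module `M₂` as an `R₁ × R₂`-module:
`(r₁, r₂) • (m₁, m₂) = (r₁ • m₁, r₂ • m₂)`. -/
instance prodModuleOverProd {R₁ : Type*} {R₂ : Type*} {M₁ : Type*} {M₂ : Type*} [Ring R₁] [Ring R₂]
    [AddCommGroup M₁] [AddCommGroup M₂] [Module R₁ M₁] [Module R₂ M₂] :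
    Module (R₁ × R₂) (M₁ × M₂) where
  smul r m := (r.1 • m.1, r.2 • m.2)
  one_smul m := Prod.ext (one_smul R₁ m.1) (one_smul R₂ m.2)
  mul_smul r s m := Prod.ext (mul_smul r.1 s.1 m.1) (mul_smul r.2 s.2 m.2)
  smul_zero r := Prod.ext (smul_zero r.1) (smul_zero r.2)
  smul_add r m m' := Prod.ext (smul_add r.1 m.1 m'.1) (smul_add r.2 m.2 m'.2)
  add_smul r s m := Prod.ext (add_smul r.1 s.1 m.1) (add_smul r.2 s.2 m.2)
  zero_smul m := Prod.ext (zero_smul R₁ m.1) (zero_smul R₂ m.2)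

/-- A module is distributive if its lattice of submodules is distributive. -/
def IsDistributiveModule (R : Type u) (M : Type v) [Ring R] [AddCommGroup M] [Module R M] : Prop :=
  ∀ X Y Z : Submodule R M, X ⊓ (Y ⊔ Z) = (X ⊓ Y) ⊔ (X ⊓ Z)

/-- `l` is the nilpotence degree of the Jacobson radical `J` of the ring `R`: the least `l` with
`J ^ l = 0`. -/
def IsJacobsonNilpotenceDegree (R : Type u) [Ring R] (l : ℕ) : Prop :=
  IsLeast {j : ℕ | Ring.jacobson R ^ j = ⊥} l

/-!
Let `K` be the center of `S`, let `A` be the module in question and `G = A^ι` for a finite set `ι`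
of coordinates. Matrices over the ring of `A` act on `G`, hence on the group algebra `K[G]`. The
theorem is a statement about these operators alone: `A` is *uniformly generated* by `k`-ary
functions (`IsUniformlyGenerated`) if the identity of `K[G]` is, for every `ι`, a `K`-linear
combination of operators given by matrices `Q * P` that factor through `k` coordinates. Then
`f(x) = ∑ c f(Q (P x))` for every `f : G → B`, so that `f` lies in the clonoid generated by the
`k`-ary functions `f ∘ Q`. Hence a clonoid is determined by its `k`-ary part, which is one of
finitely many sets if `B` is finite.

The combinations of matrices that factor through `k` coordinates (`facSpan`) are closed under
addition and multiplication. So the identity is one of them as soon as a product `∏ (1 - e)` with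
all `e` in `facSpan` vanishes; both cases below are treated in this way. As `|G|` is invertible
in `K`, each subgroup `H` of `G` gives an idempotent `avg H`, the average of the elements of
`H`. Uniform generation passes to products (`IsUniformlyGenerated.prod`), which leaves two cases.

*Finite fields*, `A = F^k` (`isUniformlyGenerated_field`, an identity of Kovács in the monoid
algebra of a matrix monoid). By recursion on `j` there is a class function on the `j × j` matrices,
with value `1` at the identity matrix and `0` at the other invertible matrices, that yields an
operator `rankOp` supported on matrices of rank `j` which is the identity on the span of the tuples
of rank at most `j`, up to tuples of smaller rank. So the product of `1 - rankOp` over the ranks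
`0, …, k` vanishes on `K[(F^k)^ι]`, since every tuple has rank at most `k`.

*Finite distributive modules* `D` with `J^l D = 0` (`IsDistributiveModule.isUniformlyGenerated`),
by induction on `|D|`. For submodules `X` and `Y` with `X ∩ Y = 0` there is a ring element that
acts as `1` on `X` and as `0` on `Y` (`IsDistributiveModule.exists_smul_eq`); this is how
distributivity enters. If some minimal submodule is not contained in `J D`, then it is a direct
summand, and either `D` splits or `D` is simple; in the simple case, by the density theorem, `D` is
a vector space over a finite field all of whose linear maps are scalars from the ring, and the case
of fields applies. Otherwise the submodule `N` annihilated by `J` is contained in `J D`, and the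
sections `X` (maximal), `D / L` (with `L` minimal) and `J D / N` of `D` are uniformly generated by
induction, the last one by functions of arity `l - 2`. With operators for the first two kinds one
reduces to tuples `x` that generate `D`, and to the part of `K[G]` on which the averages over all
`L^ι` vanish. The two extra coordinates turn the operator for `J D / N` into an operator `Φ` of
arity `l` that multiplies suitable `x` by an explicit element of `K[N^ι]`, and kills the other
generating tuples (`exists_socle_operator`). It remains to see that the factors `1 - Φ_g`, for the
conjugates `Φ_g` of `Φ` by the invertible matrices, have product zero there
(`prod_one_sub_conjSocleElement_eq_zero`). A nonzero element of `K[G]` survives averaging over the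
kernel of some complex character `χ` (`exists_addChar_avg_ker_mul_ne_zero`), and some `g` makes `x`
and `χ` simultaneously so simple (`exists_units_normal_form`) that the factor `1 - Φ_g` is zero on
this average.
-/

/-! ### Averages in the group algebra of a finite abelian group -/

section GroupAlgebra

variable (K : Type*) [CommRing K] {G G' G'' : Type*} [AddCommGroup G] [AddCommGroup G']
  [AddCommGroup G'']

/-- The basis element of the group algebra `K[G]` at `x`. -/
noncomputable def pt (x : G) : AddMonoidAlgebra K G := AddMonoidAlgebra.single x 1

/-- The algebra homomorphism `K[G] → K[G']` induced by a group homomorphism. -/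
noncomputable def act (f : G →+ G') : AddMonoidAlgebra K G →ₐ[K] AddMonoidAlgebra K G' :=
  AddMonoidAlgebra.mapDomainAlgHom K K f

variable {K}

theorem pt_zero : pt K (0 : G) = 1 := rfl

theorem pt_add (x y : G) : pt K (x + y) = pt K x * pt K y := by
  simp [pt, AddMonoidAlgebra.single_mul_single]

@[simp] theorem act_pt (f : G →+ G') (x : G) : act K f (pt K x) = pt K (f x) := by
  simp [act, pt]

theorem act_comp (f : G →+ G') (g : G' →+ G'') (z : AddMonoidAlgebra K G) :
    act K (g.comp f) z = act K g (act K f z) := by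
  simp only [act, AddMonoidAlgebra.mapDomainAlgHom_comp]; rfl

theorem act_id (z : AddMonoidAlgebra K G) : act K (AddMonoidHom.id G) z = z := by
  simp only [act, AddMonoidAlgebra.mapDomainAlgHom_id]; rfl

/-- Two linear maps on `K[G]` agree if they agree on group elements. -/
theorem ext_pt {V : Type*} [AddCommGroup V] [Module K V] {f g : AddMonoidAlgebra K G →ₗ[K] V}
    (h : ∀ x, f (pt K x) = g (pt K x)) : f = g := by
  refine LinearMap.ext fun z => ?_
  induction z using AddMonoidAlgebra.induction_linear with
  | zero => simp
  | add a b ha hb => rw [map_add, map_add, ha, hb]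
  | single x c =>
    have : (AddMonoidAlgebra.single x c : AddMonoidAlgebra K G) = c • pt K x := by simp [pt]
    rw [this, map_smul, map_smul, h]

theorem isUnit_card_subgroup (hG : IsUnit (Nat.card G : K)) (H : AddSubgroup G) :
    IsUnit (Nat.card H : K) :=
  isUnit_of_dvd_unit (Nat.cast_dvd_cast H.card_addSubgroup_dvd_card) hG

variable [Finite G] [Finite G']

variable (K) in
/-- The element `|H|⁻¹ ∑_{h ∈ H} [h]` of the group algebra `K[G]`; it is meaningful when `|H|` is
invertible in `K`. -/
noncomputable def avg (H : AddSubgroup G) : AddMonoidAlgebra K G :=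
  Ring.inverse (Nat.card H : K) • ∑ h ∈ (Set.toFinite (H : Set G)).toFinset, pt K h

theorem pt_mul_avg {H : AddSubgroup G} {x : G} (hx : x ∈ H) : pt K x * avg K H = avg K H := by
  rw [avg, mul_smul_comm, Finset.mul_sum]
  congr 1
  refine Finset.sum_bij' (fun y _ => x + y) (fun y _ => -x + y) ?_ ?_ ?_ ?_ ?_
  · intro y hy; simp at hy ⊢; exact add_mem hx hy
  · intro y hy; simp at hy ⊢; exact add_mem (neg_mem hx) hy
  · intro y _; simp
  · intro y _; simp
  · intro y _; rw [pt_add]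

theorem card_toFinset_subgroup (H : AddSubgroup G) :
    (Set.toFinite (H : Set G)).toFinset.card = Nat.card H := by
  rw [← Set.ncard_eq_toFinset_card (H : Set G)]; rfl

/-- If `z` is invariant under translation by `H`, then averaging over `H` does not change it. -/
theorem avg_mul_of_invariant (hG : IsUnit (Nat.card G : K)) {H : AddSubgroup G}
    {z : AddMonoidAlgebra K G} (hz : ∀ x ∈ H, pt K x * z = z) : avg K H * z = z := by
  rw [avg, smul_mul_assoc, Finset.sum_mul, Finset.sum_congr rfl (g := fun _ => z)]
  · rw [Finset.sum_const, card_toFinset_subgroup, ← Nat.cast_smul_eq_nsmul K, smul_smul,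
      Ring.inverse_mul_cancel _ (isUnit_card_subgroup hG H), one_smul]
  · intro x hx; exact hz x (by simpa using hx)

theorem avg_mul_avg_of_le (hG : IsUnit (Nat.card G : K)) {H L : AddSubgroup G} (h : H ≤ L) :
    avg K H * avg K L = avg K L :=
  avg_mul_of_invariant hG fun _ hx => pt_mul_avg (h hx)

theorem avg_mul_self (hG : IsUnit (Nat.card G : K)) (H : AddSubgroup G) :
    avg K H * avg K H = avg K H := avg_mul_avg_of_le hG le_rfl

theorem avg_mul_avg (hG : IsUnit (Nat.card G : K)) (H L : AddSubgroup G) :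
    avg K H * avg K L = avg K (H ⊔ L) := by
  have h1 : avg K (H ⊔ L) * (avg K H * avg K L) = avg K H * avg K L := by
    refine avg_mul_of_invariant hG fun x hx => ?_
    obtain ⟨y, hy, z, hz, rfl⟩ := AddSubgroup.mem_sup.1 hx
    rw [pt_add, mul_mul_mul_comm, pt_mul_avg hy, pt_mul_avg hz]
  rw [← h1, mul_comm, mul_assoc, avg_mul_avg_of_le hG le_sup_right,
    avg_mul_avg_of_le hG le_sup_left]

theorem avg_bot : avg K (⊥ : AddSubgroup G) = 1 := by
  have : (Set.toFinite ((⊥ : AddSubgroup G) : Set G)).toFinset = {0} := by ext; simp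
  rw [avg, this]; simp [pt_zero]

/-- The average of the images of a group homomorphism is the average over its range. -/
theorem avg_range (hG : IsUnit (Nat.card G : K)) {A : Type*} [AddCommGroup A] [Fintype A]
    (hA : IsUnit (Fintype.card A : K)) (f : A →+ G) :
    Ring.inverse (Fintype.card A : K) • ∑ a, pt K (f a) = avg K f.range := by
  set z := Ring.inverse (Fintype.card A : K) • ∑ a, pt K (f a) with hz
  have h1 : avg K f.range * z = z := by
    refine avg_mul_of_invariant hG ?_
    rintro _ ⟨b, rfl⟩
    rw [hz, mul_smul_comm, Finset.mul_sum]
    congr 1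
    refine Fintype.sum_equiv (Equiv.addLeft b) _ _ fun a => ?_
    rw [← pt_add, ← map_add]; rfl
  rw [← h1, hz, mul_smul_comm, Finset.mul_sum, Finset.sum_congr rfl (g := fun _ => avg K f.range)]
  · rw [Finset.sum_const, ← Nat.cast_smul_eq_nsmul K, smul_smul, Finset.card_univ,
      Ring.inverse_mul_cancel _ hA, one_smul]
  · intro a _; rw [mul_comm, pt_mul_avg (AddMonoidHom.mem_range.2 ⟨a, rfl⟩)]

theorem act_avg (hG : IsUnit (Nat.card G : K)) (hG' : IsUnit (Nat.card G' : K))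
    (f : G →+ G') (H : AddSubgroup G) : act K f (avg K H) = avg K (H.map f) := by
  have h1 : avg K (H.map f) * act K f (avg K H) = act K f (avg K H) := by
    refine avg_mul_of_invariant hG' ?_
    rintro _ ⟨b, hb, rfl⟩
    rw [← act_pt f, ← map_mul, pt_mul_avg hb]
  rw [← h1]
  conv_lhs => rw [avg.eq_def K H, map_smul, mul_smul_comm, map_sum, Finset.mul_sum]
  rw [
    Finset.sum_congr rfl (g := fun _ => avg K (H.map f))]
  · rw [Finset.sum_const, card_toFinset_subgroup, ← Nat.cast_smul_eq_nsmul K, smul_smul,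
      Ring.inverse_mul_cancel _ (isUnit_card_subgroup hG H), one_smul]
  · intro a ha
    rw [act_pt, mul_comm, pt_mul_avg (AddSubgroup.mem_map_of_mem f (by simpa using ha))]

/-- Suppose that `H` is maximal among the subgroups whose average does not kill `t`. Then averages
over cosets of multiples of an element outside of `H` kill `avg H * t`. -/
theorem sum_multiples_mul_eq_zero (hG : IsUnit (Nat.card G : K)) {t : AddMonoidAlgebra K G}
    {H : AddSubgroup G} (hmax : ∀ L, H < L → avg K L * t = 0) {c : G} (hc : c ∉ H) {p : ℕ}
    (hp : p • c ∈ H) : (∑ j ∈ Finset.range p, pt K (j • c)) * (avg K H * t) = 0 := by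
  set w := (∑ j ∈ Finset.range p, pt K (j • c)) * (avg K H * t) with hw
  have hlt : H < H ⊔ AddSubgroup.zmultiples c := by
    refine lt_of_le_of_ne le_sup_left fun h => hc ?_
    rw [h]; exact le_sup_right (a := H) (AddSubgroup.mem_zmultiples c)
  have hH : ∀ x ∈ H, pt K x * w = w := by
    intro x hx
    rw [hw, mul_left_comm, ← mul_assoc (pt K x), pt_mul_avg hx]
  have hcw : pt K c * w = w := by
    have h1 := Finset.sum_range_succ (fun j => pt K (j • c)) p
    rw [Finset.sum_range_succ'] at h1
    have h2 : (∑ j ∈ Finset.range p, pt K ((j + 1) • c)) =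
        pt K c * ∑ j ∈ Finset.range p, pt K (j • c) := by
      rw [Finset.mul_sum]
      refine Finset.sum_congr rfl fun j _ => ?_
      rw [← pt_add, succ_nsmul']
    rw [h2, zero_smul, pt_zero] at h1
    have h3 := congrArg (· * (avg K H * t)) h1
    simp only [add_mul, one_mul] at h3
    rw [← mul_assoc (pt K (p • c)), pt_mul_avg hp, mul_assoc] at h3
    exact add_right_cancel h3
  have hcz : ∀ n : ℤ, pt K (n • c) * w = w := by
    have hneg : pt K (-c) * w = w := by
      conv_lhs => rw [← hcw]
      rw [← mul_assoc, ← pt_add, neg_add_cancel, pt_zero, one_mul]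
    intro n
    induction n with
    | zero => rw [zero_smul, pt_zero, one_mul]
    | succ n ih => rw [add_smul, one_smul, pt_add, mul_assoc, hcw, ih]
    | pred n ih => rw [sub_smul, one_smul, sub_eq_add_neg, pt_add, mul_assoc, hneg, ih]
  have h1 : avg K (H ⊔ AddSubgroup.zmultiples c) * w = w := by
    refine avg_mul_of_invariant hG fun x hx => ?_
    obtain ⟨y, hy, z, ⟨n, rfl⟩, rfl⟩ := AddSubgroup.mem_sup.1 hx
    rw [pt_add, mul_assoc]
    simp only [hcz, hH y hy]
  rw [← h1, hw, mul_left_comm, mul_left_comm (avg K _), hmax _ hlt, mul_zero, mul_zero]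

/-- A finite abelian group in which the elements of each prime order `p` are multiples of any one
of them is cyclic. -/
theorem isAddCyclic_of_prime_torsion {A : Type*} [AddCommGroup A] [Finite A]
    (h : ∀ p : ℕ, p.Prime → ∀ a b : A, a ≠ 0 → p • a = 0 → p • b = 0 →
      b ∈ AddSubgroup.zmultiples a) : IsAddCyclic A := by
  classical
  cases nonempty_fintype A
  have hp : ∀ p : ℕ, p.Prime → (Finset.univ.filter fun a : A => p • a = 0).card ≤ p := by
    intro p hp
    by_cases h0 : ∃ a : A, a ≠ 0 ∧ p • a = 0
    · obtain ⟨a, ha, hpa⟩ := h0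
      calc _ ≤ ((Finset.range p).image fun j => j • a).card := by
            refine Finset.card_le_card fun b hb => ?_
            obtain ⟨n, rfl⟩ := h p hp a b ha hpa (by simpa using hb)
            rw [Finset.mem_image]
            have hp0 : (p : ℤ) ≠ 0 := by exact_mod_cast hp.ne_zero
            refine ⟨(n % p).toNat, ?_, ?_⟩
            · rw [Finset.mem_range, Int.toNat_lt (Int.emod_nonneg _ hp0)]
              exact Int.emod_lt_of_pos _ (by exact_mod_cast hp.pos)
            · rw [← natCast_zsmul, Int.toNat_of_nonneg (Int.emod_nonneg _ hp0)]
              change _ = n • a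
              conv_rhs => rw [← Int.emod_add_mul_ediv n p]
              rw [add_smul, mul_comm, mul_smul, natCast_zsmul, hpa, smul_zero, add_zero]
        _ ≤ p := by simpa using Finset.card_image_le (s := Finset.range p) (f := fun j => j • a)
    · push Not at h0
      calc _ ≤ ({0} : Finset A).card := by
            refine Finset.card_le_card fun b hb => ?_
            by_contra hb0
            exact h0 b (by simpa using hb0) (by simpa using hb)
        _ ≤ p := by simpa using hp.one_lt.le
  refine isAddCyclic_of_card_nsmul_eq_zero_le fun n hn => ?_
  induction n using Nat.strong_induction_on with
  | _ n ih =>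
    rcases Nat.eq_or_lt_of_le (Nat.succ_le_of_lt hn) with h1 | h1
    · subst h1
      have : (Finset.univ.filter fun a : A => Nat.succ 0 • a = 0) ⊆ {0} := fun x => by simp
      simpa using Finset.card_le_card this
    · obtain ⟨p, hpp, m, rfl⟩ := Nat.exists_prime_and_dvd h1.ne'
      have hm : 0 < m := Nat.pos_of_mul_pos_left hn
      have him := ih m (by nlinarith [hpp.two_le]) hm
      calc _ ≤ p * ((Finset.univ.filter fun a : A => (p * m) • a = 0).image (p • ·)).card := by
            refine Finset.card_le_mul_card_image _ _ fun b hb => ?_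
            obtain ⟨a0, ha0, rfl⟩ := Finset.mem_image.1 hb
            refine le_trans ?_ (hp p hpp)
            refine Finset.card_le_card_of_injOn (fun a => a - a0) ?_ ?_
            · intro a ha
              simp only [Finset.coe_filter, Set.mem_ofPred_eq, Finset.mem_filter] at ha ⊢
              simp [smul_sub, ha.2]
            · intro a _ b _ hab; simpa using hab
        _ ≤ p * m := by
            refine Nat.mul_le_mul_left _ (le_trans (Finset.card_le_card ?_) him)
            intro b hb
            obtain ⟨a, ha, rfl⟩ := Finset.mem_image.1 hb
            simp only [Finset.mem_filter, Finset.mem_univ, true_and] at ha ⊢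
            rw [smul_smul, mul_comm, ha]

/-- A nonzero element of the group algebra survives averaging over the kernel of some complex
character, and this kernel can be chosen maximal. -/
theorem exists_addChar_avg_ker_mul_ne_zero (hG : IsUnit (Nat.card G : K))
    {t : AddMonoidAlgebra K G} (ht : t ≠ 0) :
    ∃ (χ : AddChar G ℂ) (H : AddSubgroup G), (∀ x, x ∈ H ↔ χ x = 1) ∧ avg K H * t ≠ 0 ∧
      ∀ L, H < L → avg K L * t = 0 := by
  classical
  obtain ⟨H, hH⟩ : ∃ H : AddSubgroup G, Maximal (fun H => avg K H * t ≠ 0) H := by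
    obtain ⟨H, -, hH⟩ := (Set.toFinite {H : AddSubgroup G | avg K H * t ≠ 0}).exists_le_maximal
      (a := ⊥) (by simpa [avg_bot] using ht)
    exact ⟨H, hH⟩
  have hmax : ∀ L, H < L → avg K L * t = 0 := fun L hL => by
    by_contra h0
    exact hL.not_ge (hH.2 h0 hL.le)
  have hcyc : IsAddCyclic (G ⧸ H) := by
    refine isAddCyclic_of_prime_torsion fun p hp a' b' ha hpa hpb => ?_
    obtain ⟨a, rfl⟩ := QuotientAddGroup.mk_surjective a'
    obtain ⟨b, rfl⟩ := QuotientAddGroup.mk_surjective b'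
    by_contra hb
    have hmem : ∀ x : G, (x : G ⧸ H) = 0 ↔ x ∈ H := fun x => QuotientAddGroup.eq_zero_iff x
    have hcop : ∀ j : ℕ, j ≠ 0 → j < p → ∃ u v : ℤ, u * j + v * p = 1 := by
      intro j hj hjp
      have : IsCoprime (j : ℤ) p := Nat.isCoprime_iff_coprime.2
        ((hp.coprime_iff_not_dvd.2
          (Nat.not_dvd_of_pos_of_lt (Nat.pos_of_ne_zero hj) hjp)).symm)
      exact this
    have hjb : ∀ j : ℕ, j ≠ 0 → j < p →
        ((j • b : G) : G ⧸ H) ∉ AddSubgroup.zmultiples (a : G ⧸ H) := by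
      intro j hj hjp hmemj
      obtain ⟨u, v, huv⟩ := hcop j hj hjp
      apply hb
      have : (b : G ⧸ H) = u • ((j • b : G) : G ⧸ H) + v • (p • (b : G ⧸ H)) := by
        rw [QuotientAddGroup.mk_nsmul, ← natCast_zsmul, ← natCast_zsmul, smul_smul, smul_smul,
          ← add_smul, huv, one_smul]
      rw [this, hpb, smul_zero, add_zero]
      exact AddSubgroup.zsmul_mem _ hmemj u
    have hbz : ∀ j ∈ Finset.range p, j ≠ 0 →
        (∑ i ∈ Finset.range p, pt K (i • j • b)) * (avg K H * t) = 0 := by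
      intro j hj hj0
      refine sum_multiples_mul_eq_zero hG hmax (fun h => ?_) ?_
      · refine hjb j hj0 (Finset.mem_range.1 hj) ?_
        rw [(hmem _).2 h]; exact zero_mem _
      · rw [← hmem, smul_comm, QuotientAddGroup.mk_nsmul, QuotientAddGroup.mk_nsmul, hpb, smul_zero]
    have haz : ∀ i ∈ Finset.range p,
        (∑ j ∈ Finset.range p, pt K (j • (a + i • b))) * (avg K H * t) = 0 := by
      intro i hi
      refine sum_multiples_mul_eq_zero hG hmax (fun h => ?_) ?_
      · by_cases hi0 : i = 0
        · rw [hi0, zero_smul, add_zero] at h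
          exact ha ((hmem a).2 h)
        · refine hjb i hi0 (Finset.mem_range.1 hi) ?_
          have h0 := (hmem _).2 h
          rw [QuotientAddGroup.mk_add, add_eq_zero_iff_neg_eq] at h0
          rw [← h0]
          exact neg_mem (AddSubgroup.mem_zmultiples _)
      · rw [← hmem, smul_add, smul_comm p i b, QuotientAddGroup.mk_add, QuotientAddGroup.mk_nsmul,
          QuotientAddGroup.mk_nsmul, QuotientAddGroup.mk_nsmul, hpa, hpb, smul_zero, add_zero]
    have hsum := Finset.sum_eq_zero haz
    rw [← Finset.sum_mul, Finset.sum_comm, Finset.sum_mul,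
      Finset.sum_eq_single_of_mem 0 (Finset.mem_range.2 hp.pos)] at hsum
    · simp only [zero_smul, pt_zero, Finset.sum_const, Finset.card_range, smul_mul_assoc,
        one_mul] at hsum
      have hpu : IsUnit (p : K) := by
        refine isUnit_of_dvd_unit (Nat.cast_dvd_cast ?_) hG
        have h1 : addOrderOf (a : G ⧸ H) = p := by
          have := Fact.mk hp
          exact addOrderOf_eq_prime hpa ha
        rw [← h1]
        exact (addOrderOf_dvd_natCard _).trans H.card_quotient_dvd_card
      rw [← Nat.cast_smul_eq_nsmul K, hpu.smul_eq_zero] at hsum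
      exact hH.1 hsum
    · intro j hj hj0
      simp only [smul_add, pt_add, ← Finset.mul_sum, mul_assoc]
      have h2 := hbz j hj hj0
      simp only [smul_comm j] at *
      rw [h2, mul_zero]
  have hcard : NeZero (Nat.card (G ⧸ H)) := ⟨Nat.card_pos.ne'⟩
  let e := zmodAddCyclicAddEquiv hcyc
  let ψ : AddChar (ZMod (Nat.card (G ⧸ H))) ℂ := ZMod.stdAddChar
  have hψ : Function.Injective ψ := ZMod.injective_stdAddChar
  refine ⟨ψ.compAddMonoidHom (e.symm.toAddMonoidHom.comp (QuotientAddGroup.mk' H)),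
    H, fun x => ?_, hH.1, hmax⟩
  rw [AddChar.compAddMonoidHom_apply, ← AddChar.map_zero_eq_one ψ, hψ.eq_iff]
  simp

end GroupAlgebra

/-! ### Matrices acting on group algebras -/

section MatrixAction

variable {R : Type*} [Ring R] {ι κ τ : Type*} [Fintype κ] [Fintype τ]
  (D : Type*) [AddCommGroup D] [Module R D]

/-- The action of a matrix over `R` on tuples of elements of an `R`-module. -/
def matHom (M : Matrix ι κ R) : (κ → D) →+ (ι → D) where
  toFun x i := ∑ j, M i j • x j
  map_zero' := by ext; simp
  map_add' x y := by ext; simp [smul_add, Finset.sum_add_distrib]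

variable {D}

theorem matHom_apply (M : Matrix ι κ R) (x : κ → D) (i : ι) :
    matHom D M x i = ∑ j, M i j • x j := rfl

theorem matHom_mul (M : Matrix ι κ R) (N : Matrix κ τ R) :
    matHom D (M * N) = (matHom D M).comp (matHom D N) := by
  ext1 x
  funext i
  simp only [matHom_apply, Matrix.mul_apply, Finset.sum_smul, AddMonoidHom.comp_apply,
    Finset.smul_sum, mul_smul]
  rw [Finset.sum_comm]

theorem matHom_mul_apply (M : Matrix ι κ R) (N : Matrix κ τ R) (x : τ → D) :
    matHom D (M * N) x = matHom D M (matHom D N x) := by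
  rw [matHom_mul]; rfl

theorem matHom_one [Fintype ι] [DecidableEq ι] :
    matHom D (1 : Matrix ι ι R) = AddMonoidHom.id _ := by
  refine AddMonoidHom.ext fun x => funext fun i => ?_
  simp [matHom_apply, Matrix.one_apply]

theorem matHom_add_apply (M N : Matrix ι κ R) (x : κ → D) :
    matHom D (M + N) x = matHom D M x + matHom D N x := by
  funext i
  simp [matHom_apply, add_smul, Finset.sum_add_distrib]

theorem matHom_zero_apply (x : κ → D) : matHom D (0 : Matrix ι κ R) x = 0 := by
  funext i
  simp [matHom_apply]

/-- Matrices preserve the tuples with entries in a submodule. -/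
theorem matHom_mem_pi (X : Submodule R D) (M : Matrix ι κ R) {x : κ → D} (hx : ∀ s, x s ∈ X)
    (i : ι) : matHom D M x i ∈ X :=
  sum_mem fun j _ => X.smul_mem _ (hx j)

variable [Fintype ι] (K : Type*) [CommRing K]

section
variable (R D ι)

/-- The span of the endomorphisms of the group algebra `K[D^ι]` that are induced by the matrices
factoring through `R^k`. -/
noncomputable def facSpan (k : ℕ) : Submodule K (Module.End K (AddMonoidAlgebra K (ι → D))) :=
  Submodule.span K {e | ∃ (Q : Matrix ι (Fin k) R) (P : Matrix (Fin k) ι R),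
    e = (act K (matHom D (Q * P))).toLinearMap}

end

variable (R D) in
/-- The identity of `K[D^ι]` is, for each finite `ι`, a `K`-linear combination of matrices that
factor through `R^k`. Every function on `D^ι` with values in a `K`-module is then a linear
combination, with coefficients not depending on the function, of substitution instances of
functions on `D^k`. -/
def IsUniformlyGenerated (k : ℕ) : Prop :=
  ∀ (ι : Type) [Fintype ι] [DecidableEq ι],
    (1 : Module.End K (AddMonoidAlgebra K (ι → D))) ∈ facSpan R ι D K k

variable {K}

theorem act_matHom_mul (M N : Matrix ι ι R) :
    (act K (matHom D (M * N))).toLinearMap =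
      (act K (matHom D M)).toLinearMap * (act K (matHom D N)).toLinearMap := by
  refine LinearMap.ext fun z => ?_
  simp only [AlgHom.toLinearMap_apply, Module.End.mul_apply, matHom_mul, act_comp]

theorem act_matHom_one [DecidableEq ι] :
    (act K (matHom D (1 : Matrix ι ι R))).toLinearMap = 1 := by
  refine LinearMap.ext fun z => ?_
  simp only [AlgHom.toLinearMap_apply, matHom_one, act_id, Module.End.one_apply]

theorem act_mem_facSpan {k : ℕ} (Q : Matrix ι κ R) (P : Matrix κ ι R) (hk : Fintype.card κ ≤ k) :
    (act K (matHom D (Q * P))).toLinearMap ∈ facSpan R ι D K k := by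
  classical
  obtain ⟨e⟩ : Nonempty (κ ↪ Fin k) :=
    Function.Embedding.nonempty_of_card_le (by simpa using hk)
  let E : Matrix κ (Fin k) R := Matrix.of fun a j => if e a = j then 1 else 0
  have hE : E * E.transpose = 1 := by
    ext a b
    rw [Matrix.mul_apply, Matrix.one_apply]
    simp [E, e.injective.eq_iff]
  refine Submodule.subset_span ⟨Q * E, E.transpose * P, ?_⟩
  rw [← Matrix.mul_assoc, Matrix.mul_assoc Q, hE, Matrix.mul_one]

theorem facSpan_mono {k k' : ℕ} (h : k ≤ k') : facSpan R ι D K k ≤ facSpan R ι D K k' := by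
  refine Submodule.span_le.2 ?_
  rintro _ ⟨Q, P, rfl⟩
  exact act_mem_facSpan Q P (by simpa using h)

theorem IsUniformlyGenerated.mono {k k' : ℕ} (h : k ≤ k') (H : IsUniformlyGenerated R D K k) :
    IsUniformlyGenerated R D K k' := fun ι _ _ => facSpan_mono h (H ι)

theorem one_mem_facSpan_of_card_le [DecidableEq ι] {k : ℕ} (h : Fintype.card ι ≤ k) :
    1 ∈ facSpan R ι D K k := by
  rw [← act_matHom_one (R := R), ← Matrix.mul_one (1 : Matrix ι ι R)]
  exact act_mem_facSpan _ _ h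

theorem act_mul_mem_facSpan {k : ℕ} (M : Matrix ι ι R)
    {e : Module.End K (AddMonoidAlgebra K (ι → D))} (he : e ∈ facSpan R ι D K k) :
    (act K (matHom D M)).toLinearMap * e ∈ facSpan R ι D K k := by
  induction he using Submodule.span_induction with
  | mem _ h =>
    obtain ⟨Q, P, rfl⟩ := h
    rw [← act_matHom_mul, ← Matrix.mul_assoc]
    exact Submodule.subset_span ⟨_, _, rfl⟩
  | zero => rw [mul_zero]; exact zero_mem _
  | add a b _ _ ha hb => rw [mul_add]; exact add_mem ha hb
  | smul c a _ ha => rw [mul_smul_comm]; exact Submodule.smul_mem _ _ ha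

theorem mul_act_mem_facSpan {k : ℕ} (M : Matrix ι ι R)
    {e : Module.End K (AddMonoidAlgebra K (ι → D))} (he : e ∈ facSpan R ι D K k) :
    e * (act K (matHom D M)).toLinearMap ∈ facSpan R ι D K k := by
  induction he using Submodule.span_induction with
  | mem _ h =>
    obtain ⟨Q, P, rfl⟩ := h
    rw [← act_matHom_mul, Matrix.mul_assoc]
    exact Submodule.subset_span ⟨_, _, rfl⟩
  | zero => rw [zero_mul]; exact zero_mem _
  | add a b _ _ ha hb => rw [add_mul]; exact add_mem ha hb
  | smul c a _ ha => rw [smul_mul_assoc]; exact Submodule.smul_mem _ _ ha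

theorem mul_mem_facSpan {k : ℕ} {e e' : Module.End K (AddMonoidAlgebra K (ι → D))}
    (he : e ∈ facSpan R ι D K k) (he' : e' ∈ facSpan R ι D K k) :
    e * e' ∈ facSpan R ι D K k := by
  induction he using Submodule.span_induction with
  | mem _ h =>
    obtain ⟨Q, P, rfl⟩ := h
    exact act_mul_mem_facSpan _ he'
  | zero => rw [zero_mul]; exact zero_mem _
  | add a b _ _ ha hb => rw [add_mul]; exact add_mem ha hb
  | smul c a _ ha => rw [smul_mul_assoc]; exact Submodule.smul_mem _ _ ha

theorem one_sub_mul_mem_facSpan {k : ℕ} {δ δ' : Module.End K (AddMonoidAlgebra K (ι → D))}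
    (h : 1 - δ ∈ facSpan R ι D K k) (h' : 1 - δ' ∈ facSpan R ι D K k) :
    1 - δ * δ' ∈ facSpan R ι D K k := by
  have : 1 - δ * δ' = (1 - δ) + (1 - δ') - (1 - δ) * (1 - δ') := by
    simp only [mul_sub, sub_mul, mul_one, one_mul]; abel
  rw [this]
  exact sub_mem (add_mem h h') (mul_mem_facSpan h h')

theorem one_sub_prod_mem_facSpan {k : ℕ} (L : List (Module.End K (AddMonoidAlgebra K (ι → D))))
    (h : ∀ δ ∈ L, 1 - δ ∈ facSpan R ι D K k) : 1 - L.prod ∈ facSpan R ι D K k := by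
  induction L with
  | nil => simp
  | cons a L ih =>
    rw [List.prod_cons]
    exact one_sub_mul_mem_facSpan (h a (by simp)) (ih fun δ hδ => h δ (by simp [hδ]))

/-- A subspace that is invariant under all matrices is invariant under `facSpan`. -/
theorem facSpan_apply_mem {k : ℕ} {W : Submodule K (AddMonoidAlgebra K (ι → D))}
    (hW : ∀ M : Matrix ι ι R, ∀ z ∈ W, act K (matHom D M) z ∈ W)
    {e : Module.End K (AddMonoidAlgebra K (ι → D))} (he : e ∈ facSpan R ι D K k)
    {z : AddMonoidAlgebra K (ι → D)} (hz : z ∈ W) : e z ∈ W := by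
  induction he using Submodule.span_induction with
  | mem _ h =>
    obtain ⟨Q, P, rfl⟩ := h
    exact hW _ z hz
  | zero => exact zero_mem _
  | add a b _ _ ha hb => exact add_mem ha hb
  | smul c a _ ha => exact Submodule.smul_mem _ _ ha

/-- If the operators `δ j` preserve all the subspaces `W i`, and `δ i` kills `W i`, then a product
of the operators kills `W i` if `δ i` is one of the factors. -/
theorem prod_map_apply_eq_zero {V I : Type*} [AddCommGroup V] [Module K V] (L : List I)
    (δ : I → Module.End K V) (W : I → Submodule K V)
    (hW : ∀ i j, ∀ z ∈ W i, δ j z ∈ W i) (hk : ∀ i, ∀ z ∈ W i, δ i z = 0) {i : I} (hi : i ∈ L)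
    {z : V} (hz : z ∈ W i) : (L.map δ).prod z = 0 := by
  induction L generalizing i z with
  | nil => simp at hi
  | cons a L ih =>
    rw [List.map_cons, List.prod_cons, Module.End.mul_apply]
    rcases List.mem_cons.1 hi with rfl | hi
    · refine hk i _ ?_
      clear ih hi
      induction L with
      | nil => simpa
      | cons b L ih => rw [List.map_cons, List.prod_cons, Module.End.mul_apply]; exact hW _ _ _ ih
    · rw [ih hi hz, map_zero]

end MatrixAction

/-! ### Operators supported on the matrices of given rank -/

section Kovacs

variable {F : Type*} [Field F] {K : Type*} [CommRing K]

/-- The conditions on the coefficients `c` of an element `ε = ∑ c θ [θ]` of the monoid algebra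
`K[Mₘ(F)]` expressing that `ε` is invariant under conjugation, is congruent to `1` modulo the span
of the singular matrices, and satisfies `ε [θ] = 0` for all singular matrices `θ`. -/
structure IsSingularAnnihilator [Fintype F] {m : ℕ} (c : Matrix (Fin m) (Fin m) F → K) :
    Prop where
  conj : ∀ g g' θ, g * g' = 1 → c (g * θ * g') = c θ
  unit : ∀ θ θ', θ * θ' = 1 → θ ≠ 1 → c θ = 0
  one : c 1 = 1
  sum : ∀ v : Fin m → F, v ≠ 0 → ∀ θ, ∑ s : Fin m → F, c (θ + Matrix.vecMulVec s v) = 0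

variable {ι : Type*} [Fintype ι]

/-- `M = Q * P` is a full rank factorization of `M` through `F^j`. -/
def IsFullRankFactorization {j : ℕ} (M : Matrix ι ι F) (Q : Matrix ι (Fin j) F)
    (P : Matrix (Fin j) ι F) : Prop :=
  M = Q * P ∧ (∃ Q' : Matrix (Fin j) ι F, Q' * Q = 1) ∧ ∃ P' : Matrix ι (Fin j) F, P * P' = 1

open Classical in
/-- For a matrix `M` of rank `j`, the value of the class function `c` at the endomorphism that `M`
induces on its image; zero if `M` does not have rank `j`. -/
noncomputable def rankCoeff {j : ℕ} (c : Matrix (Fin j) (Fin j) F → K) (M : Matrix ι ι F) : K :=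
  if h : ∃ QP : Matrix ι (Fin j) F × Matrix (Fin j) ι F, IsFullRankFactorization M QP.1 QP.2 then
    c (h.choose.2 * h.choose.1) else 0

variable {j : ℕ} {c : Matrix (Fin j) (Fin j) F → K}

theorem rankCoeff_eq [Fintype F] (hc : IsSingularAnnihilator c) {M : Matrix ι ι F}
    {Q : Matrix ι (Fin j) F} {P : Matrix (Fin j) ι F} (h : IsFullRankFactorization M Q P) :
    rankCoeff c M = c (P * Q) := by
  classical
  have hex : ∃ QP : Matrix ι (Fin j) F × Matrix (Fin j) ι F,
    IsFullRankFactorization M QP.1 QP.2 := ⟨(Q, P), h⟩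
  rw [rankCoeff, dif_pos hex]
  obtain ⟨h1, ⟨Ql, hQl⟩, ⟨Pr, hPr⟩⟩ := h
  obtain ⟨h1', ⟨Ql', hQl'⟩, ⟨Pr', hPr'⟩⟩ := hex.choose_spec
  set Q' := hex.choose.1
  set P' := hex.choose.2
  have hM : Q * P = Q' * P' := h1.symm.trans h1'
  have hQ' : Q * (P * Pr') = Q' := by
    rw [← Matrix.mul_assoc, hM, Matrix.mul_assoc, hPr', Matrix.mul_one]
  have hP' : (Ql' * Q) * P = P' := by
    rw [Matrix.mul_assoc, hM, ← Matrix.mul_assoc, hQl', Matrix.one_mul]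
  have hg : (Ql' * Q) * (P * Pr') = 1 := by
    rw [Matrix.mul_assoc, hQ', hQl']
  rw [← hQ', ← hP', ← hc.conj (Ql' * Q) (P * Pr') (P * Q) hg]
  simp only [Matrix.mul_assoc]

theorem exists_factorization_of_rankCoeff_ne_zero {M : Matrix ι ι F} (h : rankCoeff c M ≠ 0) :
    ∃ Q P, IsFullRankFactorization (j := j) M Q P := by
  by_contra h0
  push Not at h0
  apply h
  rw [rankCoeff, dif_neg]
  rintro ⟨QP, hQP⟩
  exact h0 _ _ hQP

theorem rankCoeff_conj [Fintype F] [DecidableEq ι] (hc : IsSingularAnnihilator c)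
    {g g' : Matrix ι ι F} (hg : g' * g = 1) (M : Matrix ι ι F) :
    rankCoeff c (g * M * g') = rankCoeff c M := by
  have key : ∀ (g g' M : Matrix ι ι F), g' * g = 1 → rankCoeff c M ≠ 0 →
      rankCoeff c (g * M * g') = rankCoeff c M := by
    intro g g' M hg hM
    obtain ⟨Q, P, h⟩ := exists_factorization_of_rankCoeff_ne_zero hM
    have h' : IsFullRankFactorization (g * M * g') (g * Q) (P * g') := by
      obtain ⟨h1, ⟨Ql, hQl⟩, ⟨Pr, hPr⟩⟩ := h
      refine ⟨by rw [h1]; simp only [Matrix.mul_assoc], ⟨Ql * g', ?_⟩, ⟨g * Pr, ?_⟩⟩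
      · rw [Matrix.mul_assoc, ← Matrix.mul_assoc g', hg, Matrix.one_mul, hQl]
      · rw [Matrix.mul_assoc, ← Matrix.mul_assoc g', hg, Matrix.one_mul, hPr]
    rw [rankCoeff_eq hc h, rankCoeff_eq hc h', Matrix.mul_assoc, ← Matrix.mul_assoc g', hg,
      Matrix.one_mul]
  by_cases hM : rankCoeff c M = 0
  · by_contra h0
    have hg' := mul_eq_one_comm.1 hg
    have h1 := key g' g (g * M * g') hg' (fun h => h0 (by rw [h, hM]))
    rw [← h1] at h0
    apply h0
    congr 1
    rw [Matrix.mul_assoc, Matrix.mul_assoc, Matrix.mul_assoc, hg, Matrix.mul_one,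
      ← Matrix.mul_assoc, hg, Matrix.one_mul]
  · exact key g g' M hg hM

/-- The column condition of `IsSingularAnnihilator`, applied to one row of `Y` and averaged over
the other ones. -/
theorem IsSingularAnnihilator.sum_mul [Fintype F] [DecidableEq ι] (hF : IsUnit (Fintype.card F : K))
    (hc : IsSingularAnnihilator c) {Y : Matrix ι (Fin j) F} (hY : Y ≠ 0)
    (θ : Matrix (Fin j) (Fin j) F) : ∑ S : Matrix (Fin j) ι F, c (θ + S * Y) = 0 := by
  obtain ⟨i, hi⟩ : ∃ i, Y i ≠ 0 := by
    by_contra h0; push Not at h0; exact hY (funext h0)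
  have h1 : ∀ s : Fin j → F, ∑ S : Matrix (Fin j) ι F, c (θ + S * Y) =
      ∑ S : Matrix (Fin j) ι F, c (θ + S * Y + Matrix.vecMulVec s (Y i)) := by
    intro s
    refine (Fintype.sum_equiv (Equiv.addRight (Matrix.vecMulVec s (Pi.single i 1))) _ _
      fun S => ?_).symm
    rw [Equiv.coe_addRight, Matrix.add_mul, Matrix.vecMulVec_mul, Matrix.single_one_vecMul,
      add_assoc]
    rfl
  have h2 : Fintype.card (Fin j → F) • ∑ S : Matrix (Fin j) ι F, c (θ + S * Y) = 0 := by
    rw [← Finset.card_univ, ← Finset.sum_const, Finset.sum_congr rfl fun s _ => h1 s,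
      Finset.sum_comm]
    exact Finset.sum_eq_zero fun S _ => hc.sum _ hi _
  rw [← Nat.cast_smul_eq_nsmul K, IsUnit.smul_eq_zero] at h2
  · exact h2
  · rw [Fintype.card_fun, Nat.cast_pow]; exact hF.pow _

/-- The left inverses of a matrix. -/
def leftInverses [Fintype F] [DecidableEq F] [DecidableEq ι] (x : Matrix ι (Fin j) F) :
    Finset (Matrix (Fin j) ι F) :=
  Finset.univ.filter fun P => P * x = 1

theorem mem_leftInverses [Fintype F] [DecidableEq F] [DecidableEq ι] {x : Matrix ι (Fin j) F}
    {P : Matrix (Fin j) ι F} : P ∈ leftInverses x ↔ P * x = 1 := by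
  simp [leftInverses]

/-- The number of left inverses of a matrix depends only on its size. -/
theorem card_leftInverse [Fintype F] [DecidableEq F] [DecidableEq ι] {x : Matrix ι (Fin j) F}
    {P₀ : Matrix (Fin j) ι F} (hP₀ : P₀ * x = 1) :
    (leftInverses x).card * Fintype.card F ^ (j * j) = Fintype.card F ^ (j * Fintype.card ι) := by
  have h1 : ∀ θ : Matrix (Fin j) (Fin j) F,
      (Finset.univ.filter fun P : Matrix (Fin j) ι F => P * x = θ).card =
        (Finset.univ.filter fun P : Matrix (Fin j) ι F => P * x = 1).card := by
    intro θ
    refine Finset.card_bij' (fun P _ => P - θ * P₀ + P₀) (fun P _ => P - P₀ + θ * P₀)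
      ?_ ?_ ?_ ?_
    · intro P hP
      simp only [Finset.mem_filter, Finset.mem_univ, true_and] at hP ⊢
      rw [Matrix.add_mul, Matrix.sub_mul, Matrix.mul_assoc, hP₀, hP, Matrix.mul_one, sub_self,
        zero_add]
    · intro P hP
      simp only [Finset.mem_filter, Finset.mem_univ, true_and] at hP ⊢
      rw [Matrix.add_mul, Matrix.sub_mul, Matrix.mul_assoc, hP₀, hP, Matrix.mul_one, sub_self,
        zero_add]
    · intro P _; abel
    · intro P _; abel
  have h2 := Finset.card_eq_sum_card_fiberwise (s := (Finset.univ : Finset (Matrix (Fin j) ι F)))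
    (t := Finset.univ) (f := fun P => P * x) (fun _ _ => Finset.mem_coe.2 (Finset.mem_univ _))
  rw [Finset.sum_congr rfl (fun θ _ => h1 θ), Finset.sum_const, Finset.card_univ,
    Finset.card_univ] at h2
  rw [← Fintype.card_congr (Matrix.of (m := Fin j) (n := ι) (α := F)),
    ← Fintype.card_congr (Matrix.of (m := Fin j) (n := Fin j) (α := F)), Fintype.card_fun,
    Fintype.card_fun, Fintype.card_fun, Fintype.card_fun, Fintype.card_fin, ← pow_mul, ← pow_mul,
    smul_eq_mul] at h2
  rw [mul_comm j (Fintype.card ι), h2, mul_comm]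
  rfl

/-- The sum of the coefficients of the matrices of rank `j` that map `x` to `y`, for matrices `x`
and `y` with `j` columns and full rank. -/
theorem sum_rankCoeff [Fintype F] [DecidableEq F] [DecidableEq ι] (hF : IsUnit (Fintype.card F : K))
    (hc : IsSingularAnnihilator c) {x y : Matrix ι (Fin j) F} {P₀ : Matrix (Fin j) ι F}
    (hP₀ : P₀ * x = 1) {y' : Matrix (Fin j) ι F} (hy : y' * y = 1) :
    ∑ M : Matrix ι ι F with M * x = y, rankCoeff c M =
      if y = x then ((leftInverses x).card : K) else 0 := by
  have h1 : ∑ M : Matrix ι ι F with M * x = y, rankCoeff c M =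
      ∑ P ∈ leftInverses x, c (P * y) := by
    symm
    refine Finset.sum_bij_ne_zero (fun P _ _ => y * P) ?_ ?_ ?_ ?_
    · intro P hP _
      simp only [Finset.mem_filter, Finset.mem_univ, true_and, mem_leftInverses] at hP ⊢
      rw [Matrix.mul_assoc, hP, Matrix.mul_one]
    · intro P _ _ P' _ _ h
      rw [← Matrix.one_mul P, ← hy, Matrix.mul_assoc, h, ← Matrix.mul_assoc, hy, Matrix.one_mul]
    · intro M hM hM0
      obtain ⟨Q, P, hM1, ⟨Ql, hQ⟩, ⟨Pr, hP⟩⟩ := exists_factorization_of_rankCoeff_ne_zero hM0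
      simp only [Finset.mem_filter, Finset.mem_univ, true_and] at hM
      have h2 : (y' * Q) * (P * x) = 1 := by
        rw [Matrix.mul_assoc, ← Matrix.mul_assoc Q, ← hM1, hM, hy]
      have h3 := mul_eq_one_comm.1 h2
      have h4 : M = y * (y' * Q * P) := by
        calc M = Q * ((P * x) * (y' * Q)) * P := by rw [h3, Matrix.mul_one, hM1]
          _ = (Q * P * x) * (y' * Q * P) := by simp only [Matrix.mul_assoc]
          _ = _ := by rw [← hM1, hM]
      have h5 : (y' * Q * P) * x = 1 := by rw [Matrix.mul_assoc, h2]
      refine ⟨y' * Q * P, mem_leftInverses.2 h5, ?_, h4.symm⟩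
      have h6 := rankCoeff_eq hc (M := M) ⟨h4, ⟨y', hy⟩, ⟨x, h5⟩⟩
      rwa [← h6]
    · intro P hP _
      rw [mem_leftInverses] at hP
      exact (rankCoeff_eq hc ⟨rfl, ⟨y', hy⟩, ⟨x, hP⟩⟩).symm
  rw [h1]
  set Y := y - x * (P₀ * y) with hYdef
  by_cases hY : Y = 0
  · have hyx : y = x * (P₀ * y) := sub_eq_zero.1 hY
    have h2 : ∀ P : Matrix (Fin j) ι F, P * x = 1 → P * y = P₀ * y := by
      intro P hP
      conv_lhs => rw [hyx]
      rw [← Matrix.mul_assoc, hP, Matrix.one_mul]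
    rw [Finset.sum_congr rfl (g := fun _ => c (P₀ * y)), Finset.sum_const]
    · have h3 : (P₀ * y) * (y' * x) = 1 := by
        rw [mul_eq_one_comm, Matrix.mul_assoc, ← hyx, hy]
      by_cases h4 : P₀ * y = 1
      · rw [if_pos (by rw [hyx, h4, Matrix.mul_one]), h4, hc.one, nsmul_one]
      · rw [if_neg (fun h => h4 (by rw [h, hP₀])), hc.unit _ _ h3 h4, smul_zero]
    · intro P hP
      rw [h2 P (mem_leftInverses.1 hP)]
  · rw [if_neg (fun h => hY (by rw [hYdef, h, hP₀, Matrix.mul_one, sub_self]))]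
    -- The set of left inverses of `x` is invariant under all translations by `S * (1 - x * P₀)`.
    have h2 : ∀ S : Matrix (Fin j) ι F,
        ∑ P ∈ leftInverses x, c (P * y) =
          ∑ P ∈ leftInverses x, c (P * y + S * Y) := by
      intro S
      have h3 : (S - S * (x * P₀)) * x = 0 := by
        rw [Matrix.sub_mul, Matrix.mul_assoc, Matrix.mul_assoc x, hP₀, Matrix.mul_one, sub_self]
      refine Finset.sum_bij' (fun P _ => P - (S - S * (x * P₀))) (fun P _ => P + (S - S * (x * P₀)))
        ?_ ?_ ?_ ?_ ?_
      · intro P hP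
        rw [mem_leftInverses] at hP ⊢
        rw [Matrix.sub_mul, h3, hP, sub_zero]
      · intro P hP
        rw [mem_leftInverses] at hP ⊢
        rw [Matrix.add_mul, h3, hP, add_zero]
      · intro P _; abel
      · intro P _; abel
      · intro P _
        congr 1
        rw [hYdef, Matrix.sub_mul, Matrix.sub_mul, Matrix.mul_sub, Matrix.mul_assoc S,
          Matrix.mul_assoc x]
        abel
    have h3 : Fintype.card (Matrix (Fin j) ι F) •
        ∑ P ∈ leftInverses x, c (P * y) = 0 := by
      rw [← Finset.card_univ, ← Finset.sum_const, Finset.sum_congr rfl fun S _ => h2 S,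
        Finset.sum_comm]
      exact Finset.sum_eq_zero fun P _ => hc.sum_mul hF hY _
    rw [← Nat.cast_smul_eq_nsmul K, IsUnit.smul_eq_zero] at h3
    · exact h3
    · rw [← Fintype.card_congr (Matrix.of (m := Fin j) (n := ι) (α := F)), Fintype.card_fun,
        Fintype.card_fun, ← pow_mul, Nat.cast_pow]
      exact hF.pow _

variable (ι) (D : Type*) [AddCommGroup D] [Module F D]

/-- The `K`-linear combination of the matrices of rank `j` that acts as the identity on the
matrices with `j` columns and full rank, up to matrices of smaller rank. The normalizing factor is
the inverse of the number of left inverses of such a matrix. -/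
noncomputable def rankOp [Fintype F] [DecidableEq ι] {j : ℕ} (c : Matrix (Fin j) (Fin j) F → K) :
    Module.End K (AddMonoidAlgebra K (ι → D)) :=
  (Ring.inverse ((Fintype.card F : K) ^ (j * Fintype.card ι)) * (Fintype.card F : K) ^ (j * j)) •
    ∑ M : Matrix ι ι F, rankCoeff c M • (act K (matHom D M)).toLinearMap

theorem rankOp_mem_facSpan [Fintype F] [DecidableEq ι] : rankOp ι D c ∈ facSpan F ι D K j := by
  refine Submodule.smul_mem _ _ (sum_mem fun M _ => ?_)
  by_cases hM : rankCoeff c M = 0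
  · rw [hM, zero_smul]; exact zero_mem _
  · obtain ⟨Q, P, rfl, -⟩ := exists_factorization_of_rankCoeff_ne_zero hM
    exact Submodule.smul_mem _ _ (Submodule.subset_span ⟨Q, P, rfl⟩)

variable {ι D}

variable (K) in
/-- A matrix with `n` columns, as a basis element of the group algebra of `(F^n)^ι`. -/
noncomputable def matPt {n : ℕ} (X : Matrix ι (Fin n) F) : AddMonoidAlgebra K (ι → Fin n → F) :=
  pt K fun i j => X i j

theorem act_matPt {n : ℕ} (M : Matrix ι ι F) (X : Matrix ι (Fin n) F) :
    act K (matHom (Fin n → F) M) (matPt K X) = matPt K (M * X) := by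
  rw [matPt, act_pt, matPt]
  congr 1
  funext i j
  simp [matHom_apply, Matrix.mul_apply]

theorem rankOp_apply_sub_mem [Fintype F] [DecidableEq ι] (hF : IsUnit (Fintype.card F : K))
    (hc : IsSingularAnnihilator c) {x : Matrix ι (Fin j) F} {P₀ : Matrix (Fin j) ι F}
    (hP₀ : P₀ * x = 1) :
    rankOp ι (Fin j → F) c (matPt K x) - matPt K x ∈
      Submodule.span K (matPt K '' {y : Matrix ι (Fin j) F |
        ¬ ∃ y' : Matrix (Fin j) ι F, y' * y = 1}) := by
  classical
  set u := Ring.inverse ((Fintype.card F : K) ^ (j * Fintype.card ι)) *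
    (Fintype.card F : K) ^ (j * j) with hu
  have h1 : rankOp ι (Fin j → F) c (matPt K x) =
      ∑ y : Matrix ι (Fin j) F, (u * ∑ M : Matrix ι ι F with M * x = y, rankCoeff c M) •
        matPt K y := by
    simp only [rankOp, LinearMap.smul_apply, LinearMap.sum_apply, AlgHom.toLinearMap_apply,
      act_matPt, ← hu, mul_smul u, Finset.sum_smul, ← Finset.smul_sum]
    congr 1
    rw [← Finset.sum_fiberwise (s := Finset.univ) (g := fun M : Matrix ι ι F => M * x)]
    refine Finset.sum_congr rfl fun y _ => Finset.sum_congr rfl fun M hM => ?_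
    rw [← (Finset.mem_filter.1 hM).2]
  have h2 : u * ((leftInverses x).card : K) = 1 := by
    rw [hu, mul_assoc, mul_comm (_ ^ (j * j)), ← Nat.cast_pow _ (j * j), ← Nat.cast_mul,
      card_leftInverse hP₀, Nat.cast_pow, Ring.inverse_mul_cancel _ (hF.pow _)]
  rw [h1, ← Finset.sum_erase_add _ _ (Finset.mem_univ x), sum_rankCoeff hF hc hP₀ hP₀, if_pos rfl,
    h2, one_smul, add_sub_cancel_right]
  refine sum_mem fun y hy => ?_
  by_cases h3 : ∃ y' : Matrix (Fin j) ι F, y' * y = 1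
  · obtain ⟨y', hy'⟩ := h3
    rw [sum_rankCoeff hF hc hP₀ hy', if_neg (Finset.ne_of_mem_erase hy), mul_zero, zero_smul]
    exact zero_mem _
  · exact Submodule.smul_mem _ _ (Submodule.subset_span ⟨y, h3, rfl⟩)

/-- A matrix with `j` columns that has no left inverse factors through `F^r` for some `r < j`. -/
theorem exists_factorization_of_no_leftInverse [DecidableEq ι] {y : Matrix ι (Fin j) F}
    (hy : ¬ ∃ y' : Matrix (Fin j) ι F, y' * y = 1) :
    ∃ r < j, ∃ (Y : Matrix ι (Fin r) F) (Z : Matrix (Fin r) (Fin j) F), y = Y * Z := by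
  set f := Matrix.toLin' y with hf
  have hker : ¬ LinearMap.ker f = ⊥ := by
    intro h
    obtain ⟨g, hg⟩ := f.exists_leftInverse_of_injective h
    refine hy ⟨LinearMap.toMatrix' g, ?_⟩
    rw [← LinearMap.toMatrix'_toLin' y, ← hf, ← LinearMap.toMatrix'_comp, hg,
      LinearMap.toMatrix'_id]
  have hr : Module.finrank F (LinearMap.range f) < j := by
    have h1 := f.finrank_range_add_finrank_ker
    have h2 : 0 < Module.finrank F (LinearMap.ker f) :=
      Nat.pos_of_ne_zero fun h => hker (Submodule.finrank_eq_zero.1 h)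
    rw [Module.finrank_fin_fun] at h1
    omega
  let e : LinearMap.range f ≃ₗ[F] (Fin (Module.finrank F (LinearMap.range f)) → F) :=
    (Module.finBasis F (LinearMap.range f)).equivFun
  refine ⟨_, hr, LinearMap.toMatrix' ((LinearMap.range f).subtype ∘ₗ e.symm.toLinearMap),
    LinearMap.toMatrix' (e.toLinearMap ∘ₗ f.rangeRestrict), ?_⟩
  rw [← LinearMap.toMatrix'_comp, ← LinearMap.toMatrix'_toLin' y]
  congr 1
  refine LinearMap.ext fun v => ?_
  simp [hf]

variable (K ι F) in
/-- The span of the matrices with `n` columns and rank less than `j`. -/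
noncomputable def rankSpan (n j : ℕ) : Submodule K (AddMonoidAlgebra K (ι → Fin n → F)) :=
  Submodule.span K {z | ∃ r < j, ∃ (Y : Matrix ι (Fin r) F) (Z : Matrix (Fin r) (Fin n) F),
    z = matPt K (Y * Z)}

theorem rankSpan_act_mem {n j : ℕ} (M : Matrix ι ι F) {z : AddMonoidAlgebra K (ι → Fin n → F)}
    (hz : z ∈ rankSpan F K ι n j) : act K (matHom _ M) z ∈ rankSpan F K ι n j := by
  induction hz using Submodule.span_induction with
  | mem _ h =>
    obtain ⟨r, hr, Y, Z, rfl⟩ := h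
    rw [act_matPt, ← Matrix.mul_assoc]
    exact Submodule.subset_span ⟨r, hr, _, _, rfl⟩
  | zero => rw [map_zero]; exact zero_mem _
  | add a b _ _ ha hb => rw [map_add]; exact add_mem ha hb
  | smul c a _ ha => rw [map_smul]; exact Submodule.smul_mem _ _ ha

/-- Right multiplication by a matrix. -/
def mulRightHom {n n' : ℕ} (Z : Matrix (Fin n) (Fin n') F) :
    (ι → Fin n → F) →+ (ι → Fin n' → F) where
  toFun x i j := ∑ a, x i a * Z a j
  map_zero' := by ext; simp
  map_add' x y := by ext; simp [add_mul, Finset.sum_add_distrib]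

theorem act_mulRightHom {κ : Type*} {n n' : ℕ} (Z : Matrix (Fin n) (Fin n') F)
    (X : Matrix κ (Fin n) F) :
    act K (mulRightHom Z) (matPt K X) = matPt K (X * Z) := by
  rw [matPt, act_pt, matPt]
  rfl

theorem matHom_comp_mulRightHom {n n' : ℕ} (M : Matrix ι ι F) (Z : Matrix (Fin n) (Fin n') F) :
    (matHom (Fin n' → F) M).comp (mulRightHom Z) = (mulRightHom Z).comp (matHom (Fin n → F) M) := by
  refine AddMonoidHom.ext fun x => funext fun i => funext fun a => ?_
  simp only [AddMonoidHom.comp_apply, matHom_apply, mulRightHom, AddMonoidHom.coe_mk,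
    ZeroHom.coe_mk, Finset.sum_apply, Pi.smul_apply, smul_eq_mul, Finset.mul_sum, Finset.sum_mul,
    mul_assoc]
  rw [Finset.sum_comm]

theorem rankOp_act_mulRightHom [Fintype F] [DecidableEq ι] {n n' : ℕ}
    (Z : Matrix (Fin n) (Fin n') F)
    (z : AddMonoidAlgebra K (ι → Fin n → F)) :
    rankOp ι (Fin n' → F) c (act K (mulRightHom Z) z) =
      act K (mulRightHom Z) (rankOp ι (Fin n → F) c z) := by
  simp only [rankOp, LinearMap.smul_apply, LinearMap.sum_apply, AlgHom.toLinearMap_apply, map_smul,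
    map_sum, ← act_comp, matHom_comp_mulRightHom]

/-- The operator `rankOp` acts as the identity on matrices of rank at most `j`, up to matrices of
rank less than `j`. -/
theorem sub_rankOp_mem [Fintype F] [DecidableEq ι] (hF : IsUnit (Fintype.card F : K))
    (hc : IsSingularAnnihilator c) {n : ℕ} {z : AddMonoidAlgebra K (ι → Fin n → F)}
    (hz : z ∈ rankSpan F K ι n (j + 1)) :
    (1 - rankOp ι (Fin n → F) c) z ∈ rankSpan F K ι n j := by
  have hlow : ∀ z ∈ rankSpan F K ι n j, (1 - rankOp ι (Fin n → F) c) z ∈ rankSpan F K ι n j :=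
    fun z hz => sub_mem hz
      (facSpan_apply_mem (fun M z hz => rankSpan_act_mem M hz) (rankOp_mem_facSpan ι _) hz)
  induction hz using Submodule.span_induction with
  | mem _ h =>
    obtain ⟨r, hr, Y, Z, rfl⟩ := h
    rcases Nat.lt_succ_iff_lt_or_eq.1 hr with hr | rfl
    · exact hlow _ (Submodule.subset_span ⟨r, hr, Y, Z, rfl⟩)
    · by_cases hY : ∃ Y' : Matrix (Fin r) ι F, Y' * Y = 1
      · obtain ⟨Y', hY'⟩ := hY
        have h1 := rankOp_apply_sub_mem hF hc hY'
        rw [LinearMap.sub_apply, Module.End.one_apply, ← act_mulRightHom, rankOp_act_mulRightHom,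
          ← map_sub, ← neg_sub, map_neg]
        refine neg_mem ?_
        generalize rankOp ι (Fin r → F) c (matPt K Y) - matPt K Y = w at h1 ⊢
        induction h1 using Submodule.span_induction with
        | mem _ h =>
          obtain ⟨y, hy, rfl⟩ := h
          obtain ⟨s, hs, A, B, rfl⟩ := exists_factorization_of_no_leftInverse hy
          rw [act_mulRightHom, Matrix.mul_assoc]
          exact Submodule.subset_span ⟨s, hs, _, _, rfl⟩
        | zero => rw [map_zero]; exact zero_mem _
        | add a b _ _ ha hb => rw [map_add]; exact add_mem ha hb
        | smul c a _ ha => rw [map_smul]; exact Submodule.smul_mem _ _ ha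
      · obtain ⟨s, hs, A, B, rfl⟩ := exists_factorization_of_no_leftInverse hY
        refine hlow _ (Submodule.subset_span ⟨s, hs, A, B * Z, ?_⟩)
        rw [Matrix.mul_assoc]
  | zero => rw [map_zero]; exact zero_mem _
  | add a b _ _ ha hb => rw [map_add]; exact add_mem ha hb
  | smul c a _ ha => rw [map_smul]; exact Submodule.smul_mem _ _ ha

variable (ι D) in
/-- The product of the operators `1 - rankOp` for the ranks less than `j`. -/
noncomputable def singularOp [Fintype F] [DecidableEq ι] (c : ∀ j, Matrix (Fin j) (Fin j) F → K) :
    ℕ → Module.End K (AddMonoidAlgebra K (ι → D))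
  | 0 => 1
  | j + 1 => singularOp c j * (1 - rankOp ι D (c j))

theorem singularOp_apply_eq_zero [Fintype F] [DecidableEq ι] (hF : IsUnit (Fintype.card F : K))
    (c : ∀ j, Matrix (Fin j) (Fin j) F → K) {n : ℕ} (j : ℕ)
    (hc : ∀ i < j, IsSingularAnnihilator (c i)) {z : AddMonoidAlgebra K (ι → Fin n → F)}
    (hz : z ∈ rankSpan F K ι n j) : singularOp ι (Fin n → F) c j z = 0 := by
  induction j generalizing z with
  | zero =>
    have : rankSpan F K ι n 0 = ⊥ := by
      rw [rankSpan, Submodule.span_eq_bot]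
      rintro _ ⟨r, hr, -⟩
      exact absurd hr r.not_lt_zero
    rw [this, Submodule.mem_bot] at hz
    rw [hz, map_zero]
  | succ j ih =>
    rw [singularOp, Module.End.mul_apply]
    exact ih (fun i hi => hc i (hi.trans j.lt_succ_self))
      (sub_rankOp_mem hF (hc j j.lt_succ_self) hz)

theorem one_sub_singularOp_mem_facSpan [Fintype F] [DecidableEq ι]
    (c : ∀ j, Matrix (Fin j) (Fin j) F → K)
    (j : ℕ) : 1 - singularOp ι D c (j + 1) ∈ facSpan F ι D K j := by
  have h : ∀ i ≤ j + 1, 1 - singularOp ι D c i ∈ facSpan F ι D K j := by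
    intro i hi
    induction i with
    | zero => rw [singularOp, sub_self]; exact zero_mem _
    | succ i ih =>
      refine one_sub_mul_mem_facSpan (ih (by omega)) ?_
      rw [sub_sub_cancel]
      exact facSpan_mono (by omega) (rankOp_mem_facSpan ι D)
  exact h _ le_rfl

end Kovacs

/-! ### Powers of finite fields -/

section KovacsExistence

variable {F : Type*} [Field F] {K : Type*} [CommRing K] {ι : Type*} [Fintype ι]

variable (K) in
/-- The coefficient of a group element, as a linear functional on the group algebra. -/
noncomputable def ptCoeff {G : Type*} [AddCommGroup G] (y : G) : AddMonoidAlgebra K G →ₗ[K] K :=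
  Finsupp.lapply y ∘ₗ (AddMonoidAlgebra.coeffLinearEquiv K).toLinearMap

theorem ptCoeff_pt {G : Type*} [AddCommGroup G] [DecidableEq G] (x y : G) :
    ptCoeff K y (pt K x) = if x = y then 1 else 0 := by
  simp [ptCoeff, pt, AddMonoidAlgebra.coeffLinearEquiv, Finsupp.single_apply]

theorem sum_ptCoeff_smul_pt {G : Type*} [AddCommGroup G] [Fintype G] (z : AddMonoidAlgebra K G) :
    ∑ x, ptCoeff K x z • pt K x = z := by
  classical
  have h : ∑ x, (ptCoeff K x).smulRight (pt K x) = LinearMap.id (M := AddMonoidAlgebra K G) := by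
    refine ext_pt fun y => ?_
    simp [LinearMap.sum_apply, ptCoeff_pt]
  simpa [LinearMap.sum_apply] using LinearMap.congr_fun h z

theorem rankOp_act_conj [Fintype F] {m j : ℕ} {c : Matrix (Fin j) (Fin j) F → K}
    (hc : IsSingularAnnihilator c) {g g' : Matrix (Fin m) (Fin m) F} (hg : g' * g = 1)
    (z : AddMonoidAlgebra K (Fin m → Fin m → F)) :
    rankOp (Fin m) (Fin m → F) c (act K (matHom _ g) z) =
      act K (matHom _ g) (rankOp (Fin m) (Fin m → F) c z) := by
  have hg' := mul_eq_one_comm.1 hg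
  simp only [rankOp, LinearMap.smul_apply, LinearMap.sum_apply, AlgHom.toLinearMap_apply, map_smul,
    map_sum, ← act_comp, ← matHom_mul]
  congr 1
  symm
  refine Fintype.sum_equiv ⟨fun M => g * M * g', fun M => g' * M * g, fun M => ?_, fun M => ?_⟩
    _ _ fun M => ?_
  · simp only [Matrix.mul_assoc, hg, Matrix.mul_one]
    rw [← Matrix.mul_assoc, hg, Matrix.one_mul]
  · simp only [Matrix.mul_assoc, hg', Matrix.mul_one]
    rw [← Matrix.mul_assoc, hg', Matrix.one_mul]
  · simp only [Equiv.coe_fn_mk]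
    rw [rankCoeff_conj hc hg, Matrix.mul_assoc (g * M), hg, Matrix.mul_one]

theorem singularOp_act_conj [Fintype F] {m : ℕ} {c : ∀ j, Matrix (Fin j) (Fin j) F → K} (n : ℕ)
    (hc : ∀ i < n, IsSingularAnnihilator (c i)) {g g' : Matrix (Fin m) (Fin m) F}
    (hg : g' * g = 1) (z : AddMonoidAlgebra K (Fin m → Fin m → F)) :
    singularOp (Fin m) (Fin m → F) c n (act K (matHom _ g) z) =
      act K (matHom _ g) (singularOp (Fin m) (Fin m → F) c n z) := by
  induction n generalizing z with
  | zero => rfl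
  | succ n ih =>
    simp only [singularOp, Module.End.mul_apply]
    rw [LinearMap.sub_apply, Module.End.one_apply, rankOp_act_conj (hc n n.lt_succ_self) hg,
      ← map_sub, ih fun i hi => hc i (hi.trans n.lt_succ_self)]
    rfl

theorem singularOp_act_mulRightHom [Fintype F] {m n' : ℕ} {c : ∀ j, Matrix (Fin j) (Fin j) F → K}
    [DecidableEq ι] (n : ℕ) (Z : Matrix (Fin m) (Fin n') F)
    (z : AddMonoidAlgebra K (ι → Fin m → F)) :
    singularOp ι (Fin n' → F) c n (act K (mulRightHom Z) z) =
      act K (mulRightHom Z) (singularOp ι (Fin m → F) c n z) := by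
  induction n generalizing z with
  | zero => rfl
  | succ n ih =>
    simp only [singularOp, Module.End.mul_apply]
    rw [LinearMap.sub_apply, Module.End.one_apply, rankOp_act_mulRightHom, ← map_sub, ih]
    rfl

theorem singularOp_pt_one_sub_mem [Fintype F] {m : ℕ} (c : ∀ j, Matrix (Fin j) (Fin j) F → K) :
    (1 - singularOp (Fin m) (Fin m → F) c m) (matPt K 1) ∈ rankSpan F K (Fin m) m m := by
  cases m with
  | zero => rw [singularOp, sub_self]; exact zero_mem _
  | succ m =>
    have h := one_sub_singularOp_mem_facSpan (ι := Fin (m + 1)) (D := Fin (m + 1) → F) (K := K) c m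
    generalize 1 - singularOp (Fin (m + 1)) (Fin (m + 1) → F) c (m + 1) = e at h ⊢
    induction h using Submodule.span_induction with
    | mem _ h =>
      obtain ⟨Q, P, rfl⟩ := h
      rw [AlgHom.toLinearMap_apply, act_matPt, Matrix.mul_one]
      exact Submodule.subset_span ⟨m, m.lt_succ_self, Q, P, rfl⟩
    | zero => exact zero_mem _
    | add a b _ _ ha hb => exact add_mem ha hb
    | smul c a _ ha => exact Submodule.smul_mem _ _ ha

/-- The coefficients of the image of the identity matrix under `singularOp` form the next singular
annihilator. -/
theorem isSingularAnnihilator_ptCoeff [Fintype F] (hF : IsUnit (Fintype.card F : K)) {m : ℕ}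
    {c : ∀ j, Matrix (Fin j) (Fin j) F → K} (hc : ∀ i < m, IsSingularAnnihilator (c i)) :
    IsSingularAnnihilator fun θ : Matrix (Fin m) (Fin m) F =>
      ptCoeff K (fun i j => θ i j) (singularOp (Fin m) (Fin m → F) c m (matPt K 1)) := by
  classical
  set ε := singularOp (Fin m) (Fin m → F) c m (matPt K 1) with hε
  have hcoeff : ∀ X Y : Matrix (Fin m) (Fin m) F,
      ptCoeff K (fun i j => Y i j) (matPt K X) = if X = Y then 1 else 0 := by
    intro X Y
    rw [matPt, ptCoeff_pt]
    rfl
  have hsum : ∑ θ : Matrix (Fin m) (Fin m) F, ptCoeff K (fun i j => θ i j) ε • matPt K θ = ε :=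
    sum_ptCoeff_smul_pt ε
  have hunit : ∀ θ θ' : Matrix (Fin m) (Fin m) F, θ * θ' = 1 →
      ptCoeff K (fun i j => θ i j) ε = if 1 = θ then 1 else 0 := by
    intro θ θ' hθ
    have h1 : matPt K (1 : Matrix (Fin m) (Fin m) F) - ε ∈ rankSpan F K (Fin m) m m :=
      singularOp_pt_one_sub_mem c
    have h2 : ∀ z ∈ rankSpan F K (Fin m) m m, ptCoeff K (fun i j => θ i j) z = 0 := by
      intro z hz
      induction hz using Submodule.span_induction with
      | mem _ h =>
        obtain ⟨r, hr, Y, Z, rfl⟩ := h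
        rw [hcoeff, if_neg]
        rintro rfl
        have h3 := Matrix.rank_mul_le_left (Y * Z) θ'
        rw [hθ, Matrix.rank_one, Fintype.card_fin] at h3
        have h4 := (Matrix.rank_mul_le_left Y Z).trans Y.rank_le_width
        omega
      | zero => rw [map_zero]
      | add a b _ _ ha hb => rw [map_add, ha, hb, add_zero]
      | smul c a _ ha => rw [map_smul, ha, smul_zero]
    have h3 := h2 _ h1
    rw [map_sub, hcoeff, sub_eq_zero] at h3
    exact h3.symm
  refine ⟨?_, ?_, ?_, ?_⟩
  · intro g g' θ hg
    have hg' := mul_eq_one_comm.1 hg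
    have h1 : act K (mulRightHom g') (act K (matHom _ g) ε) = ε := by
      rw [hε, ← singularOp_act_conj m hc hg', ← singularOp_act_mulRightHom, act_matPt,
        act_mulRightHom, Matrix.mul_one, hg]
    conv_lhs => rw [← h1, ← hsum]
    simp only [map_sum, map_smul, act_matPt, act_mulRightHom, hcoeff]
    rw [Finset.sum_eq_single θ]
    · simp
    · intro θ' _ hne
      rw [if_neg, smul_zero]
      intro h
      apply hne
      calc θ' = g' * (g * θ' * g') * g := by
            simp only [Matrix.mul_assoc, hg', Matrix.mul_one]
            rw [← Matrix.mul_assoc, hg', Matrix.one_mul]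
        _ = θ := by
            rw [h]
            simp only [Matrix.mul_assoc, hg', Matrix.mul_one]
            rw [← Matrix.mul_assoc, hg', Matrix.one_mul]
    · intro h; exact absurd (Finset.mem_univ _) h
  · intro θ θ' h hne
    rw [hunit θ θ' h, if_neg hne.symm]
  · rw [hunit 1 1 (Matrix.mul_one _), if_pos rfl]
  · intro v hv θ₀
    obtain ⟨i, hi⟩ : ∃ i, v i ≠ 0 := by
      by_contra h0; push Not at h0; exact hv (funext h0)
    -- The matrix `X` annihilates exactly the matrices `s vᵀ` from the right.
    let u : Fin m → F := Pi.single i (v i)⁻¹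
    have huv : v ⬝ᵥ u = 1 := by simp [u, hi]
    let X : Matrix (Fin m) (Fin m) F := 1 - Matrix.vecMulVec u v
    have hvX : ∀ s : Fin m → F, Matrix.vecMulVec s v * X = 0 := by
      intro s
      rw [Matrix.mul_sub, Matrix.mul_one, Matrix.vecMulVec_mul_vecMulVec, huv, one_smul, sub_self]
    have hX : ¬ ∃ X' : Matrix (Fin m) (Fin m) F, X' * X = 1 := by
      rintro ⟨X', hX'⟩
      have h2 : Matrix.vecMulVec u v = 0 := by
        rw [← Matrix.mul_one (Matrix.vecMulVec u v), ← mul_eq_one_comm.1 hX', ← Matrix.mul_assoc,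
          hvX, Matrix.zero_mul]
      have h3 := congrFun (congrFun h2 i) i
      simp [Matrix.vecMulVec_apply, u, hi] at h3
    have h0 : act K (mulRightHom X) ε = 0 := by
      rw [hε, ← singularOp_act_mulRightHom, act_mulRightHom, Matrix.one_mul]
      refine singularOp_apply_eq_zero hF c m hc ?_
      obtain ⟨r, hr, Y, Z, h⟩ := exists_factorization_of_no_leftInverse hX
      exact Submodule.subset_span ⟨r, hr, Y, Z, by rw [h]⟩
    have h1 := congrArg (ptCoeff K fun a b => (θ₀ * X) a b) h0
    rw [← hsum] at h1
    simp only [map_sum, map_smul, act_mulRightHom, hcoeff, map_zero, smul_eq_mul, mul_ite, mul_one,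
      mul_zero] at h1
    rw [← Finset.sum_filter] at h1
    rw [← h1]
    refine Finset.sum_bij (fun s _ => θ₀ + Matrix.vecMulVec s v) ?_ ?_ ?_ ?_
    · intro s _
      rw [Finset.mem_filter, Matrix.add_mul, hvX, add_zero]
      exact ⟨Finset.mem_univ _, rfl⟩
    · intro s _ s' _ h
      have h2 := add_left_cancel h
      funext a
      have h3 := congrFun (congrFun h2 a) i
      simpa [Matrix.vecMulVec_apply, hi] using h3
    · intro θ hθ
      have h2 := (Finset.mem_filter.1 hθ).2
      refine ⟨(θ - θ₀).mulVec u, Finset.mem_univ _, ?_⟩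
      have h3 : (θ - θ₀) * X = 0 := by rw [Matrix.sub_mul, h2, sub_self]
      rw [Matrix.mul_sub, Matrix.mul_one, sub_eq_zero, Matrix.mul_vecMulVec] at h3
      rw [← h3]; abel
    · intro s _; rfl

theorem exists_isSingularAnnihilator [Fintype F] (hF : IsUnit (Fintype.card F : K)) (m : ℕ) :
    ∃ c : ∀ j, Matrix (Fin j) (Fin j) F → K, ∀ i < m, IsSingularAnnihilator (c i) := by
  induction m with
  | zero => exact ⟨fun _ _ => 0, fun i hi => absurd hi i.not_lt_zero⟩
  | succ m ih =>
    obtain ⟨c, hc⟩ := ih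
    refine ⟨Function.update c m fun θ : Matrix (Fin m) (Fin m) F =>
      ptCoeff K (fun i j => θ i j) (singularOp (Fin m) (Fin m → F) c m (matPt K 1)),
      fun i hi => ?_⟩
    rcases Nat.lt_succ_iff_lt_or_eq.1 hi with hi | rfl
    · rw [Function.update_of_ne hi.ne]; exact hc i hi
    · rw [Function.update_self]; exact isSingularAnnihilator_ptCoeff hF hc

/-- The identity on the `K`-linearized space `(F^k)^ι` is a `K`-linear combination of matrices of
rank at most `k`: the product of the operators `1 - rankOp` for the ranks up to `k` vanishes. -/
theorem isUniformlyGenerated_field [Fintype F] (hF : IsUnit (Fintype.card F : K)) (k : ℕ) :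
    IsUniformlyGenerated F (Fin k → F) K k := by
  intro ι _ _
  obtain ⟨c, hc⟩ := exists_isSingularAnnihilator (F := F) hF (k + 1)
  have h0 : singularOp ι (Fin k → F) c (k + 1) = 0 := by
    refine ext_pt fun x => ?_
    rw [singularOp_apply_eq_zero hF c (k + 1) hc, LinearMap.zero_apply]
    refine Submodule.subset_span ⟨k, k.lt_succ_self, Matrix.of fun i j => x i j, 1, ?_⟩
    rw [Matrix.mul_one]
    rfl
  have h1 := one_sub_singularOp_mem_facSpan (ι := ι) (D := Fin k → F) c k
  rwa [h0, sub_zero] at h1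

end KovacsExistence

/-! ### Distributive modules -/

section DistributiveModules

variable {R : Type*} [Ring R] {M : Type*} [AddCommGroup M] [Module R M]

theorem IsDistributiveModule.of_le (h : ∀ X Y Z : Submodule R M, X ⊓ (Y ⊔ Z) ≤ (X ⊓ Y) ⊔ (X ⊓ Z)) :
    IsDistributiveModule R M := fun X Y Z => le_antisymm (h X Y Z)
  (sup_le (inf_le_inf_left _ le_sup_left) (inf_le_inf_left _ le_sup_right))

theorem IsDistributiveModule.submodule (h : IsDistributiveModule R M) (P : Submodule R M) :
    IsDistributiveModule R P := by
  intro X Y Z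
  apply Submodule.map_injective_of_injective P.injective_subtype
  simp only [Submodule.map_sup, Submodule.map_inf _ P.injective_subtype]
  exact h _ _ _

theorem IsDistributiveModule.quotient (h : IsDistributiveModule R M) (P : Submodule R M) :
    IsDistributiveModule R (M ⧸ P) := by
  refine .of_le fun X Y Z => ?_
  intro x hx
  obtain ⟨x, rfl⟩ := P.mkQ_surjective x
  obtain ⟨hx, hyz⟩ := Submodule.mem_inf.1 hx
  obtain ⟨y, hy, z, hz, h1⟩ := Submodule.mem_sup.1 hyz
  obtain ⟨y, rfl⟩ := P.mkQ_surjective y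
  obtain ⟨z, rfl⟩ := P.mkQ_surjective z
  have h2 : x - (y + z) ∈ P := by
    rw [← P.ker_mkQ, LinearMap.mem_ker, map_sub, map_add, h1, sub_self]
  have h3 : x ∈ X.comap P.mkQ ⊓ (Y.comap P.mkQ ⊔ Z.comap P.mkQ) := by
    refine Submodule.mem_inf.2 ⟨hx, Submodule.mem_sup.2 ⟨y + (x - (y + z)), ?_, z, hz, by abel⟩⟩
    rw [← P.ker_mkQ, LinearMap.mem_ker] at h2
    rw [Submodule.mem_comap, map_add, h2, add_zero]
    exact hy
  rw [h] at h3
  obtain ⟨u, hu, v, hv, rfl⟩ := Submodule.mem_sup.1 h3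
  rw [map_add]
  exact Submodule.add_mem_sup hu hv

/-- In a distributive module, `R (a + b)` is the sum of its intersections with `R a` and `R b`; a
decomposition of `a + b` along this sum gives `s`. -/
theorem IsDistributiveModule.exists_smul_mem_span (h : IsDistributiveModule R M) (a b : M) :
    ∃ s : R, s • b ∈ R ∙ a ∧ (1 - s) • a ∈ R ∙ b := by
  have h1 : a + b ∈ (R ∙ (a + b)) ⊓ ((R ∙ a) ⊔ (R ∙ b)) := Submodule.mem_inf.2
    ⟨Submodule.mem_span_singleton_self _, Submodule.add_mem_sup
      (Submodule.mem_span_singleton_self _) (Submodule.mem_span_singleton_self _)⟩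
  rw [h] at h1
  obtain ⟨x, hx, y, hy, hxy⟩ := Submodule.mem_sup.1 h1
  obtain ⟨hx, hxa⟩ := Submodule.mem_inf.1 hx
  obtain ⟨-, hyb⟩ := Submodule.mem_inf.1 hy
  obtain ⟨s, rfl⟩ := Submodule.mem_span_singleton.1 hx
  refine ⟨s, ?_, ?_⟩
  · rw [smul_add] at hxa
    exact (Submodule.add_mem_iff_right _
      (Submodule.smul_mem _ _ (Submodule.mem_span_singleton_self a))).1 hxa
  · have h2 : (1 - s) • a = y - (1 - s) • b := by
      have : y = a + b - s • (a + b) := eq_sub_of_add_eq' hxy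
      rw [this, sub_smul, sub_smul, one_smul, one_smul, smul_add]; abel
    rw [h2]
    exact sub_mem hyb (Submodule.smul_mem _ _ (Submodule.mem_span_singleton_self b))

/-- In a finite distributive module, for submodules `X` and `Y` with trivial intersection, the
projections of `X ⊕ Y` are given by ring elements. -/
theorem IsDistributiveModule.exists_smul_eq [Finite M] (h : IsDistributiveModule R M)
    {X Y : Submodule R M} (hXY : X ⊓ Y = ⊥) :
    ∃ r : R, (∀ x ∈ X, r • x = x) ∧ ∀ y ∈ Y, r • y = 0 := by
  classical
  have h0 : ∀ a ∈ X, ∀ b ∈ Y, ∃ s : R, s • a = a ∧ s • b = 0 := by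
    intro a ha b hb
    obtain ⟨s, h1, h2⟩ := h.exists_smul_mem_span a b
    refine ⟨s, ?_, ?_⟩
    · have h3 : (1 - s) • a ∈ X ⊓ Y := Submodule.mem_inf.2 ⟨X.smul_mem _ ha,
        (Submodule.span_singleton_le_iff_mem _ _).2 hb h2⟩
      rw [hXY, Submodule.mem_bot, sub_smul, one_smul, sub_eq_zero] at h3
      exact h3.symm
    · have h3 : s • b ∈ X ⊓ Y := Submodule.mem_inf.2
        ⟨(Submodule.span_singleton_le_iff_mem _ _).2 ha h1, Y.smul_mem _ hb⟩
      rwa [hXY, Submodule.mem_bot] at h3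
  have h1 : ∀ b ∈ Y, ∃ s : R, (∀ x ∈ X, s • x = x) ∧ s • b = 0 := by
    intro b hb
    suffices ∀ T : Finset M, (∀ x ∈ T, x ∈ X) → ∃ s : R, (∀ x ∈ T, s • x = x) ∧ s • b = 0 by
      obtain ⟨s, hs, hsb⟩ := this (Set.toFinite (X : Set M)).toFinset (by simp)
      exact ⟨s, fun x hx => hs x (by simpa using hx), hsb⟩
    intro T hT
    induction T using Finset.induction_on with
    | empty => exact ⟨0, by simp, zero_smul _ _⟩
    | insert a T _ ih =>
      obtain ⟨r, hr, hrb⟩ := ih fun x hx => hT x (Finset.mem_insert_of_mem hx)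
      obtain ⟨s, hs, hsb⟩ := h0 _ (X.smul_mem (1 - r) (hT a (Finset.mem_insert_self _ _))) b hb
      refine ⟨r + s * (1 - r), fun x hx => ?_, ?_⟩
      · rcases Finset.mem_insert.1 hx with rfl | hx
        · rw [add_smul, mul_smul, hs, sub_smul, one_smul]; abel
        · rw [add_smul, mul_smul, sub_smul 1 r, hr x hx, one_smul, sub_self, smul_zero, add_zero]
      · rw [add_smul, mul_smul, sub_smul 1 r, hrb, one_smul, sub_zero, hsb, add_zero]
  suffices ∀ T : Finset M, (∀ y ∈ T, y ∈ Y) →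
      ∃ r : R, (∀ x ∈ X, r • x = x) ∧ ∀ y ∈ T, r • y = 0 by
    obtain ⟨r, hr, hr0⟩ := this (Set.toFinite (Y : Set M)).toFinset (by simp)
    exact ⟨r, hr, fun y hy => hr0 y (by simpa using hy)⟩
  intro T hT
  induction T using Finset.induction_on with
  | empty => exact ⟨1, fun x _ => one_smul _ _, by simp⟩
  | insert b T _ ih =>
    obtain ⟨r, hr, hr0⟩ := ih fun x hx => hT x (Finset.mem_insert_of_mem hx)
    obtain ⟨s, hs, hsb⟩ := h1 _ (Y.smul_mem r (hT b (Finset.mem_insert_self _ _)))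
    refine ⟨s * r, fun x hx => by rw [mul_smul, hr x hx, hs x hx], fun y hy => ?_⟩
    rcases Finset.mem_insert.1 hy with rfl | hy
    · rw [mul_smul, hsb]
    · rw [mul_smul, hr0 y hy, smul_zero]

end DistributiveModules

/-! ### The radical of a distributive module -/

section Radical

variable {R : Type*} [Ring R] {M : Type*} [AddCommGroup M] [Module R M]

variable (M) in
/-- The elements of a module that are annihilated by a two-sided ideal. -/
def killedBy (I : Ideal R) [I.IsTwoSided] : Submodule R M where
  carrier := {m | ∀ a ∈ I, a • m = 0}
  zero_mem' a _ := smul_zero a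
  add_mem' hx hy a ha := by rw [smul_add, hx a ha, hy a ha, add_zero]
  smul_mem' r x hx a ha := by rw [← mul_smul]; exact hx _ (Ideal.mul_mem_right r I ha)

theorem isSemisimpleModule_of_jacobson_smul_eq_zero [IsSemiprimaryRing R]
    (h : ∀ a ∈ Ring.jacobson R, ∀ m : M, a • m = 0) : IsSemisimpleModule R M := by
  have := ((isSemiprimaryRing_iff R).1 inferInstance).1
  have h' : Module.IsTorsionBySet R M (Ring.jacobson R) := fun m a => h a a.2 m
  let _ := h'.module
  exact (h'.semilinearMap.isSemisimpleModule_iff_of_bijective Function.bijective_id).2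
    inferInstance

/-- The elements annihilated by the radical form a semisimple module, so if they do not all lie in
`X`, then some minimal submodule is not contained in `X`. -/
theorem exists_isAtom_not_le [IsSemiprimaryRing R] {X : Submodule R M} {m : M}
    (hm : m ∈ killedBy M (Ring.jacobson R)) (hmX : m ∉ X) :
    ∃ N : Submodule R M, IsAtom N ∧ ¬ N ≤ X := by
  by_contra! h0
  have : IsSemisimpleModule R (killedBy M (Ring.jacobson R)) :=
    isSemisimpleModule_of_jacobson_smul_eq_zero fun a ha m => Subtype.ext (m.2 a ha)
  have h1 := IsSemisimpleModule.sSup_simples_eq_top R (killedBy M (Ring.jacobson R))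
  apply hmX
  have h2 : (⊤ : Submodule R (killedBy M (Ring.jacobson R))) ≤ X.comap (Submodule.subtype _) := by
    rw [← h1]
    refine sSup_le fun P hP => ?_
    rw [← Submodule.map_le_iff_le_comap]
    refine h0 _ ?_
    have hP' : IsSimpleModule R P := hP
    exact isSimpleModule_iff_isAtom.1 (IsSimpleModule.congr
      (Submodule.equivMapOfInjective _ (Submodule.injective_subtype _) P).symm)
  exact h2 (Submodule.mem_top (x := ⟨m, hm⟩))

/-- An element outside of `J M` is avoided by some maximal submodule. -/
theorem exists_isCoatom_notMem [IsSemiprimaryRing R] {m : M}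
    (hm : m ∉ Ring.jacobson R • (⊤ : Submodule R M)) :
    ∃ X : Submodule R M, IsCoatom X ∧ m ∉ X := by
  set P := Ring.jacobson R • (⊤ : Submodule R M) with hP
  have : IsSemisimpleModule R (M ⧸ P) := by
    refine isSemisimpleModule_of_jacobson_smul_eq_zero fun a ha m => ?_
    obtain ⟨m, rfl⟩ := P.mkQ_surjective m
    rw [← map_smul, ← LinearMap.mem_ker, P.ker_mkQ]
    exact Submodule.smul_mem_smul ha Submodule.mem_top
  have h1 := Module.jacobson_le_of_eq_bot (IsSemisimpleModule.jacobson_eq_bot R (M ⧸ P))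
  by_contra! h0
  exact hm (h1 (Submodule.mem_sInf.2 fun X hX => h0 X hX))

theorem smul_top_le_of_isCoatom {X : Submodule R M} (hX : IsCoatom X) :
    Ring.jacobson R • (⊤ : Submodule R M) ≤ X :=
  (Ring.jacobson_smul_top_le R M).trans (sInf_le hX)

theorem IsAtom.jacobson_smul_eq_zero {N : Submodule R M} (hN : IsAtom N) {a : R}
    (ha : a ∈ Ring.jacobson R) {m : M} (hm : m ∈ N) : a • m = 0 := by
  have : IsSimpleModule R N := isSimpleModule_iff_isAtom.2 hN
  have h1 := IsSemisimpleModule.jacobson_le_annihilator R N ha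
  exact congrArg Subtype.val (Module.mem_annihilator.1 h1 ⟨m, hm⟩)

variable [IsSemiprimaryRing R] [Finite M]

/-- For a minimal submodule `N` there is a ring element that annihilates `J M`, but not `M`, and
maps `M` into `N`. -/
theorem IsDistributiveModule.exists_smul_mem_atom (hM : IsDistributiveModule R M) {l : ℕ}
    (hl : ∀ a ∈ Ring.jacobson R ^ l, ∀ m : M, a • m = 0) {N : Submodule R M} (hN : IsAtom N) :
    ∃ a : R, (∀ m ∈ Ring.jacobson R • (⊤ : Submodule R M), a • m = 0) ∧ (∀ m : M, a • m ∈ N) ∧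
      ∃ m : M, a • m ≠ 0 := by
  set J := Ring.jacobson R with hJ
  -- The element is `r * b`, where `b ∈ J ^ p` for the maximal `p` with `N ≤ J ^ p M`, and `r`
  -- projects `J ^ p M` to its direct summand `N`.
  obtain ⟨p, hp, hp'⟩ : ∃ p, N ≤ J ^ p • (⊤ : Submodule R M) ∧
      ¬ N ≤ J ^ (p + 1) • (⊤ : Submodule R M) := by
    by_contra! h0
    have h1 : ∀ p, N ≤ J ^ p • (⊤ : Submodule R M) := by
      intro p
      induction p with
      | zero => rw [Submodule.pow_zero, Ideal.one_eq_top, Submodule.top_smul]; exact le_top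
      | succ p ih => exact h0 p ih
    refine hN.1 (le_bot_iff.1 ((h1 l).trans (Submodule.smul_le.2 fun a ha m _ => ?_)))
    rw [hl a ha]; exact zero_mem _
  set E := J ^ p • (⊤ : Submodule R M) with hE
  have hJE : J • E = J ^ (p + 1) • (⊤ : Submodule R M) := by
    rw [hE, ← Submodule.mul_smul, ← Ideal.IsTwoSided.pow_succ]
  obtain ⟨n, hn, hnE⟩ := Set.not_subset.1 hp'
  have hnE' : (⟨n, hp hn⟩ : E) ∉ J • (⊤ : Submodule R E) := by
    intro h
    apply hnE
    rw [← hJE]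
    have h1 := Submodule.mem_map_of_mem (f := E.subtype) h
    rwa [Submodule.map_smul'', Submodule.map_top, Submodule.range_subtype] at h1
  obtain ⟨X, hX, hnX⟩ := exists_isCoatom_notMem hnE'
  have hJX : J • E ≤ X.map E.subtype := by
    have h1 := Submodule.map_mono (f := E.subtype) (smul_top_le_of_isCoatom hX)
    rwa [Submodule.map_smul'', Submodule.map_top, Submodule.range_subtype] at h1
  have hdisj : N ⊓ X.map E.subtype = ⊥ := by
    refine (hN.le_iff.1 inf_le_left).resolve_right fun h => hnX ?_
    have h1 : n ∈ N ⊓ X.map E.subtype := by rw [h]; exact hn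
    obtain ⟨⟨x, hx⟩, hxX, rfl⟩ := Submodule.mem_map.1 (Submodule.mem_inf.1 h1).2
    exact hxX
  have hsup : N.comap E.subtype ⊔ X = ⊤ := by
    refine hX.2 _ (lt_of_le_of_ne le_sup_right fun h => hnX ?_)
    rw [h]
    exact le_sup_left (a := N.comap E.subtype) (show (⟨n, hp hn⟩ : E) ∈ N.comap E.subtype from hn)
  obtain ⟨r, hr, hr0⟩ := hM.exists_smul_eq hdisj
  have hrE : ∀ e ∈ E, r • e ∈ N := by
    intro e he
    obtain ⟨u, hu, v, hv, huv⟩ := Submodule.mem_sup.1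
      (hsup ▸ Submodule.mem_top : (⟨e, he⟩ : E) ∈ N.comap E.subtype ⊔ X)
    have h1 : e = u + v := congrArg Subtype.val huv.symm
    rw [h1, smul_add, hr u hu, hr0 v (Submodule.mem_map_of_mem (f := E.subtype) hv), add_zero]
    exact hu
  have key : ∃ b ∈ J ^ p, ∃ m : M, r • b • m ≠ 0 := by
    by_contra! h0
    have h1 : ∀ e ∈ E, r • e = 0 := fun e he =>
      Submodule.smul_induction_on he (fun b hb m _ => h0 b hb m)
        fun x y hx hy => by rw [smul_add, hx, hy, add_zero]
    apply hnE
    rw [← hr n hn, h1 n (hp hn)]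
    exact zero_mem _
  obtain ⟨b, hb, m, hm⟩ := key
  refine ⟨r * b, fun m hm => ?_, fun m => ?_, m, by rwa [mul_smul]⟩
  · have h1 : b • m ∈ J • E := by
      rw [hJE, Submodule.pow_succ, Submodule.mul_smul]
      exact Submodule.smul_mem_smul hb hm
    rw [mul_smul]
    exact hr0 _ (hJX h1)
  · rw [mul_smul]
    exact hrE _ (Submodule.smul_mem_smul hb Submodule.mem_top)

/-- For a maximal submodule `X` and `d ∉ X`, there is a ring element that maps the module to the
elements annihilated by the radical `J`, annihilates `J M` and does not annihilate `d`. -/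
theorem IsDistributiveModule.exists_smul_ne_zero (hM : IsDistributiveModule R M) {l : ℕ}
    (hl : ∀ a ∈ Ring.jacobson R ^ l, ∀ m : M, a • m = 0) {X : Submodule R M} (hX : IsCoatom X)
    {d : M} (hd : d ∉ X) :
    ∃ a : R, (∀ m ∈ Ring.jacobson R • (⊤ : Submodule R M), a • m = 0) ∧
      (∀ m : M, a • m ∈ killedBy M (Ring.jacobson R)) ∧ a • d ≠ 0 := by
  set J := Ring.jacobson R with hJ
  -- The element is `b * r`, where `b ∈ J ^ p` for the maximal `p` such that `X` contains the
  -- submodule `Z` annihilated by `J ^ p`, and `r` projects `M / Z` to a minimal direct summand,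
  -- with kernel `X`.
  obtain ⟨p, hp, hp'⟩ : ∃ p, killedBy M (J ^ p) ≤ X ∧ ¬ killedBy M (J ^ (p + 1)) ≤ X := by
    by_contra! h0
    have h1 : ∀ p, killedBy M (J ^ p) ≤ X := by
      intro p
      induction p with
      | zero =>
        intro m hm
        have h2 := hm 1 (by rw [Submodule.pow_zero, Ideal.one_eq_top]; exact Submodule.mem_top)
        rw [one_smul] at h2
        rw [h2]; exact zero_mem _
      | succ p ih => exact h0 p ih
    exact hX.1 (top_le_iff.1 (fun m _ => h1 l fun a ha => hl a ha m))
  set Z := killedBy M (J ^ p) with hZ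
  obtain ⟨z, hz, hzX⟩ := Set.not_subset.1 hp'
  have hzJ : Z.mkQ z ∈ killedBy (M ⧸ Z) J := by
    intro a ha
    rw [← map_smul, ← LinearMap.mem_ker, Z.ker_mkQ]
    intro b hb
    rw [← mul_smul]
    exact hz _ (by rw [Submodule.pow_succ]; exact Ideal.mul_mem_mul hb ha)
  have hmemX : ∀ m, Z.mkQ m ∈ X.map Z.mkQ → m ∈ X := by
    intro m hm
    obtain ⟨x, hx, hxm⟩ := Submodule.mem_map.1 hm
    have h1 : m - x ∈ Z := by rw [← Z.ker_mkQ, LinearMap.mem_ker, map_sub, hxm, sub_self]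
    simpa using add_mem (hp h1) hx
  obtain ⟨C, hC, hCX⟩ := exists_isAtom_not_le hzJ fun h => hzX (hmemX z h)
  have hdisj : C ⊓ X.map Z.mkQ = ⊥ :=
    (hC.le_iff.1 inf_le_left).resolve_right fun h => hCX (inf_eq_left.1 h)
  have := Finite.of_surjective Z.mkQ Z.mkQ_surjective
  obtain ⟨r, hr, hr0⟩ := (hM.quotient Z).exists_smul_eq hdisj
  have hsup : C.comap Z.mkQ ⊔ X = ⊤ := by
    refine hX.2 _ (lt_of_le_of_ne le_sup_right fun h => hCX fun c hc => ?_)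
    obtain ⟨c, rfl⟩ := Z.mkQ_surjective c
    refine Submodule.mem_map_of_mem ?_
    rw [h]
    exact le_sup_left (a := C.comap Z.mkQ) hc
  have hrM : ∀ m, ∀ b ∈ J ^ p, b • r • m ∈ killedBy M J := by
    intro m b hb a ha
    obtain ⟨c, hc, x, hx, rfl⟩ := Submodule.mem_sup.1
      (hsup ▸ Submodule.mem_top : m ∈ C.comap Z.mkQ ⊔ X)
    have h1 : r • x ∈ Z := by
      rw [← Z.ker_mkQ, LinearMap.mem_ker, map_smul]
      exact hr0 _ (Submodule.mem_map_of_mem hx)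
    have h2 : r • c ∈ killedBy M (J ^ (p + 1)) := by
      intro a ha
      rw [Submodule.pow_succ] at ha
      refine Submodule.smul_induction_on ha (fun a ha b hb => ?_) fun a b ha hb => ?_
      · have h3 : b • r • c ∈ Z := by
          rw [← Z.ker_mkQ, LinearMap.mem_ker, map_smul, map_smul, hr _ hc]
          exact hC.jacobson_smul_eq_zero hb hc
        rw [smul_eq_mul, mul_smul]
        exact h3 a ha
      · rw [add_smul, ha, hb, add_zero]
    rw [smul_add, smul_add, h1 b hb, add_zero, ← mul_smul]
    refine h2 _ ?_
    rw [Ideal.IsTwoSided.pow_succ]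
    exact Ideal.mul_mem_mul ha hb
  have hrd : r • d ∉ Z := by
    intro h
    obtain ⟨c, hc, x, hx, rfl⟩ := Submodule.mem_sup.1
      (hsup ▸ Submodule.mem_top : d ∈ C.comap Z.mkQ ⊔ X)
    rw [← Z.ker_mkQ, LinearMap.mem_ker, map_smul, map_add, smul_add, hr _ hc,
      hr0 _ (Submodule.mem_map_of_mem hx), add_zero, ← LinearMap.mem_ker, Z.ker_mkQ] at h
    exact hd (add_mem (hp h) hx)
  obtain ⟨b, hb, hbd⟩ : ∃ b ∈ J ^ p, b • r • d ≠ 0 := by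
    by_contra! h0
    exact hrd fun b hb => h0 b hb
  refine ⟨b * r, fun m hm => ?_, fun m => by rw [mul_smul]; exact hrM m b hb, by rwa [mul_smul]⟩
  have h1 : r • m ∈ Z := by
    rw [← Z.ker_mkQ, LinearMap.mem_ker, map_smul]
    exact hr0 _ (Submodule.mem_map_of_mem (smul_top_le_of_isCoatom hX hm))
  rw [mul_smul]
  exact h1 b hb

/-- Modulo `J M`, two elements generate a cyclic submodule, with a generator of the form
`a + r b`. -/
theorem IsDistributiveModule.exists_add_smul_generates (hM : IsDistributiveModule R M) (a b : M) :
    ∃ r t : R, b - t • (a + r • b) ∈ Ring.jacobson R • (⊤ : Submodule R M) := by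
  set P := Ring.jacobson R • (⊤ : Submodule R M) with hP
  have : IsSemisimpleModule R (M ⧸ P) := by
    refine isSemisimpleModule_of_jacobson_smul_eq_zero fun a ha m => ?_
    obtain ⟨m, rfl⟩ := P.mkQ_surjective m
    rw [← map_smul, ← LinearMap.mem_ker, P.ker_mkQ]
    exact Submodule.smul_mem_smul ha Submodule.mem_top
  obtain ⟨W, hW⟩ := exists_isCompl (R ∙ P.mkQ a)
  have := Finite.of_surjective P.mkQ P.mkQ_surjective
  obtain ⟨r, hr, hr0⟩ := (hM.quotient P).exists_smul_eq hW.symm.inf_eq_bot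
  obtain ⟨b0, hb0, b1, hb1, hb⟩ := Submodule.mem_sup.1
    (hW.sup_eq_top ▸ Submodule.mem_top : P.mkQ b ∈ (R ∙ P.mkQ a) ⊔ W)
  obtain ⟨s, rfl⟩ := Submodule.mem_span_singleton.1 hb0
  have h1 : r • P.mkQ b = b1 := by rw [← hb, smul_add, hr0 _ hb0, hr _ hb1, zero_add]
  -- `b ≡ s a + b₁`, where `b₁ ≡ r c` and `a ≡ c - r c` for `c = a + r b`.
  refine ⟨r, s * (1 - r) + r, ?_⟩
  have h2 : r • P.mkQ a = 0 := hr0 _ (Submodule.mem_span_singleton_self _)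
  have h3 : r • (P.mkQ a + b1) = b1 := by rw [smul_add, h2, hr _ hb1, zero_add]
  rw [← P.ker_mkQ, LinearMap.mem_ker, map_sub, map_smul, map_add, map_smul, h1, add_smul, mul_smul,
    sub_smul, one_smul, h3, add_sub_cancel_right, hb, sub_self]

/-- A character of a finite abelian group that is trivial wherever all characters of a given
subgroup of the dual are trivial belongs to this subgroup. -/
theorem AddChar.mem_of_forall_eq_one {A : Type*} [AddCommGroup A] [Finite A]
    (T : AddSubgroup (AddChar A ℂ)) (ψ : AddChar A ℂ)
    (h : ∀ a, (∀ φ ∈ T, φ a = 1) → ψ a = 1) : ψ ∈ T := by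
  by_contra hψ
  have h1 : (QuotientAddGroup.mk ψ : AddChar A ℂ ⧸ T) ≠ 0 := by
    rwa [Ne, QuotientAddGroup.eq_zero_iff]
  obtain ⟨Φ, hΦ⟩ := AddChar.exists_apply_ne_zero.2 h1
  obtain ⟨a, ha⟩ := (AddChar.doubleDualEmb_bijective (α := A)).2
    (Φ.compAddMonoidHom (QuotientAddGroup.mk' T))
  have h2 : ∀ φ : AddChar A ℂ, φ a = Φ (QuotientAddGroup.mk φ) := fun φ =>
    DFunLike.congr_fun ha φ
  refine hΦ ?_
  rw [← h2]
  refine h a fun φ hφ => ?_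
  rw [h2, (QuotientAddGroup.eq_zero_iff φ).2 hφ, AddChar.map_zero_eq_one]

/-- The largest submodule in the kernel of a character. -/
def addCharKernel (χ : AddChar M ℂ) : Submodule R M where
  carrier := {m | ∀ s : R, χ (s • m) = 1}
  zero_mem' s := by rw [smul_zero, AddChar.map_zero_eq_one]
  add_mem' hx hy s := by rw [smul_add, AddChar.map_add_eq_mul, hx s, hy s, one_mul]
  smul_mem' r x hx s := by rw [← mul_smul]; exact hx _

/-- The dual of `exists_add_smul_generates`: for two characters of a module annihilated by the
radical there is a combination `χ₁ + χ₂ r` of which the second one is a multiple. -/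
theorem IsDistributiveModule.exists_addChar_generates (hM : IsDistributiveModule R M)
    (hJ : ∀ a ∈ Ring.jacobson R, ∀ m : M, a • m = 0) (χ₁ χ₂ : AddChar M ℂ) :
    ∃ r t : R, ∀ m, χ₂ m = χ₁ (t • m) * χ₂ (r • t • m) := by
  have := isSemisimpleModule_of_jacobson_smul_eq_zero hJ
  set A₁ : Submodule R M := addCharKernel χ₁ with hA₁
  obtain ⟨Y, hY⟩ := exists_isCompl A₁
  obtain ⟨r, hr, hr0⟩ := hM.exists_smul_eq hY.inf_eq_bot
  let χ : AddChar M ℂ := χ₁ + χ₂.compAddMonoidHom (DistribSMul.toAddMonoidHom M r)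
  have hχ : ∀ m, χ m = χ₁ m * χ₂ (r • m) := fun m => rfl
  let T : AddSubgroup (AddChar M ℂ) :=
    { carrier := {φ | ∃ t : R, ∀ m, φ m = χ (t • m)}
      zero_mem' := ⟨0, fun m => by rw [zero_smul, AddChar.map_zero_eq_one]; rfl⟩
      add_mem' := by
        rintro φ ψ ⟨t, ht⟩ ⟨u, hu⟩
        refine ⟨t + u, fun m => ?_⟩
        rw [add_smul, AddChar.map_add_eq_mul, ← ht, ← hu]; rfl
      neg_mem' := by
        rintro φ ⟨t, ht⟩
        refine ⟨-t, fun m => ?_⟩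
        rw [neg_smul, ← smul_neg, ← ht]; rfl }
  suffices h : χ₂ ∈ T by
    obtain ⟨t, ht⟩ := h
    exact ⟨r, t, fun m => by rw [ht, hχ]⟩
  -- The largest submodule `P` in the kernel of `χ` lies in the kernel of `χ₂`.
  refine AddChar.mem_of_forall_eq_one T χ₂ fun a ha => ?_
  have haP : a ∈ (addCharKernel χ : Submodule R M) := fun t =>
    ha (χ.compAddMonoidHom (DistribSMul.toAddMonoidHom M t)) ⟨t, fun m => rfl⟩
  have hPY : (addCharKernel χ : Submodule R M) ⊓ Y = ⊥ := by
    rw [← le_bot_iff, ← hY.inf_eq_bot]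
    refine le_inf (fun m hm => fun s => ?_) inf_le_right
    obtain ⟨hm, hmY⟩ := Submodule.mem_inf.1 hm
    have h1 := hm s
    rwa [hχ, hr0 _ (Y.smul_mem s hmY), AddChar.map_zero_eq_one, mul_one] at h1
  have hPA : (addCharKernel χ : Submodule R M) ≤ A₁ := by
    have h1 := hM (addCharKernel χ) A₁ Y
    rw [hY.sup_eq_top, inf_top_eq, hPY, sup_bot_eq] at h1
    exact inf_eq_left.1 h1.symm
  have h1 := haP 1
  have h2 := hPA haP 1
  rw [one_smul] at h1 h2
  rwa [hχ, h2, one_mul, hr a (hPA haP)] at h1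

end Radical

/-! ### Sections and transport -/

section Naturality

variable {R : Type*} [Ring R] {ι : Type*} {K : Type*} [CommRing K]
  {D D' : Type*} [AddCommGroup D] [Module R D] [AddCommGroup D']

/-- The tuples with entries in a submodule. -/
def piSub (ι : Type*) (N : Submodule R D) : AddSubgroup (ι → D) where
  carrier := {x | ∀ i, x i ∈ N}
  zero_mem' _ := zero_mem _
  add_mem' hx hy i := add_mem (hx i) (hy i)
  neg_mem' hx i := neg_mem (hx i)

theorem mem_piSub {N : Submodule R D} {x : ι → D} : x ∈ piSub ι N ↔ ∀ i, x i ∈ N := Iff.rfl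

theorem matHom_compLeft {κ : Type*} [Fintype κ] [Module R D'] (f : D →ₗ[R] D')
    (M : Matrix ι κ R) :
    (matHom D' M).comp (f.toAddMonoidHom.compLeft κ) =
      (f.toAddMonoidHom.compLeft ι).comp (matHom D M) := by
  refine AddMonoidHom.ext fun x => funext fun i => ?_
  simp [matHom_apply]

variable [Fintype ι]

variable (D) in
/-- The operator on `K[D^ι]` given by a formal linear combination of factorized matrices. -/
noncomputable def facComb {k : ℕ} (c : (Matrix ι (Fin k) R × Matrix (Fin k) ι R) →₀ K) :
    Module.End K (AddMonoidAlgebra K (ι → D)) :=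
  Finsupp.linearCombination K
    (fun QP : Matrix ι (Fin k) R × Matrix (Fin k) ι R =>
      (act K (matHom D (QP.1 * QP.2))).toLinearMap) c

theorem exists_facComb_eq {k : ℕ} {e : Module.End K (AddMonoidAlgebra K (ι → D))}
    (he : e ∈ facSpan R ι D K k) :
    ∃ c : (Matrix ι (Fin k) R × Matrix (Fin k) ι R) →₀ K, facComb D c = e := by
  refine (Finsupp.mem_span_range_iff_exists_finsupp.1 (Submodule.span_mono ?_ he))
  rintro _ ⟨Q, P, rfl⟩
  exact ⟨(Q, P), rfl⟩

theorem facComb_mem {k : ℕ} (c : (Matrix ι (Fin k) R × Matrix (Fin k) ι R) →₀ K) :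
    facComb D c ∈ facSpan R ι D K k :=
  sum_mem fun QP _ => Submodule.smul_mem _ _ (Submodule.subset_span ⟨QP.1, QP.2, rfl⟩)

theorem facComb_apply {k : ℕ} (c : (Matrix ι (Fin k) R × Matrix (Fin k) ι R) →₀ K)
    (z : AddMonoidAlgebra K (ι → D)) :
    facComb D c z = c.sum fun QP a => a • act K (matHom D (QP.1 * QP.2)) z := by
  simp [facComb, Finsupp.linearCombination_apply, Finsupp.sum, LinearMap.sum_apply]

/-- A formal linear combination of matrices acts naturally in the module. -/
theorem facComb_act {k : ℕ} (c : (Matrix ι (Fin k) R × Matrix (Fin k) ι R) →₀ K)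
    [Module R D'] (f : D →ₗ[R] D') (z : AddMonoidAlgebra K (ι → D)) :
    facComb D' c (act K (f.toAddMonoidHom.compLeft ι) z) =
      act K (f.toAddMonoidHom.compLeft ι) (facComb D c z) := by
  simp only [facComb_apply, Finsupp.sum, map_sum, map_smul, ← act_comp, matHom_compLeft]

/-- An element of the group algebra that is killed by a homomorphism is killed by the average over
the kernel. -/
theorem mul_avg_ker_eq_zero {G G' : Type*} [AddCommGroup G] [AddCommGroup G'] [Finite G]
    (f : G →+ G') {z : AddMonoidAlgebra K G} (hz : act K f z = 0) : z * avg K f.ker = 0 := by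
  classical
  let L : AddMonoidAlgebra K G' →ₗ[K] AddMonoidAlgebra K G :=
    (Finsupp.lsum K fun y => LinearMap.toSpanSingleton K _
      (if h : ∃ x, f x = y then pt K h.choose * avg K f.ker else 0)) ∘ₗ
      (AddMonoidAlgebra.coeffLinearEquiv K).toLinearMap
  have hL : L ∘ₗ (act K f).toLinearMap = LinearMap.mulRight K (avg K f.ker) := by
    refine ext_pt fun x => ?_
    have h : ∃ x', f x' = f x := ⟨x, rfl⟩
    have h1 : x = h.choose + (x - h.choose) := by abel
    have h2 : x - h.choose ∈ f.ker := by
      rw [AddMonoidHom.mem_ker, map_sub, h.choose_spec, sub_self]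
    rw [LinearMap.comp_apply, AlgHom.toLinearMap_apply, act_pt, LinearMap.mulRight_apply]
    conv_rhs => rw [h1, pt_add, mul_assoc, pt_mul_avg h2]
    simp [L, pt, AddMonoidAlgebra.coeffLinearEquiv]
  have h1 := LinearMap.congr_fun hL z
  rwa [LinearMap.comp_apply, AlgHom.toLinearMap_apply, hz, map_zero, LinearMap.mulRight_apply,
    eq_comm] at h1

theorem isUnit_card_pi {D : Type*} (hD : IsUnit (Nat.card D : K)) :
    IsUnit (Nat.card (ι → D) : K) := by
  rw [Nat.card_fun, Nat.cast_pow]; exact hD.pow _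

theorem isUnit_card_submodule (hD : IsUnit (Nat.card D : K)) (X : Submodule R D) :
    IsUnit (Nat.card X : K) :=
  isUnit_of_dvd_unit (Nat.cast_dvd_cast X.toAddSubgroup.card_addSubgroup_dvd_card) hD

/-- If the section `X / N` of `D` is uniformly generated, then some combination of matrices acts
on tuples with entries in `X` as the identity modulo `N`. -/
theorem exists_mem_facSpan_sub_mul_avg [Finite D] (hD : IsUnit (Nat.card D : K)) {k : ℕ}
    {X N : Submodule R D} (hN : N ≤ X)
    (h : IsUniformlyGenerated R (X ⧸ N.comap X.subtype) K k) (ι : Type) [Fintype ι]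
    [DecidableEq ι] :
    ∃ e ∈ facSpan R ι D K k, ∀ x : ι → D, (∀ i, x i ∈ X) →
      (e (pt K x) - pt K x) * avg K (piSub ι N) = 0 := by
  obtain ⟨c, hc⟩ := exists_facComb_eq (h ι)
  refine ⟨facComb D c, facComb_mem c, fun x hx => ?_⟩
  let x' : ι → X := fun i => ⟨x i, hx i⟩
  set j := X.subtype.toAddMonoidHom.compLeft ι
  set q := (N.comap X.subtype).mkQ.toAddMonoidHom.compLeft ι
  have hx' : j x' = x := rfl
  have h1 : act K q (facComb X c (pt K x') - pt K x') = 0 := by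
    rw [map_sub, ← facComb_act, hc, Module.End.one_apply, sub_self]
  have h2 := congrArg (act K j) (mul_avg_ker_eq_zero q h1)
  have h3 : q.ker.map j = piSub ι N := by
    ext z
    constructor
    · rintro ⟨y, hy, rfl⟩ i
      have h4 : (N.comap X.subtype).mkQ (y i) = 0 := congrFun hy i
      rw [← LinearMap.mem_ker, Submodule.ker_mkQ] at h4
      exact h4
    · intro hz
      refine ⟨fun i => ⟨z i, hN (hz i)⟩, funext fun i => ?_, rfl⟩
      change (N.comap X.subtype).mkQ _ = 0
      rw [← LinearMap.mem_ker, Submodule.ker_mkQ]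
      exact hz i
  rwa [map_mul, map_sub, ← facComb_act, act_pt, hx', act_avg
    (isUnit_card_pi (isUnit_card_submodule hD X)) (isUnit_card_pi hD), h3, map_zero] at h2

/-- Uniform generation is transported along additive isomorphisms that turn scalars into
scalars. -/
theorem IsUniformlyGenerated.of_addEquiv {R' : Type*} [Ring R'] [Module R' D'] {k : ℕ}
    (h : IsUniformlyGenerated R' D' K k) (φ : D' ≃+ D)
    (hφ : ∀ a : R', ∃ b : R, ∀ d, φ (a • d) = b • φ d) : IsUniformlyGenerated R D K k := by
  intro ι _ _
  choose β hβ using hφ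
  have hM : ∀ (κ τ : Type) [Fintype κ] [Fintype τ] (M : Matrix κ τ R') (x : τ → D'),
      φ.toAddMonoidHom.compLeft κ (matHom D' M x) =
        matHom D (M.map β) (φ.toAddMonoidHom.compLeft τ x) := by
    intro κ τ _ _ M x
    funext i
    simp [matHom_apply, hβ]
  set f := φ.toAddMonoidHom.compLeft ι with hf
  set g := φ.symm.toAddMonoidHom.compLeft ι with hg
  have hgf : ∀ x, g (f x) = x := fun x => funext fun i => by simp [hf, hg]
  have hfg : ∀ x, f (g x) = x := fun x => funext fun i => by simp [hf, hg]
  have key : ∀ e ∈ facSpan R' ι D' K k,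
      (act K f).toLinearMap ∘ₗ e ∘ₗ (act K g).toLinearMap ∈ facSpan R ι D K k := by
    intro e he
    induction he using Submodule.span_induction with
    | mem _ h =>
      obtain ⟨Q, P, rfl⟩ := h
      refine Submodule.subset_span ⟨Q.map β, P.map β, ext_pt fun x => ?_⟩
      simp only [LinearMap.comp_apply, AlgHom.toLinearMap_apply, act_pt]
      rw [matHom_mul_apply, hf, hM, hM, ← matHom_mul_apply, ← hf, hfg]
    | zero => rw [LinearMap.zero_comp, LinearMap.comp_zero]; exact zero_mem _
    | add a b _ _ ha hb => rw [LinearMap.add_comp, LinearMap.comp_add]; exact add_mem ha hb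
    | smul c a _ ha =>
      rw [LinearMap.smul_comp, LinearMap.comp_smul]; exact Submodule.smul_mem _ _ ha
  have h1 := key 1 (h ι)
  convert h1 using 1
  refine ext_pt fun x => ?_
  simp [hfg]

/-- It is enough to check uniform generation for arbitrarily large index types. -/
theorem one_mem_facSpan_of_retract {ι' : Type*} [Fintype ι'] [DecidableEq ι] {k : ℕ}
    {A : Matrix ι ι' R} {B : Matrix ι' ι R} (hAB : A * B = 1)
    (h : 1 ∈ facSpan R ι' D K k) : 1 ∈ facSpan R ι D K k := by
  have key : ∀ e ∈ facSpan R ι' D K k,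
      (act K (matHom D A)).toLinearMap ∘ₗ e ∘ₗ (act K (matHom D B)).toLinearMap ∈
        facSpan R ι D K k := by
    intro e he
    induction he using Submodule.span_induction with
    | mem _ h =>
      obtain ⟨Q, P, rfl⟩ := h
      refine Submodule.subset_span ⟨A * Q, P * B, ext_pt fun x => ?_⟩
      simp only [LinearMap.comp_apply, AlgHom.toLinearMap_apply, act_pt, matHom_mul_apply]
    | zero => rw [LinearMap.zero_comp, LinearMap.comp_zero]; exact zero_mem _
    | add a b _ _ ha hb => rw [LinearMap.add_comp, LinearMap.comp_add]; exact add_mem ha hb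
    | smul c a _ ha =>
      rw [LinearMap.smul_comp, LinearMap.comp_smul]; exact Submodule.smul_mem _ _ ha
  have h1 := key 1 h
  convert h1 using 1
  refine ext_pt fun x => ?_
  simp only [Module.End.one_apply, LinearMap.comp_apply, AlgHom.toLinearMap_apply, act_pt]
  rw [← matHom_mul_apply, hAB, matHom_one, AddMonoidHom.id_apply]

end Naturality

/-! ### Simple modules -/

section SimpleModules

variable {R : Type*} [Ring R] {K : Type*} [CommRing K] {D : Type*} [AddCommGroup D] [Module R D]

/-- A finite vector space over a field `F` on which every `F`-linear map is given by a scalar from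
the ring `R` is uniformly generated by unary functions: matrices of rank at most one over `F`
factor through `D`. -/
theorem isUniformlyGenerated_one_of_field {F : Type*} [Field F] [Fintype F] [Module F D]
    [Nontrivial D] [Finite D] (hF : IsUnit (Fintype.card F : K))
    (h : ∀ g : D →ₗ[F] D, ∃ r : R, ∀ d, g d = r • d) : IsUniformlyGenerated R D K 1 := by
  intro ι _ _
  obtain ⟨d₀, hd₀⟩ := exists_ne (0 : D)
  obtain ⟨f₀, hf₀⟩ : ∃ f : D →ₗ[F] F, f d₀ = 1 := by
    obtain ⟨f, hf⟩ := not_forall.1 (mt (Module.forall_dual_apply_eq_zero_iff F d₀).1 hd₀)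
    exact ⟨(f d₀)⁻¹ • f, by simp [hf]⟩
  let n := Module.finrank F (ι → D)
  let b : (ι → D) ≃ₗ[F] (Fin n → F) := (Module.finBasis F (ι → D)).equivFun
  let φ : (ι → D) ≃ₗ[F] (Fin n → Fin 1 → F) :=
    b ≪≫ₗ LinearEquiv.piCongrRight fun _ => (LinearEquiv.funUnique (Fin 1) F F).symm
  have key : ∀ e ∈ facSpan F (Fin n) (Fin 1 → F) K 1,
      (act K φ.symm.toLinearMap.toAddMonoidHom).toLinearMap ∘ₗ e ∘ₗ
        (act K φ.toLinearMap.toAddMonoidHom).toLinearMap ∈ facSpan R ι D K 1 := by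
    intro e he
    induction he using Submodule.span_induction with
    | mem _ h' =>
      obtain ⟨Q, P, rfl⟩ := h'
      -- `p` and `q` are the two factors, as linear maps through `F`.
      let p : (ι → D) →ₗ[F] F :=
        { toFun := fun x => matHom (Fin 1 → F) P (φ x) 0 0
          map_add' := fun x y => by simp
          map_smul' := fun a x => by
            simp [matHom_apply, Finset.mul_sum, mul_left_comm] }
      let q : F →ₗ[F] (ι → D) :=
        { toFun := fun a => φ.symm (matHom (Fin 1 → F) Q fun _ _ => a)
          map_add' := fun x y => by rw [← map_add, ← map_add]; rfl
          map_smul' := fun a x => by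
            rw [RingHom.id_apply, ← map_smul]
            congr 1
            funext i j
            simp [matHom_apply, mul_left_comm] }
      choose B hB using fun i => h (LinearMap.toSpanSingleton F D d₀ ∘ₗ p ∘ₗ
        LinearMap.single F (fun _ : ι => D) i)
      choose A hA using fun i => h (LinearMap.proj i ∘ₗ q ∘ₗ f₀)
      refine Submodule.subset_span ⟨Matrix.of fun i _ => A i, Matrix.of fun _ i => B i,
        ext_pt fun x => ?_⟩
      simp only [LinearMap.comp_apply, AlgHom.toLinearMap_apply, act_pt]
      congr 1
      funext i
      have h1 : matHom D (Matrix.of fun (_ : Fin 1) i => B i) x = fun _ => p x • d₀ := by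
        funext j
        simp only [matHom_apply, Matrix.of_apply, ← hB]
        simp only [LinearMap.comp_apply, ← map_sum]
        simp only [LinearMap.coe_single, Finset.univ_sum_single, LinearMap.toSpanSingleton_apply]
      rw [matHom_mul_apply, matHom_mul_apply, h1, matHom_apply]
      simp only [Finset.univ_unique, Finset.sum_singleton, Matrix.of_apply, ← hA]
      have h2 : f₀ (p x • d₀) = p x := by rw [map_smul, hf₀, smul_eq_mul, mul_one]
      rw [LinearMap.comp_apply, LinearMap.comp_apply, h2, LinearMap.proj_apply]
      change φ.symm (matHom (Fin 1 → F) Q (matHom (Fin 1 → F) P (φ x))) i =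
        φ.symm (matHom (Fin 1 → F) Q fun _ _ => matHom (Fin 1 → F) P (φ x) 0 0) i
      congr 3
    | zero => rw [LinearMap.zero_comp, LinearMap.comp_zero]; exact zero_mem _
    | add a b _ _ ha hb => rw [LinearMap.add_comp, LinearMap.comp_add]; exact add_mem ha hb
    | smul c a _ ha =>
      rw [LinearMap.smul_comp, LinearMap.comp_smul]; exact Submodule.smul_mem _ _ ha
  have h1 := key 1 (isUniformlyGenerated_field hF 1 (Fin n))
  convert h1 using 1
  refine ext_pt fun x => ?_
  simp

open Classical in
theorem isUniformlyGenerated_one_of_isSimpleModule [Finite D] [IsSimpleModule R D]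
    (hD : IsUnit (Nat.card D : K)) : IsUniformlyGenerated R D K 1 := by
  have := IsSimpleModule.nontrivial R D
  have : Finite (Module.End R D) :=
    Finite.of_injective (fun f => (f : D → D)) DFunLike.coe_injective
  let _ : Field (Module.End R D) := littleWedderburn _
  let _ := Fintype.ofFinite (Module.End R D)
  refine isUniformlyGenerated_one_of_field (F := Module.End R D) ?_ fun g => ?_
  · refine isUnit_of_dvd_unit (Nat.cast_dvd_cast ?_) hD
    rw [Module.natCard_eq_pow_finrank (K := Module.End R D) (V := D), Nat.card_eq_fintype_card]
    exact dvd_pow_self _ Module.finrank_pos.ne'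
  · cases nonempty_fintype D
    obtain ⟨r, hr⟩ := jacobson_density g Finset.univ
    exact ⟨r, fun d => hr d (Finset.mem_univ d)⟩

end SimpleModules

/-! ### Products -/

section Products

variable {R₁ R₂ : Type*} [Ring R₁] [Ring R₂] {K : Type*} [CommRing K] {D₁ D₂ : Type*}
  [AddCommGroup D₁] [Module R₁ D₁] [AddCommGroup D₂] [Module R₂ D₂]

/-- The matrix over `R₁ × R₂` with given components. -/
def prodMat {ι κ : Type*} (M : Matrix ι κ R₁) (N : Matrix ι κ R₂) : Matrix ι κ (R₁ × R₂) :=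
  Matrix.of fun i j => (M i j, N i j)

theorem prodMat_mul {ι κ τ : Type*} [Fintype κ] (M : Matrix ι κ R₁) (N : Matrix ι κ R₂)
    (M' : Matrix κ τ R₁) (N' : Matrix κ τ R₂) :
    prodMat (M * M') (N * N') = prodMat M N * prodMat M' N' := by
  refine Matrix.ext fun i j => Prod.ext ?_ ?_ <;>
  simp [prodMat, Matrix.mul_apply, Prod.fst_sum, Prod.snd_sum]

/-- If two modules are uniformly generated by `k`-ary functions, then so is their product, as a
module over the product of the rings. -/
theorem IsUniformlyGenerated.prod {k : ℕ} (h₁ : IsUniformlyGenerated R₁ D₁ K k)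
    (h₂ : IsUniformlyGenerated R₂ D₂ K k) :
    IsUniformlyGenerated (R₁ × R₂) (D₁ × D₂) K k := by
  intro ι _ _
  let i₁ : (ι → D₁) →+ (ι → D₁ × D₂) := (AddMonoidHom.inl D₁ D₂).compLeft ι
  let i₂ : (ι → D₂) →+ (ι → D₁ × D₂) := (AddMonoidHom.inr D₁ D₂).compLeft ι
  have hM : ∀ (M : Matrix ι ι R₁) (N : Matrix ι ι R₂) z₁ z₂,
      act K (matHom (D₁ × D₂) (prodMat M N)) (act K i₁ z₁ * act K i₂ z₂) =
        act K i₁ (act K (matHom D₁ M) z₁) * act K i₂ (act K (matHom D₂ N) z₂) := by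
    intro M N z₁ z₂
    rw [map_mul, ← act_comp, ← act_comp, ← act_comp, ← act_comp]
    congr 3
    · refine AddMonoidHom.ext fun x => funext fun i => Prod.ext ?_ ?_
      · simp [i₁, matHom_apply, Prod.fst_sum]; rfl
      · simp [i₁, matHom_apply, Prod.snd_sum]
        exact Finset.sum_eq_zero fun j _ => smul_zero (N i j)
    · refine AddMonoidHom.ext fun x => funext fun i => Prod.ext ?_ ?_
      · simp [i₂, matHom_apply, Prod.fst_sum]
        exact Finset.sum_eq_zero fun j _ => smul_zero (M i j)
      · simp [i₂, matHom_apply, Prod.snd_sum]; rfl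
  have key : ∀ e₁ ∈ facSpan R₁ ι D₁ K k, ∀ e₂ ∈ facSpan R₂ ι D₂ K k,
      ∃ e ∈ facSpan (R₁ × R₂) ι (D₁ × D₂) K k, ∀ z₁ z₂,
        e (act K i₁ z₁ * act K i₂ z₂) = act K i₁ (e₁ z₁) * act K i₂ (e₂ z₂) := by
    intro e₁ he₁ e₂ he₂
    induction he₁ using Submodule.span_induction with
    | mem _ h =>
      obtain ⟨Q, P, rfl⟩ := h
      induction he₂ using Submodule.span_induction with
      | mem _ h =>
        obtain ⟨Q', P', rfl⟩ := h
        refine ⟨_, Submodule.subset_span ⟨prodMat Q Q', prodMat P P', rfl⟩, fun z₁ z₂ => ?_⟩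
        rw [← prodMat_mul]
        exact hM _ _ _ _
      | zero => exact ⟨0, zero_mem _, fun z₁ z₂ => by simp⟩
      | add a b _ _ ha hb =>
        obtain ⟨e, he, hez⟩ := ha
        obtain ⟨e', he', hez'⟩ := hb
        refine ⟨e + e', add_mem he he', fun z₁ z₂ => ?_⟩
        rw [LinearMap.add_apply, hez, hez', LinearMap.add_apply, map_add, mul_add]
      | smul c a _ ha =>
        obtain ⟨e, he, hez⟩ := ha
        refine ⟨c • e, Submodule.smul_mem _ _ he, fun z₁ z₂ => ?_⟩
        rw [LinearMap.smul_apply, hez, LinearMap.smul_apply, map_smul, mul_smul_comm]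
    | zero => exact ⟨0, zero_mem _, fun z₁ z₂ => by simp⟩
    | add a b _ _ ha hb =>
      obtain ⟨e, he, hez⟩ := ha
      obtain ⟨e', he', hez'⟩ := hb
      refine ⟨e + e', add_mem he he', fun z₁ z₂ => ?_⟩
      rw [LinearMap.add_apply, hez, hez', LinearMap.add_apply, map_add, add_mul]
    | smul c a _ ha =>
      obtain ⟨e, he, hez⟩ := ha
      refine ⟨c • e, Submodule.smul_mem _ _ he, fun z₁ z₂ => ?_⟩
      rw [LinearMap.smul_apply, hez, LinearMap.smul_apply, map_smul, smul_mul_assoc]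
  obtain ⟨e, he, hez⟩ := key 1 (h₁ ι) 1 (h₂ ι)
  convert he using 1
  refine ext_pt fun x => ?_
  have hx : pt K x = act K i₁ (pt K fun i => (x i).1) * act K i₂ (pt K fun i => (x i).2) := by
    rw [act_pt, act_pt, ← pt_add]
    congr 1
    funext i
    exact Prod.ext (by simp [i₁, i₂]) (by simp [i₁, i₂])
  rw [hx, hez]; rfl

/-- If `D` is the direct sum of two submodules and the projections are given by ring elements,
then uniform generation of the summands implies that of `D`. -/
theorem IsUniformlyGenerated.of_isCompl {R : Type*} [Ring R] {D : Type*} [AddCommGroup D]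
    [Module R D] {k : ℕ} {X Y : Submodule R D} (hXY : IsCompl X Y) {r : R}
    (hrX : ∀ x ∈ X, r • x = x) (hrY : ∀ y ∈ Y, r • y = 0) (hX : IsUniformlyGenerated R X K k)
    (hY : IsUniformlyGenerated R Y K k) : IsUniformlyGenerated R D K k := by
  refine (hX.prod hY).of_addEquiv (Submodule.prodEquivOfIsCompl X Y hXY).toAddEquiv
    fun a => ⟨a.1 * r + a.2 * (1 - r), ?_⟩
  rintro ⟨x, y⟩
  change (a.1 • x : D) + (a.2 • y : D) = (a.1 * r + a.2 * (1 - r)) • ((x : D) + y)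
  simp only [add_smul, mul_smul, sub_smul, one_smul, smul_add, hrX x x.2, hrY y y.2, smul_zero,
    sub_self, zero_add, add_zero, sub_zero]

theorem isUniformlyGenerated_of_subsingleton {R : Type*} [Ring R] {D : Type*} [AddCommGroup D]
    [Module R D] [Subsingleton D] (k : ℕ) : IsUniformlyGenerated R D K k := by
  intro ι _ _
  have : (1 : Module.End K (AddMonoidAlgebra K (ι → D))) =
      (act K (matHom _ ((0 : Matrix ι (Fin k) R) * (0 : Matrix (Fin k) ι R)))).toLinearMap :=
    ext_pt fun x => by
      simp only [Module.End.one_apply, AlgHom.toLinearMap_apply, act_pt]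
      congr 1
      exact Subsingleton.elim _ _
  rw [this]
  exact Submodule.subset_span ⟨_, _, rfl⟩

theorem IsUniformlyGenerated.pi {K : Type*} [CommRing K] {k n : ℕ} {R D : Fin n → Type*}
    [∀ i, Ring (R i)] [∀ i, AddCommGroup (D i)] [∀ i, Module (R i) (D i)]
    (h : ∀ i, IsUniformlyGenerated (R i) (D i) K k) :
    IsUniformlyGenerated (∀ i, R i) (∀ i, D i) K k := by
  induction n with
  | zero => exact isUniformlyGenerated_of_subsingleton k
  | succ n ih =>
    refine ((h 0).prod (ih fun i => h i.succ)).of_addEquiv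
      { toFun := fun x => Fin.cons x.1 x.2
        invFun := fun x => (x 0, fun i => x i.succ)
        left_inv := fun x => rfl
        right_inv := fun x => Fin.cons_self_tail x
        map_add' := fun x y => ?_ } fun a => ⟨Fin.cons a.1 a.2, fun d => ?_⟩
    · funext i
      refine Fin.cases rfl (fun i => rfl) i
    · funext i
      refine Fin.cases rfl (fun i => rfl) i

end Products

/-! ### Averages of matrices -/

section AveragingOperators

variable {R : Type*} [Ring R] {ι : Type*} {K : Type*} [CommRing K]
  {D : Type*} [AddCommGroup D] [Module R D]

/-- The tuples with entries in `L` that vanish outside of `S`. -/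
def coordSub (S : Set ι) (L : Submodule R D) : AddSubgroup (ι → D) where
  carrier := {z | (∀ s, z s ∈ L) ∧ ∀ s ∉ S, z s = 0}
  zero_mem' := ⟨fun _ => zero_mem _, fun _ _ => rfl⟩
  add_mem' hx hy := ⟨fun s => add_mem (hx.1 s) (hy.1 s), fun s hs => by
    rw [Pi.add_apply, hx.2 s hs, hy.2 s hs, add_zero]⟩
  neg_mem' hx := ⟨fun s => neg_mem (hx.1 s), fun s hs => by
    rw [Pi.neg_apply, hx.2 s hs, neg_zero]⟩

theorem coordSub_mono (S : Set ι) {L L' : Submodule R D} (h : L ≤ L') :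
    coordSub S L ≤ coordSub S L' := fun _ hz => ⟨fun s => h (hz.1 s), hz.2⟩

theorem coordSub_bot (S : Set ι) : coordSub S (⊥ : Submodule R D) = ⊥ :=
  le_bot_iff.1 fun _ hz => funext hz.1

variable [Fintype ι]

/-- The matrices with entries in a left ideal and with support in `S × T`. -/
def matSub (I : Ideal R) (S T : Set ι) : AddSubgroup (Matrix ι ι R) where
  carrier := {B | (∀ s t, B s t ∈ I) ∧ (∀ s ∉ S, ∀ t, B s t = 0) ∧ ∀ t ∉ T, ∀ s, B s t = 0}
  zero_mem' := ⟨fun _ _ => zero_mem _, fun _ _ _ => rfl, fun _ _ _ => rfl⟩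
  add_mem' hx hy := ⟨fun s t => add_mem (hx.1 s t) (hy.1 s t),
    fun s hs t => by rw [Matrix.add_apply, hx.2.1 s hs, hy.2.1 s hs, add_zero],
    fun t ht s => by rw [Matrix.add_apply, hx.2.2 t ht, hy.2.2 t ht, add_zero]⟩
  neg_mem' hx := ⟨fun s t => neg_mem (hx.1 s t),
    fun s hs t => by rw [Matrix.neg_apply, hx.2.1 s hs, neg_zero],
    fun t ht s => by rw [Matrix.neg_apply, hx.2.2 t ht, neg_zero]⟩

/-- The submodule generated by the products of the elements of a left ideal with the entries
`x t`, `t ∈ T`. -/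
def idealSpan (I : Ideal R) (T : Set ι) (x : ι → D) : Submodule R D where
  carrier := {d | ∃ a : ι → R, (∀ t, a t ∈ I) ∧ (∀ t ∉ T, a t = 0) ∧ ∑ t, a t • x t = d}
  zero_mem' := ⟨0, fun _ => zero_mem _, fun _ _ => rfl, by simp⟩
  add_mem' := by
    rintro _ _ ⟨a, ha, haT, rfl⟩ ⟨b, hb, hbT, rfl⟩
    exact ⟨a + b, fun t => add_mem (ha t) (hb t),
      fun t ht => by rw [Pi.add_apply, haT t ht, hbT t ht, add_zero],
      by simp [add_smul, Finset.sum_add_distrib]⟩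
  smul_mem' := by
    rintro r _ ⟨a, ha, haT, rfl⟩
    exact ⟨fun t => r * a t, fun t => I.mul_mem_left _ (ha t),
      fun t ht => by simp only [haT t ht, mul_zero], by simp [Finset.smul_sum, mul_smul]⟩

theorem smul_mem_idealSpan {I : Ideal R} {T : Set ι} (x : ι → D) {a : R} (ha : a ∈ I) {t : ι}
    (ht : t ∈ T) : a • x t ∈ idealSpan I T x := by
  classical
  refine ⟨Pi.single t a, fun s => ?_, fun s hs => ?_, ?_⟩
  · by_cases h : s = t
    · subst h; rwa [Pi.single_eq_same]
    · rw [Pi.single_eq_of_ne h]; exact zero_mem _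
  · exact Pi.single_eq_of_ne (fun h => hs (by rw [h]; exact ht)) _
  · rw [Finset.sum_eq_single t (fun s _ hs => by rw [Pi.single_eq_of_ne hs, zero_smul])
      (fun h => absurd (Finset.mem_univ t) h), Pi.single_eq_same]

theorem idealSpan_le {I : Ideal R} {T : Set ι} {x : ι → D} {L : Submodule R D}
    (h : ∀ a ∈ I, ∀ t ∈ T, a • x t ∈ L) : idealSpan I T x ≤ L := by
  rintro _ ⟨a, ha, haT, rfl⟩
  refine sum_mem fun t _ => ?_
  by_cases ht : t ∈ T
  · exact h _ (ha t) t ht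
  · rw [haT t ht, zero_smul]; exact zero_mem _

theorem idealSpan_mono {I I' : Ideal R} (h : I ≤ I') (T : Set ι) (x : ι → D) :
    idealSpan I T x ≤ idealSpan I' T x :=
  idealSpan_le fun _ ha _ ht => smul_mem_idealSpan x (h ha) ht

theorem idealSpan_congr {I : Ideal R} {T : Set ι} {x y : ι → D}
    (h : ∀ a ∈ I, ∀ t ∈ T, a • x t = a • y t) : idealSpan I T x = idealSpan I T y :=
  le_antisymm (idealSpan_le fun a ha t ht => by rw [h a ha t ht]; exact smul_mem_idealSpan y ha ht)
    (idealSpan_le fun a ha t ht => by rw [← h a ha t ht]; exact smul_mem_idealSpan x ha ht)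

variable (K D) in
/-- The average of the operators given by the matrices `1 + B`, where `B` has entries in `I` and
support in `S × T`. -/
noncomputable def avOp [Finite R] [DecidableEq ι] (I : Ideal R) (S T : Set ι) :
    Module.End K (AddMonoidAlgebra K (ι → D)) :=
  Ring.inverse (Nat.card (matSub I S T) : K) •
    ∑ᶠ B : matSub I S T, (act K (matHom D (1 + (B : Matrix ι ι R)))).toLinearMap

theorem isUnit_card_matSub (hR : IsUnit (Nat.card R : K)) (I : Ideal R) (S T : Set ι) :
    IsUnit (Nat.card (matSub I S T) : K) := by
  refine isUnit_of_dvd_unit (Nat.cast_dvd_cast (matSub I S T).card_addSubgroup_dvd_card) ?_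
  rw [← Nat.card_congr (Matrix.of (m := ι) (n := ι) (α := R)), Nat.card_fun, Nat.card_fun,
    Nat.cast_pow, Nat.cast_pow]
  exact (hR.pow _).pow _

/-- The averaging operator multiplies a basis element by the average over a subgroup. -/
theorem avOp_pt [Finite R] [DecidableEq ι] [Finite D] (hR : IsUnit (Nat.card R : K))
    (hD : IsUnit (Nat.card D : K)) (I : Ideal R) (S T : Set ι) (x : ι → D) :
    avOp K D I S T (pt K x) = pt K x * avg K (coordSub S (idealSpan I T x)) := by
  classical
  cases nonempty_fintype R
  have : Fintype (matSub I S T) := Fintype.ofFinite _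
  let f : matSub I S T →+ (ι → D) :=
    { toFun := fun B => matHom D (B : Matrix ι ι R) x
      map_zero' := matHom_zero_apply x
      map_add' := fun B B' => matHom_add_apply _ _ x }
  have hf : f.range = coordSub S (idealSpan I T x) := by
    ext z
    constructor
    · rintro ⟨⟨B, hB1, hB2, hB3⟩, rfl⟩
      refine ⟨fun s => ⟨B s, hB1 s, fun t ht => hB3 t ht s, rfl⟩, fun s hs => ?_⟩
      exact Finset.sum_eq_zero fun t _ => by simp only [hB2 s hs t, zero_smul]
    · rintro ⟨hz, hzS⟩
      choose a ha haT haz using hz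
      refine ⟨⟨Matrix.of fun s t => if s ∈ S then a s t else 0, fun s t => ?_, fun s hs t => ?_,
        fun t ht s => ?_⟩, funext fun s => ?_⟩
      · rw [Matrix.of_apply]; split_ifs
        · exact ha s t
        · exact zero_mem _
      · rw [Matrix.of_apply, if_neg hs]
      · rw [Matrix.of_apply, haT s t ht, ite_self]
      · change ∑ t, (if s ∈ S then a s t else 0) • x t = z s
        by_cases hs : s ∈ S
        · simp only [if_pos hs]; exact haz s
        · simp only [if_neg hs, zero_smul, Finset.sum_const_zero]; exact (hzS s hs).symm
  have hu := isUnit_card_matSub hR I S T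
  rw [Nat.card_eq_fintype_card] at hu
  rw [← hf, ← avg_range (isUnit_card_pi hD) hu, avOp, finsum_eq_sum_of_fintype,
    LinearMap.smul_apply, LinearMap.sum_apply, mul_smul_comm, Finset.mul_sum,
    Nat.card_eq_fintype_card]
  congr 1
  refine Finset.sum_congr rfl fun B _ => ?_
  rw [AlgHom.toLinearMap_apply, act_pt, ← pt_add, matHom_add_apply, matHom_one]
  rfl

end AveragingOperators

/-! ### Operators acting on a coset by multiplication -/

section ActsBy

variable {K : Type*} [CommRing K] {G : Type*} [AddCommGroup G]

variable (K) in
/-- The span of the elements of a subgroup. -/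
noncomputable def ptSpan (U : AddSubgroup G) : Submodule K (AddMonoidAlgebra K G) :=
  Submodule.span K (pt K '' U)

/-- The operator `Φ` acts on the coset `x + U` as multiplication by `w`. -/
def ActsBy (U : AddSubgroup G) (Φ : Module.End K (AddMonoidAlgebra K G)) (x : G)
    (w : AddMonoidAlgebra K G) : Prop :=
  ∀ u ∈ U, Φ (pt K (x + u)) = pt K (x + u) * w

variable {U : AddSubgroup G} {Φ Ψ : Module.End K (AddMonoidAlgebra K G)} {x : G}
  {w w' : AddMonoidAlgebra K G}

theorem pt_mem_ptSpan (hx : x ∈ U) : pt K x ∈ ptSpan K U := Submodule.subset_span ⟨x, hx, rfl⟩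

theorem one_mem_ptSpan : 1 ∈ ptSpan K U := pt_mem_ptSpan U.zero_mem

theorem avg_mem_ptSpan [Finite G] {H : AddSubgroup G} (h : H ≤ U) : avg K H ∈ ptSpan K U :=
  Submodule.smul_mem _ _ (sum_mem fun x hx => pt_mem_ptSpan (h (by simpa using hx)))

theorem mul_mem_ptSpan (h : w ∈ ptSpan K U) (h' : w' ∈ ptSpan K U) : w * w' ∈ ptSpan K U := by
  induction h using Submodule.span_induction with
  | mem _ h =>
    obtain ⟨x, hx, rfl⟩ := h
    induction h' using Submodule.span_induction with
    | mem _ h =>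
      obtain ⟨y, hy, rfl⟩ := h
      rw [← pt_add]
      exact pt_mem_ptSpan (add_mem hx hy)
    | zero => rw [mul_zero]; exact zero_mem _
    | add a b _ _ ha hb => rw [mul_add]; exact add_mem ha hb
    | smul c a _ ha => rw [mul_smul_comm]; exact Submodule.smul_mem _ _ ha
  | zero => rw [zero_mul]; exact zero_mem _
  | add a b _ _ ha hb => rw [add_mul]; exact add_mem ha hb
  | smul c a _ ha => rw [smul_mul_assoc]; exact Submodule.smul_mem _ _ ha

theorem prod_mem_ptSpan {I : Type*} (L : List I) {w : I → AddMonoidAlgebra K G}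
    (h : ∀ i ∈ L, w i ∈ ptSpan K U) : (L.map w).prod ∈ ptSpan K U := by
  induction L with
  | nil => exact one_mem_ptSpan
  | cons i L ih =>
    rw [List.map_cons, List.prod_cons]
    exact mul_mem_ptSpan (h i (by simp)) (ih fun j hj => h j (by simp [hj]))

theorem ActsBy.pt_mul (h : ActsBy U Φ x w) {z : AddMonoidAlgebra K G} (hz : z ∈ ptSpan K U) :
    Φ (pt K x * z) = pt K x * z * w := by
  induction hz using Submodule.span_induction with
  | mem _ h' =>
    obtain ⟨u, hu, rfl⟩ := h'
    rw [← pt_add]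
    exact h u hu
  | zero => rw [mul_zero, zero_mul, map_zero]
  | add a b _ _ ha hb => rw [mul_add, map_add, ha, hb, add_mul]
  | smul c a _ ha => rw [mul_smul_comm, map_smul, ha, smul_mul_assoc]

theorem ActsBy.add (h : ActsBy U Φ x w) {u : G} (hu : u ∈ U) : ActsBy U Φ (x + u) w :=
  fun v hv => by rw [add_assoc]; exact h _ (add_mem hu hv)

theorem ActsBy.mul (h : ActsBy U Φ x w) (h' : ActsBy U Ψ x w') (hw : w' ∈ ptSpan K U) :
    ActsBy U (Φ * Ψ) x (w' * w) := by
  intro u hu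
  rw [Module.End.mul_apply, h' u hu, (h.add hu).pt_mul hw, mul_assoc]

theorem ActsBy.one_sub (h : ActsBy U Φ x w) : ActsBy U (1 - Φ) x (1 - w) := by
  intro u hu
  rw [LinearMap.sub_apply, h u hu, Module.End.one_apply, mul_sub, mul_one]

theorem ActsBy.prod {I : Type*} (L : List I) {Φ : I → Module.End K (AddMonoidAlgebra K G)}
    {w : I → AddMonoidAlgebra K G} (h : ∀ i, ActsBy U (Φ i) x (w i))
    (hw : ∀ i, w i ∈ ptSpan K U) : ActsBy U (L.map Φ).prod x (L.map w).prod := by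
  induction L with
  | nil => intro u _; simp
  | cons i L ih =>
    rw [List.map_cons, List.prod_cons, List.map_cons, List.prod_cons, mul_comm (w i)]
    exact (h i).mul ih (prod_mem_ptSpan L fun i _ => hw i)

end ActsBy

/-! ### Operators and blocks -/

section MatrixAlgebra

variable {R : Type*} [Ring R] {ι : Type*} [Fintype ι] {K : Type*} [CommRing K]
  {D : Type*} [AddCommGroup D] [Module R D]

theorem mul_facSpan_mem {k k' : ℕ} {e e' : Module.End K (AddMonoidAlgebra K (ι → D))}
    (he : e ∈ facSpan R ι D K k') (he' : e' ∈ facSpan R ι D K k) :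
    e * e' ∈ facSpan R ι D K k := by
  induction he using Submodule.span_induction with
  | mem _ h =>
    obtain ⟨Q, P, rfl⟩ := h
    exact act_mul_mem_facSpan _ he'
  | zero => rw [zero_mul]; exact zero_mem _
  | add a b _ _ ha hb => rw [add_mul]; exact add_mem ha hb
  | smul c a _ ha => rw [smul_mul_assoc]; exact Submodule.smul_mem _ _ ha

theorem facSpan_mul_mem {k k' : ℕ} {e e' : Module.End K (AddMonoidAlgebra K (ι → D))}
    (he : e ∈ facSpan R ι D K k) (he' : e' ∈ facSpan R ι D K k') :
    e * e' ∈ facSpan R ι D K k := by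
  induction he' using Submodule.span_induction with
  | mem _ h =>
    obtain ⟨Q, P, rfl⟩ := h
    exact mul_act_mem_facSpan _ he
  | zero => rw [mul_zero]; exact zero_mem _
  | add a b _ _ ha hb => rw [mul_add]; exact add_mem ha hb
  | smul c a _ ha => rw [mul_smul_comm]; exact Submodule.smul_mem _ _ ha

theorem act_mem_facSpan_card (M : Matrix ι ι R) :
    (act K (matHom D M)).toLinearMap ∈ facSpan R ι D K (Fintype.card ι) := by
  classical
  rw [← Matrix.mul_one M]
  exact act_mem_facSpan _ _ le_rfl

theorem avOp_mem_facSpan [Finite R] [DecidableEq ι] (I : Ideal R) (S T : Set ι) :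
    avOp K D I S T ∈ facSpan R ι D K (Fintype.card ι) := by
  have : Fintype (matSub I S T) := Fintype.ofFinite _
  rw [avOp, finsum_eq_sum_of_fintype]
  exact Submodule.smul_mem _ _ (sum_mem fun B _ => act_mem_facSpan_card _)

theorem list_prod_mem_facSpan [DecidableEq ι]
    (L : List (Module.End K (AddMonoidAlgebra K (ι → D))))
    (h : ∀ δ ∈ L, δ ∈ facSpan R ι D K (Fintype.card ι)) :
    L.prod ∈ facSpan R ι D K (Fintype.card ι) := by
  induction L with
  | nil => exact one_mem_facSpan_of_card_le le_rfl
  | cons a L ih =>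
    rw [List.prod_cons]
    exact mul_mem_facSpan (h a (by simp)) (ih fun δ hδ => h δ (by simp [hδ]))

end MatrixAlgebra

section BlockOperators

variable {R : Type*} [Ring R] {K : Type*} [CommRing K] {D : Type*} [AddCommGroup D] [Module R D]

variable (D) in
/-- The inclusion of the first block of coordinates. -/
def inlHom (σ τ : Type*) : (σ → D) →+ (σ ⊕ τ → D) where
  toFun x := Sum.elim x 0
  map_zero' := funext fun i => by cases i <;> rfl
  map_add' x y := funext fun i => by cases i <;> simp

variable (D) in
/-- The inclusion of the second block of coordinates. -/
def inrHom (σ τ : Type*) : (τ → D) →+ (σ ⊕ τ → D) where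
  toFun x := Sum.elim 0 x
  map_zero' := funext fun i => by cases i <;> rfl
  map_add' x y := funext fun i => by cases i <;> simp

theorem inlHom_add_inrHom {σ τ : Type*} (x : σ ⊕ τ → D) :
    inlHom D σ τ (fun s => x (.inl s)) + inrHom D σ τ (fun t => x (.inr t)) = x :=
  funext fun i => by cases i <;> simp [inlHom, inrHom]

/-- A combination of matrices through `R^k` on the second block extends to one through
`R^(k + |σ|)` that fixes the first block. -/
theorem exists_block_extension {σ τ : Type*} [Fintype σ] [DecidableEq σ] [Fintype τ] {k : ℕ}
    {e : Module.End K (AddMonoidAlgebra K (τ → D))} (he : e ∈ facSpan R τ D K k) :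
    ∃ ê ∈ facSpan R (σ ⊕ τ) D K (Fintype.card σ + k), ∀ z₁ z₂,
      ê (act K (inlHom D σ τ) z₁ * act K (inrHom D σ τ) z₂) =
        act K (inlHom D σ τ) z₁ * act K (inrHom D σ τ) (e z₂) := by
  induction he using Submodule.span_induction with
  | mem _ h =>
    obtain ⟨Q, P, rfl⟩ := h
    refine ⟨_, act_mem_facSpan (Matrix.fromBlocks (1 : Matrix σ σ R) 0 0 Q)
      (Matrix.fromBlocks (1 : Matrix σ σ R) 0 0 P) (by simp), fun z₁ z₂ => ?_⟩
    rw [AlgHom.toLinearMap_apply, map_mul, AlgHom.toLinearMap_apply, Matrix.fromBlocks_multiply,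
      ← act_comp, ← act_comp, ← act_comp]
    congr 3
    · refine AddMonoidHom.ext fun x => funext fun i => ?_
      cases i <;> simp [matHom_apply, inlHom, Matrix.one_apply]
    · refine AddMonoidHom.ext fun x => funext fun i => ?_
      cases i <;> simp [matHom_apply, inrHom]
  | zero => exact ⟨0, zero_mem _, fun z₁ z₂ => by simp⟩
  | add a b _ _ ha hb =>
    obtain ⟨e, he, hez⟩ := ha
    obtain ⟨e', he', hez'⟩ := hb
    refine ⟨e + e', add_mem he he', fun z₁ z₂ => ?_⟩
    rw [LinearMap.add_apply, hez, hez', LinearMap.add_apply, map_add, mul_add]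
  | smul c a _ ha =>
    obtain ⟨e, he, hez⟩ := ha
    refine ⟨c • e, Submodule.smul_mem _ _ he, fun z₁ z₂ => ?_⟩
    rw [LinearMap.smul_apply, hez, LinearMap.smul_apply, map_smul, mul_smul_comm]

end BlockOperators

/-! ### Ring elements mapping into the socle -/

section SocleIdeals

variable {R : Type*} [Ring R] {D : Type*} [AddCommGroup D] [Module R D]

/-- The ring elements that annihilate `J D` and map `D` into `L`. -/
def socIdeal (L : Submodule R D) : Ideal R where
  carrier := {a | (∀ m ∈ Ring.jacobson R • (⊤ : Submodule R D), a • m = 0) ∧ ∀ m : D, a • m ∈ L}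
  zero_mem' := ⟨fun _ _ => zero_smul _ _, fun m => by rw [zero_smul]; exact zero_mem _⟩
  add_mem' ha hb := ⟨fun m hm => by rw [add_smul, ha.1 m hm, hb.1 m hm, add_zero],
    fun m => by rw [add_smul]; exact add_mem (ha.2 m) (hb.2 m)⟩
  smul_mem' r a ha := ⟨fun m hm => by rw [smul_eq_mul, mul_smul, ha.1 m hm, smul_zero],
    fun m => by rw [smul_eq_mul, mul_smul]; exact L.smul_mem _ (ha.2 m)⟩

theorem socIdeal_mono {L L' : Submodule R D} (h : L ≤ L') : socIdeal L ≤ socIdeal L' :=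
  fun _ ha => ⟨ha.1, fun m => h (ha.2 m)⟩

theorem isAtom_le_killedBy {N : Submodule R D} (hN : IsAtom N) :
    N ≤ killedBy D (Ring.jacobson R) := fun _ hm _ ha => hN.jacobson_smul_eq_zero ha hm

variable {ι : Type*} [Fintype ι]

theorem idealSpan_socIdeal_le (L : Submodule R D) (T : Set ι) (x : ι → D) :
    idealSpan (socIdeal L) T x ≤ L := idealSpan_le fun _ ha _ _ => ha.2 _

theorem idealSpan_socIdeal_add (L : Submodule R D) (T : Set ι) {x u : ι → D}
    (hu : ∀ t ∈ T, u t ∈ Ring.jacobson R • (⊤ : Submodule R D)) :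
    idealSpan (socIdeal L) T (x + u) = idealSpan (socIdeal L) T x :=
  idealSpan_congr fun a ha t ht => by rw [Pi.add_apply, smul_add, ha.1 _ (hu t ht), add_zero]

theorem idealSpan_socIdeal_eq_bot (L : Submodule R D) (T : Set ι) {x : ι → D}
    (hx : ∀ t ∈ T, x t ∈ Ring.jacobson R • (⊤ : Submodule R D)) :
    idealSpan (socIdeal L) T x = ⊥ :=
  le_bot_iff.1 (idealSpan_le fun a ha t ht => by rw [ha.1 _ (hx t ht)]; exact zero_mem _)

variable [Finite D] [IsSemiprimaryRing R]

/-- For a generating tuple `x`, the products of the ring elements in `socIdeal N` with the entries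
of `x` generate the minimal submodule `N`. -/
theorem idealSpan_socIdeal_isAtom (hM : IsDistributiveModule R D) {l : ℕ}
    (hl : ∀ a ∈ Ring.jacobson R ^ l, ∀ m : D, a • m = 0) {N : Submodule R D} (hN : IsAtom N)
    {T : Set ι} {x : ι → D} (hx : ∀ X : Submodule R D, IsCoatom X → ∃ t ∈ T, x t ∉ X) :
    idealSpan (socIdeal N) T x = N := by
  refine (hN.le_iff.1 (idealSpan_socIdeal_le N T x)).resolve_left fun h => ?_
  obtain ⟨a, ha1, ha2, m, ham⟩ := hM.exists_smul_mem_atom hl hN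
  let Z : Submodule R D :=
    { carrier := {m | ∀ a ∈ socIdeal N, a • m = 0}
      zero_mem' := fun a _ => smul_zero a
      add_mem' := fun hx hy a ha => by rw [smul_add, hx a ha, hy a ha, add_zero]
      smul_mem' := fun r m hm a ha => by
        rw [← mul_smul]
        refine hm _ ⟨fun y hy => ?_, fun y => ?_⟩
        · rw [mul_smul]; exact ha.1 _ (Submodule.smul_mem _ _ hy)
        · rw [mul_smul]; exact ha.2 _ }
  obtain hZ | ⟨X, hX, hZX⟩ := eq_top_or_exists_le_coatom Z
  · have h1 : m ∈ Z := by rw [hZ]; exact Submodule.mem_top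
    exact ham (h1 a ⟨ha1, ha2⟩)
  · obtain ⟨t, ht, htX⟩ := hx X hX
    refine htX (hZX fun a ha => ?_)
    have h1 := smul_mem_idealSpan x ha ht
    rwa [h, Submodule.mem_bot] at h1

theorem idealSpan_socIdeal_killedBy (hM : IsDistributiveModule R D) {l : ℕ}
    (hl : ∀ a ∈ Ring.jacobson R ^ l, ∀ m : D, a • m = 0)
    {T : Set ι} {x : ι → D} (hx : ∀ X : Submodule R D, IsCoatom X → ∃ t ∈ T, x t ∉ X) :
    idealSpan (socIdeal (killedBy D (Ring.jacobson R))) T x = killedBy D (Ring.jacobson R) := by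
  refine le_antisymm (idealSpan_socIdeal_le _ T x) fun m hm => ?_
  by_contra h0
  obtain ⟨N, hN, hN'⟩ := exists_isAtom_not_le hm h0
  refine hN' ?_
  conv_lhs => rw [← idealSpan_socIdeal_isAtom hM hl hN hx]
  exact idealSpan_mono (socIdeal_mono (isAtom_le_killedBy hN)) T x

/-- An entry outside of `J D` is not annihilated by all the ring elements that annihilate `J D` and
map `D` into the submodule annihilated by `J`. -/
theorem exists_isAtom_le_idealSpan (hM : IsDistributiveModule R D) {l : ℕ}
    (hl : ∀ a ∈ Ring.jacobson R ^ l, ∀ m : D, a • m = 0) {T : Set ι} {x : ι → D} {t : ι}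
    (ht : t ∈ T) (hx : x t ∉ Ring.jacobson R • (⊤ : Submodule R D)) :
    ∃ N : Submodule R D, IsAtom N ∧
      N ≤ idealSpan (socIdeal (killedBy D (Ring.jacobson R))) T x := by
  obtain ⟨X, hX, hxX⟩ := exists_isCoatom_notMem hx
  obtain ⟨a, ha1, ha2, ha3⟩ := hM.exists_smul_ne_zero hl hX hxX
  refine (eq_bot_or_exists_atom_le _).resolve_left fun h => ha3 ?_
  have h1 := smul_mem_idealSpan x
    (show a ∈ socIdeal (killedBy D (Ring.jacobson R)) from ⟨ha1, ha2⟩) ht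
  rwa [h, Submodule.mem_bot] at h1

end SocleIdeals

/-! ### The socle operator -/

section SocleOperator

variable {R : Type*} [Ring R] {K : Type*} [CommRing K]
  {D : Type*} [AddCommGroup D] [Module R D] [Finite D]

variable (R D) in
/-- The minimal submodules. -/
noncomputable def minimalSubmodules : List (Submodule R D) :=
  (Set.toFinite {N : Submodule R D | IsAtom N}).toFinset.toList

theorem mem_minimalSubmodules {N : Submodule R D} :
    N ∈ minimalSubmodules R D ↔ IsAtom N := by simp [minimalSubmodules]

variable (K) in
/-- The element of `K[D^ι]` by which the operator of `exists_socle_operator` acts; here `N` is the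
submodule annihilated by the radical, and `S` is the set of the first two coordinates. -/
noncomputable def socleElement {ι : Type*} [Fintype ι] (S : Set ι) (N : Submodule R D) :
    AddMonoidAlgebra K (ι → D) :=
  avg K (coordSub Sᶜ N) *
    ((minimalSubmodules R D).map fun L => 1 - avg K (coordSub S L)).prod

/-- If `J D / N` is uniformly generated by `k`-ary functions, where `N` is annihilated by `J`,
then there is an operator of arity `k + 2` that multiplies a generating tuple by `socleElement` if
all but its first two entries are in `J D`, and that maps it to zero otherwise. -/
theorem exists_socle_operator [Finite R] (hR : IsUnit (Nat.card R : K))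
    (hD : IsUnit (Nat.card D : K))
    (hM : IsDistributiveModule R D) {l : ℕ}
    (hl : ∀ a ∈ Ring.jacobson R ^ l, ∀ m : D, a • m = 0)
    (hN : killedBy D (Ring.jacobson R) ≤ Ring.jacobson R • (⊤ : Submodule R D)) {k : ℕ}
    (h : IsUniformlyGenerated R
      ((Ring.jacobson R • (⊤ : Submodule R D) : Submodule R D) ⧸
        (killedBy D (Ring.jacobson R)).comap (Ring.jacobson R • (⊤ : Submodule R D)).subtype) K k)
    (m : ℕ) :
    ∃ Φ ∈ facSpan R (Fin 2 ⊕ Fin m) D K (2 + k), ∀ x : Fin 2 ⊕ Fin m → D,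
      (∀ X : Submodule R D, IsCoatom X → ∃ s, x s ∉ X) →
      ((∀ s, x (.inr s) ∈ Ring.jacobson R • (⊤ : Submodule R D)) →
        Φ (pt K x) = pt K x * socleElement K (Set.range .inl) (killedBy D (Ring.jacobson R))) ∧
      ((∃ s, x (.inr s) ∉ Ring.jacobson R • (⊤ : Submodule R D)) → Φ (pt K x) = 0) := by
  classical
  obtain ⟨e, he, hez⟩ := exists_mem_facSpan_sub_mul_avg hD hN h (Fin m)
  obtain ⟨ê, hê, hêz⟩ := exists_block_extension (σ := Fin 2) he
  set P := Ring.jacobson R • (⊤ : Submodule R D) with hP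
  set N := killedBy D (Ring.jacobson R) with hNdef
  have hG : IsUnit (Nat.card (Fin 2 ⊕ Fin m → D) : K) := isUnit_card_pi hD
  set S : Set (Fin 2 ⊕ Fin m) := Set.range Sum.inl with hS
  have hSr : ∀ s, Sum.inr s ∉ S := fun s => by simp [hS]
  have hSl : ∀ s, Sum.inl s ∈ S := fun s => ⟨s, rfl⟩
  set U : AddSubgroup (Fin 2 ⊕ Fin m → D) := piSub _ N with hU
  have hcoordU : ∀ (S : Set (Fin 2 ⊕ Fin m)) (L : Submodule R D), L ≤ N → coordSub S L ≤ U :=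
    fun S L hL z hz s => hL (hz.1 s)
  -- The averaging operators over matrices with entries in `socIdeal L`.
  have hav : ∀ (L : Submodule R D) (_ : L ≤ N) (S T : Set (Fin 2 ⊕ Fin m)) x,
      ActsBy U (avOp K D (socIdeal L) S T) x (avg K (coordSub S (idealSpan (socIdeal L) T x))) := by
    intro L _ S T x u hu
    rw [avOp_pt hR hD, idealSpan_socIdeal_add L T fun t _ => hN (hu t)]
  let atomOp : Submodule R D → Module.End K (AddMonoidAlgebra K (Fin 2 ⊕ Fin m → D)) := fun L =>
    1 - avOp K D (socIdeal (L ⊓ N)) S S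
  let κ := ((minimalSubmodules R D).map atomOp).prod
  let lam := avOp K D (socIdeal N) Sᶜ S
  let w : (Fin 2 ⊕ Fin m → D) → AddMonoidAlgebra K (Fin 2 ⊕ Fin m → D) := fun x =>
    avg K (coordSub Sᶜ (idealSpan (socIdeal N) S x)) *
      ((minimalSubmodules R D).map
        fun L => 1 - avg K (coordSub S (idealSpan (socIdeal (L ⊓ N)) S x))).prod
  have hκl : ∀ x, ActsBy U (κ * lam) x (w x) := by
    intro x
    refine ActsBy.mul (ActsBy.prod _ (fun L => (hav _ inf_le_right S S x).one_sub) fun L => ?_)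
      (hav N le_rfl Sᶜ S x) (avg_mem_ptSpan (hcoordU _ _ (idealSpan_socIdeal_le N S x)))
    exact sub_mem one_mem_ptSpan
      (avg_mem_ptSpan (hcoordU _ _ ((idealSpan_socIdeal_le _ S x).trans inf_le_right)))
  -- `w` only depends on the first two coordinates.
  have hwcongr : ∀ x y, (∀ s, x (.inl s) = y (.inl s)) → w x = w y := by
    intro x y hxy
    have h1 : ∀ L : Submodule R D, idealSpan (socIdeal L) S x = idealSpan (socIdeal L) S y := by
      intro L
      refine idealSpan_congr fun a _ t ht => ?_
      obtain ⟨s, rfl⟩ := ht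
      rw [hxy]
    simp only [w, h1]
  set i₁ := inlHom D (Fin 2) (Fin m) with hi₁
  set i₂ := inrHom D (Fin 2) (Fin m) with hi₂
  have hi : ∀ x : Fin 2 ⊕ Fin m → D,
      pt K x = act K i₁ (pt K fun s => x (.inl s)) * act K i₂ (pt K fun s => x (.inr s)) := by
    intro x
    rw [act_pt, act_pt, ← pt_add, hi₁, hi₂, inlHom_add_inrHom]
  have hκlz : ∀ (x : Fin 2 ⊕ Fin m → D) (t : AddMonoidAlgebra K (Fin 2 ⊕ Fin m → D)),
      t ∈ ptSpan K U → ∀ z, (κ * lam) (act K i₁ (pt K fun s => x (.inl s)) * act K i₂ z * t) =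
        act K i₁ (pt K fun s => x (.inl s)) * act K i₂ z * t * w x := by
    intro x t ht z
    have h1 : (κ * lam) ∘ₗ LinearMap.mulRight K t ∘ₗ
        LinearMap.mulLeft K (act K i₁ (pt K fun s => x (.inl s))) ∘ₗ (act K i₂).toLinearMap =
        LinearMap.mulRight K (w x) ∘ₗ LinearMap.mulRight K t ∘ₗ
        LinearMap.mulLeft K (act K i₁ (pt K fun s => x (.inl s))) ∘ₗ (act K i₂).toLinearMap := by
      refine ext_pt fun y => ?_
      simp only [LinearMap.comp_apply, LinearMap.mulRight_apply, LinearMap.mulLeft_apply,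
        AlgHom.toLinearMap_apply]
      have h2 := hi (Sum.elim (fun s => x (.inl s)) y)
      simp only [Sum.elim_inl, Sum.elim_inr] at h2
      rw [← h2, (hκl _).pt_mul ht, hwcongr x (Sum.elim (fun s => x (.inl s)) y) fun s => rfl]
    exact LinearMap.congr_fun h1 z
  -- The averages over blocks.
  have hi₁avg : ∀ L : Submodule R D, act K i₁ (avg K (piSub (Fin 2) L)) = avg K (coordSub S L) := by
    intro L
    rw [act_avg (isUnit_card_pi hD) hG]
    congr 1
    ext z
    constructor
    · rintro ⟨y, hy, rfl⟩
      refine ⟨fun s => ?_, fun s hs => ?_⟩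
      · cases s with
        | inl s => exact hy s
        | inr s => exact zero_mem _
      · cases s with
        | inl s => exact absurd (hSl s) hs
        | inr s => rfl
    · intro hz
      refine ⟨fun s => z (.inl s), fun s => hz.1 _, funext fun s => ?_⟩
      cases s with
      | inl s => rfl
      | inr s => exact (hz.2 _ (hSr s)).symm
  have hi₂avg : ∀ L : Submodule R D,
      act K i₂ (avg K (piSub (Fin m) L)) = avg K (coordSub Sᶜ L) := by
    intro L
    rw [act_avg (isUnit_card_pi hD) hG]
    congr 1
    ext z
    constructor
    · rintro ⟨y, hy, rfl⟩
      refine ⟨fun s => ?_, fun s hs => ?_⟩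
      · cases s with
        | inl s => exact zero_mem _
        | inr s => exact hy s
      · cases s with
        | inl s => rfl
        | inr s => exact absurd (hSr s) hs
    · intro hz
      refine ⟨fun s => z (.inr s), fun s => hz.1 _, funext fun s => ?_⟩
      cases s with
      | inl s => exact (hz.2 _ (not_not.2 (hSl s))).symm
      | inr s => rfl
  -- From the right: the average over the upper right blocks records by an average over `L²`, for
  -- some submodule `L` of `N`, whether `x` has further coordinates outside of `J D`; the operator
  -- `ê` is the identity modulo `N` on the further coordinates if they are in `J D`; and `lam`
  -- supplies the average over `N` in these coordinates, which makes `ê` exact, if the first two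
  -- entries generate `D`. The factors of `κ` detect if `L ≠ 0`.
  refine ⟨κ * lam * (ê * avOp K D (socIdeal N) S Sᶜ), ?_, fun x hx => ?_⟩
  · have hκ : κ ∈ facSpan R (Fin 2 ⊕ Fin m) D K (Fintype.card (Fin 2 ⊕ Fin m)) :=
      list_prod_mem_facSpan _ fun δ hδ => by
        obtain ⟨L, -, rfl⟩ := List.mem_map.1 hδ
        exact sub_mem (one_mem_facSpan_of_card_le le_rfl) (avOp_mem_facSpan _ _ _)
    have h1 := mul_facSpan_mem (mul_mem_facSpan hκ (avOp_mem_facSpan (socIdeal N) Sᶜ S))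
      (facSpan_mul_mem hê (avOp_mem_facSpan (socIdeal N) S Sᶜ))
    rwa [Fintype.card_fin] at h1
  -- The image of `x` under all the factors.
  have hΦ : (κ * lam * (ê * avOp K D (socIdeal N) S Sᶜ)) (pt K x) =
      act K i₁ (pt K fun s => x (.inl s)) * act K i₂ (e (pt K fun s => x (.inr s))) *
        avg K (coordSub S (idealSpan (socIdeal N) Sᶜ x)) * w x := by
    set L := idealSpan (socIdeal N) Sᶜ x with hL
    have h1 : pt K x * avg K (coordSub S L) =
        act K i₁ ((pt K fun s => x (.inl s)) * avg K (piSub (Fin 2) L)) *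
          act K i₂ (pt K fun s => x (.inr s)) := by
      rw [map_mul, hi₁avg, mul_right_comm, ← hi x]
    have h2 : avg K (coordSub S L) ∈ ptSpan K U :=
      avg_mem_ptSpan (hcoordU _ _ (idealSpan_socIdeal_le N _ x))
    rw [Module.End.mul_apply (κ * lam), Module.End.mul_apply ê, avOp_pt hR hD, ← hL, h1, hêz,
      map_mul (act K i₁), hi₁avg, mul_right_comm, hκlz x _ h2]
  rw [hΦ]
  constructor
  · intro hxP
    have hxS : ∀ X : Submodule R D, IsCoatom X → ∃ t ∈ S, x t ∉ X := by
      intro X hX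
      obtain ⟨s, hs⟩ := hx X hX
      cases s with
      | inl s => exact ⟨_, hSl s, hs⟩
      | inr s => exact absurd (smul_top_le_of_isCoatom hX (hxP s)) hs
    have h1 : idealSpan (socIdeal N) Sᶜ x = ⊥ := by
      refine idealSpan_socIdeal_eq_bot N _ fun t ht => ?_
      cases t with
      | inl s => exact absurd (hSl s) ht
      | inr s => exact hxP s
    have h2 : w x = socleElement K S N := by
      simp only [w, socleElement, idealSpan_socIdeal_killedBy hM hl hxS, hNdef]
      congr 2
      refine List.map_congr_left fun L hL => ?_
      have hL' := mem_minimalSubmodules.1 hL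
      rw [inf_eq_left.2 (isAtom_le_killedBy hL'), idealSpan_socIdeal_isAtom hM hl hL' hxS]
    have h3 := congrArg (act K i₂) (hez (fun s => x (.inr s)) hxP)
    rw [map_mul, map_sub, map_zero, hi₂avg, sub_mul, sub_eq_zero] at h3
    rw [h1, coordSub_bot, avg_bot, mul_one, h2, hi x, socleElement, mul_assoc, mul_assoc,
      ← mul_assoc (act K i₂ _), ← mul_assoc (act K i₂ _), h3]
  · rintro ⟨s, hs⟩
    obtain ⟨L, hL, hLx⟩ := exists_isAtom_le_idealSpan hM hl (T := Sᶜ) (hSr s) hs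
    -- The factor of `w x` for `L` is killed by the average over a larger subgroup.
    have h1 : avg K (coordSub S (idealSpan (socIdeal N) Sᶜ x)) *
        (1 - avg K (coordSub S (idealSpan (socIdeal (L ⊓ N)) S x))) = 0 := by
      rw [mul_sub, mul_one, mul_comm, avg_mul_avg_of_le hG, sub_self]
      exact coordSub_mono S ((idealSpan_socIdeal_le _ S x).trans (inf_le_left.trans hLx))
    obtain ⟨v, hv⟩ : (1 - avg K (coordSub S (idealSpan (socIdeal (L ⊓ N)) S x))) ∣ w x :=
      (List.dvd_prod (List.mem_map_of_mem (mem_minimalSubmodules.2 hL))).mul_left _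
    rw [hv, mul_assoc, ← mul_assoc (avg K _), h1, zero_mul, mul_zero]

end SocleOperator

/-! ### Simultaneous elimination for a tuple and a character -/

section Elimination

variable {R : Type*} [Ring R] {ι : Type*} [Fintype ι] [DecidableEq ι]
  {D : Type*} [AddCommGroup D] [Module R D]

/-- The elementary matrix `1 + r E i j`, for `i ≠ j`, as a unit. -/
def elemUnit (i j : ι) (h : i ≠ j) (r : R) : (Matrix ι ι R)ˣ where
  val := 1 + Matrix.single i j r
  inv := 1 + Matrix.single i j (-r)
  val_inv := by
    rw [add_mul, one_mul, mul_add, mul_one, Matrix.single_mul_single_of_ne _ _ _ _ h.symm,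
      add_zero, add_assoc, ← Matrix.single_add, neg_add_cancel, Matrix.single_zero, add_zero]
  inv_val := by
    rw [add_mul, one_mul, mul_add, mul_one, Matrix.single_mul_single_of_ne _ _ _ _ h.symm,
      add_zero, add_assoc, ← Matrix.single_add, add_neg_cancel, Matrix.single_zero, add_zero]

theorem matHom_elemUnit (i j : ι) (h : i ≠ j) (r : R) (x : ι → D) :
    matHom D (elemUnit i j h r : Matrix ι ι R) x = x + Pi.single i (r • x j) := by
  change matHom D (1 + Matrix.single i j r) x = _
  rw [matHom_add_apply, matHom_one, AddMonoidHom.id_apply]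
  congr 1
  funext s
  rw [matHom_apply]
  by_cases hs : s = i
  · subst hs
    rw [Pi.single_eq_same, Finset.sum_eq_single j]
    · rw [Matrix.single_apply_same]
    · intro t _ ht
      rw [Matrix.single_apply_of_ne _ _ _ _ _ (fun h => ht h.2.symm), zero_smul]
    · intro h; exact absurd (Finset.mem_univ j) h
  · rw [Pi.single_eq_of_ne hs]
    refine Finset.sum_eq_zero fun t _ => ?_
    rw [Matrix.single_apply_of_ne _ _ _ _ _ (fun h => hs h.1.symm), zero_smul]

theorem inv_elemUnit (i j : ι) (h : i ≠ j) (r : R) :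
    (elemUnit i j h r)⁻¹ = elemUnit i j h (-r) := Units.ext rfl

theorem matHom_units_mul (g h : (Matrix ι ι R)ˣ) (x : ι → D) :
    matHom D ((g * h : (Matrix ι ι R)ˣ) : Matrix ι ι R) x =
      matHom D g.val (matHom D h.val x) := by
  rw [Units.val_mul, matHom_mul_apply]

variable [Finite D] [IsSemiprimaryRing R]

/-- Row operations move all but one of the entries of a tuple into `J D`. -/
theorem exists_units_matHom_mem (hM : IsDistributiveModule R D) (i₀ : ι) (T : Finset ι)
    (hT : i₀ ∉ T) (x : ι → D) : ∃ g : (Matrix ι ι R)ˣ, ∀ s ∈ T,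
      matHom D g.val x s ∈ Ring.jacobson R • (⊤ : Submodule R D) := by
  induction T using Finset.induction_on with
  | empty => exact ⟨1, by simp⟩
  | insert s T hs ih =>
    rw [Finset.mem_insert, not_or] at hT
    obtain ⟨g, hg⟩ := ih hT.2
    obtain ⟨r, t, hrt⟩ := hM.exists_add_smul_generates
      (matHom D g.val x i₀) (matHom D g.val x s)
    refine ⟨elemUnit s i₀ (Ne.symm hT.1) (-t) * elemUnit i₀ s hT.1 r * g, fun s' hs' => ?_⟩
    rw [matHom_units_mul, matHom_units_mul, matHom_elemUnit, matHom_elemUnit]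
    rcases Finset.mem_insert.1 hs' with rfl | hs'
    · rw [Pi.add_apply, Pi.add_apply, Pi.single_eq_of_ne (Ne.symm hT.1), add_zero,
        Pi.single_eq_same, Pi.add_apply, Pi.single_eq_same, neg_smul, ← sub_eq_add_neg]
      exact hrt
    · rw [Pi.add_apply, Pi.add_apply, Pi.single_eq_of_ne (ne_of_mem_of_not_mem hs' hs),
        Pi.single_eq_of_ne (ne_of_mem_of_not_mem hs' hT.2), add_zero, add_zero]
      exact hg s' hs'

/-- Column operations that do not involve `i₀` make a character trivial on the tuples with entries
annihilated by the radical and support in `T`. -/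
theorem exists_units_addChar_eq_one (hM : IsDistributiveModule R D) {i₀ i₁ : ι} (hi : i₁ ≠ i₀)
    (T : Finset ι) (hT₀ : i₀ ∉ T) (hT₁ : i₁ ∉ T) {x : ι → D}
    (hx : ∀ s ≠ i₀, x s ∈ Ring.jacobson R • (⊤ : Submodule R D)) (χ : AddChar (ι → D) ℂ) :
    ∃ g : (Matrix ι ι R)ˣ,
      (∀ s ≠ i₀, matHom D g.val x s ∈ Ring.jacobson R • (⊤ : Submodule R D)) ∧
      ∀ s ∈ T, ∀ n ∈ killedBy D (Ring.jacobson R),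
        χ (matHom D g⁻¹.val (Pi.single s n)) = 1 := by
  induction T using Finset.induction_on with
  | empty =>
    refine ⟨1, fun s hs => ?_, by simp⟩
    rw [Units.val_one, matHom_one]
    exact hx s hs
  | insert s T hs ih =>
    rw [Finset.mem_insert, not_or] at hT₀ hT₁
    obtain ⟨g, hg, hgχ⟩ := ih hT₀.2 hT₁.2
    set N := killedBy D (Ring.jacobson R)
    let χ' : AddChar (ι → D) ℂ :=
      χ.compAddMonoidHom (matHom D g⁻¹.val)
    have hχ' : ∀ y, χ (matHom D g⁻¹.val y) = χ' y := fun y => rfl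
    let ρ : ι → AddChar N ℂ := fun s =>
      χ'.compAddMonoidHom ((AddMonoidHom.single (fun _ : ι => D) s).comp N.subtype.toAddMonoidHom)
    have hρ : ∀ s (n : N), ρ s n = χ' (Pi.single s (n : D)) := fun s n => rfl
    obtain ⟨r, t, hrt⟩ := (hM.submodule N).exists_addChar_generates
      (fun a ha n => Subtype.ext (n.2 a ha)) (ρ i₁) (ρ s)
    have hpres : ∀ (i j : ι) (hij : i ≠ j) (_ : j ≠ i₀) (a : R) (y : ι → D),
        (∀ s ≠ i₀, y s ∈ Ring.jacobson R • (⊤ : Submodule R D)) →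
        ∀ s ≠ i₀, matHom D (elemUnit i j hij a : Matrix ι ι R) y s ∈
          Ring.jacobson R • (⊤ : Submodule R D) := by
      intro i j hij hj a y hy s hs
      rw [matHom_elemUnit, Pi.add_apply]
      refine add_mem (hy s hs) ?_
      by_cases h : s = i
      · subst h; rw [Pi.single_eq_same]; exact Submodule.smul_mem _ _ (hy j hj)
      · rw [Pi.single_eq_of_ne h]; exact zero_mem _
    have hi₁s : i₁ ≠ s := hT₁.1
    refine ⟨(elemUnit s i₁ hi₁s.symm r * elemUnit i₁ s hi₁s (-t))⁻¹ * g, ?_, ?_⟩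
    · rw [mul_inv_rev, inv_elemUnit, inv_elemUnit]
      intro s' hs'
      rw [matHom_units_mul, matHom_units_mul]
      exact hpres _ _ _ (Ne.symm hT₀.1) _ _ (hpres _ _ _ hi _ _ hg) s' hs'
    · intro s' hs' n hn
      rw [mul_inv_rev, inv_inv, matHom_units_mul, hχ', matHom_units_mul, matHom_elemUnit,
        matHom_elemUnit]
      rcases Finset.mem_insert.1 hs' with rfl | hs'
      · have h1 := hrt ⟨n, hn⟩
        rw [hρ, hρ, hρ] at h1
        rw [Pi.single_eq_same, Pi.add_apply, Pi.single_eq_of_ne hi₁s, zero_add,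
          Pi.single_eq_same, neg_smul, smul_neg, Pi.single_neg, Pi.single_neg,
          AddChar.map_add_eq_mul, AddChar.map_add_eq_mul, AddChar.map_neg_eq_inv,
          AddChar.map_neg_eq_inv, h1]
        change χ' (Pi.single i₁ (t • n)) * χ' (Pi.single s' (r • t • n)) *
          (χ' (Pi.single i₁ (t • n)))⁻¹ * (χ' (Pi.single s' (r • t • n)))⁻¹ = 1
        have h2 := (χ'.val_isUnit (Pi.single i₁ (t • n))).ne_zero
        have h3 := (χ'.val_isUnit (Pi.single s' (r • t • n))).ne_zero
        field_simp
      · have h1 : s ≠ s' := (ne_of_mem_of_not_mem hs' hs).symm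
        have h2 : i₁ ≠ s' := (ne_of_mem_of_not_mem hs' hT₁.2).symm
        rw [Pi.single_eq_of_ne h1, smul_zero, Pi.single_zero, add_zero, Pi.single_eq_of_ne h2,
          smul_zero, Pi.single_zero, add_zero]
        exact hgχ s' hs' n hn

/-- The coordinates of a tuple `x` and of a character `χ` can be brought simultaneously into a
form where all but the first coordinate of `x` are in `J D` and only the first two coordinates of
`χ` are nontrivial on the elements annihilated by `J`. -/
theorem exists_units_normal_form (hM : IsDistributiveModule R D) {m : ℕ}
    (x : Fin 2 ⊕ Fin m → D) (χ : AddChar (Fin 2 ⊕ Fin m → D) ℂ) :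
    ∃ g : (Matrix (Fin 2 ⊕ Fin m) (Fin 2 ⊕ Fin m) R)ˣ,
      (∀ s, matHom D g.val x (.inr s) ∈ Ring.jacobson R • (⊤ : Submodule R D)) ∧
      ∀ u ∈ coordSub (Set.range Sum.inl)ᶜ (killedBy D (Ring.jacobson R)),
        χ (matHom D g⁻¹.val u) = 1 := by
  obtain ⟨g, hg⟩ := exists_units_matHom_mem hM (.inl 0) (Finset.univ.erase (.inl 0)) (by simp) x
  obtain ⟨h, hh, hhχ⟩ := exists_units_addChar_eq_one hM (i₀ := Sum.inl (0 : Fin 2))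
    (i₁ := Sum.inl (1 : Fin 2)) (by simp) (Finset.univ.image Sum.inr) (by simp) (by simp)
    (fun s hs => hg s (Finset.mem_erase.2 ⟨hs, Finset.mem_univ _⟩))
    (χ.compAddMonoidHom (matHom D g⁻¹.val))
  refine ⟨h * g, fun s => ?_, fun u hu => ?_⟩
  · rw [matHom_units_mul]; exact hh _ (by simp)
  · set ψ := (χ.compAddMonoidHom (matHom D g⁻¹.val)).compAddMonoidHom (matHom D h⁻¹.val)
    have h1 : ∀ T : Finset (Fin 2 ⊕ Fin m), ψ (∑ s ∈ T, Pi.single s (u s)) = 1 := by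
      intro T
      induction T using Finset.induction_on with
      | empty => rw [Finset.sum_empty, AddChar.map_zero_eq_one]
      | insert s T hs ih =>
        rw [Finset.sum_insert hs, AddChar.map_add_eq_mul, ih, mul_one]
        cases s with
        | inl s => rw [hu.2 (.inl s) (not_not.2 ⟨s, rfl⟩), Pi.single_zero, AddChar.map_zero_eq_one]
        | inr s => exact hhχ _ (by simp) _ (hu.1 _)
    rw [mul_inv_rev, matHom_units_mul]
    have h2 := h1 Finset.univ
    rwa [Finset.univ_sum_single] at h2

end Elimination

/-! ### The product over the conjugates of the socle operator -/

section SocleIdentity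

variable {R : Type*} [Ring R] [Finite R] {K : Type*} [CommRing K]
  {D : Type*} [AddCommGroup D] [Module R D] [Finite D]

theorem isIdempotentElem_avg {G : Type*} [AddCommGroup G] [Finite G]
    (hG : IsUnit (Nat.card G : K)) (H : AddSubgroup G) : IsIdempotentElem (avg K H) :=
  avg_mul_self hG H

theorem isIdempotentElem_list_prod {A : Type*} [CommRing A] (L : List A)
    (h : ∀ a ∈ L, IsIdempotentElem a) : IsIdempotentElem L.prod := by
  induction L with
  | nil => exact IsIdempotentElem.one
  | cons a L ih =>
    rw [List.prod_cons]
    exact (h a (by simp)).mul (ih fun b hb => h b (by simp [hb]))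

theorem list_prod_mul_eq_self {A : Type*} [CommRing A] (L : List A) {t : A}
    (h : ∀ a ∈ L, a * t = t) : L.prod * t = t := by
  induction L with
  | nil => rw [List.prod_nil, one_mul]
  | cons a L ih =>
    rw [List.prod_cons, mul_assoc, ih fun b hb => h b (by simp [hb]), h a (by simp)]

open Classical in
variable (K) in
/-- The element by which the conjugate of the operator of `exists_socle_operator` by the
invertible matrix `g` acts on the tuple `x`. -/
noncomputable def conjSocleElement {m : ℕ} (x : Fin 2 ⊕ Fin m → D)
    (g : (Matrix (Fin 2 ⊕ Fin m) (Fin 2 ⊕ Fin m) R)ˣ) :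
    AddMonoidAlgebra K (Fin 2 ⊕ Fin m → D) :=
  if ∀ s, matHom D g.val x (.inr s) ∈ Ring.jacobson R • (⊤ : Submodule R D) then
    act K (matHom D g⁻¹.val)
      (socleElement K (Set.range .inl) (killedBy D (Ring.jacobson R)))
  else 0

/-- The element given by all the factors is zero: otherwise, it survives averaging over the kernel
of some character `χ`, and for the matrix `g` that brings the tuple and `χ` into normal form the
factor `1 - conjSocleElement` vanishes after averaging. -/
theorem prod_one_sub_conjSocleElement_eq_zero (hD : IsUnit (Nat.card D : K))
    (hM : IsDistributiveModule R D) {m : ℕ} (x : Fin 2 ⊕ Fin m → D)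
    (L : List (Matrix (Fin 2 ⊕ Fin m) (Fin 2 ⊕ Fin m) R)ˣ) (hL : ∀ g, g ∈ L) :
    ((minimalSubmodules R D).map fun N => 1 - avg K (piSub (Fin 2 ⊕ Fin m) N)).prod *
      (L.map fun g => 1 - conjSocleElement K x g).prod = 0 := by
  have hG : IsUnit (Nat.card (Fin 2 ⊕ Fin m → D) : K) := isUnit_card_pi hD
  by_contra ht
  set t := ((minimalSubmodules R D).map fun N => 1 - avg K (piSub (Fin 2 ⊕ Fin m) N)).prod *
      (L.map fun g => 1 - conjSocleElement K x g).prod with htdef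
  obtain ⟨χ, H, hχ, hH, hmax⟩ := exists_addChar_avg_ker_mul_ne_zero hG ht
  obtain ⟨g, hgx, hgχ⟩ := exists_units_normal_form (R := R) hM x χ
  set S : Set (Fin 2 ⊕ Fin m) := Set.range Sum.inl with hS
  set N := killedBy D (Ring.jacobson R) with hN
  set φ := matHom D g⁻¹.val with hφ
  have hφg : ∀ z, φ (matHom D g.val z) = z := by
    intro z
    rw [hφ, ← matHom_units_mul, inv_mul_cancel, Units.val_one, matHom_one, AddMonoidHom.id_apply]
  have h1 : (coordSub Sᶜ N).map φ ≤ H := by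
    rintro _ ⟨u, hu, rfl⟩
    exact (hχ _).2 (hgχ u hu)
  have h2 : ∀ A ∈ minimalSubmodules R D, ¬ (coordSub S A).map φ ≤ H := by
    intro A hA hle
    have hA' := mem_minimalSubmodules.1 hA
    have h3 : piSub (Fin 2 ⊕ Fin m) A ≤ H := by
      intro z hz
      rw [← hφg z]
      set y := matHom D g.val z with hy
      have hyA : ∀ s, y s ∈ A := matHom_mem_pi A _ hz
      rw [← inlHom_add_inrHom y, map_add]
      refine add_mem (hle ⟨_, ⟨fun s => ?_, fun s hs => ?_⟩, rfl⟩)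
        (h1 ⟨_, ⟨fun s => ?_, fun s hs => ?_⟩, rfl⟩)
      · cases s with
        | inl s => exact hyA _
        | inr s => exact zero_mem _
      · cases s with
        | inl s => exact absurd ⟨s, rfl⟩ hs
        | inr s => rfl
      · cases s with
        | inl s => exact zero_mem _
        | inr s => exact isAtom_le_killedBy hA' (hyA _)
      · cases s with
        | inl s => rfl
        | inr s => exact absurd (by simp [hS]) hs
    obtain ⟨v, hv⟩ : (1 - avg K (piSub (Fin 2 ⊕ Fin m) A)) ∣ t :=
      (List.dvd_prod (List.mem_map_of_mem hA)).mul_right _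
    apply hH
    rw [hv, ← mul_assoc, mul_sub, mul_one, mul_comm (avg K H), avg_mul_avg_of_le hG h3, sub_self,
      zero_mul]
  have hw : conjSocleElement K x g = avg K ((coordSub Sᶜ N).map φ) *
      ((minimalSubmodules R D).map fun A => 1 - avg K ((coordSub S A).map φ)).prod := by
    rw [conjSocleElement, if_pos hgx, socleElement, map_mul, act_avg hG hG, map_list_prod,
      List.map_map]
    congr 3
    funext A
    rw [Function.comp_apply, map_sub, map_one, act_avg hG hG]
  have hwidem : IsIdempotentElem (conjSocleElement K x g) := by
    rw [hw]
    refine (isIdempotentElem_avg hG _).mul (isIdempotentElem_list_prod _ fun a ha => ?_)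
    obtain ⟨A, -, rfl⟩ := List.mem_map.1 ha
    exact (isIdempotentElem_avg hG _).one_sub
  have h3 : conjSocleElement K x g * (avg K H * t) = avg K H * t := by
    rw [hw, mul_assoc, list_prod_mul_eq_self, ← mul_assoc, avg_mul_avg_of_le hG h1]
    intro a ha
    obtain ⟨A, hA, rfl⟩ := List.mem_map.1 ha
    have h4 : H < (coordSub S A).map φ ⊔ H :=
      lt_of_le_of_ne le_sup_right fun h => h2 A hA (by rw [h]; exact le_sup_left)
    rw [sub_mul, one_mul, ← mul_assoc (avg K _) (avg K H) t, avg_mul_avg hG, hmax _ h4, sub_zero]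
  obtain ⟨v, hv⟩ : (1 - conjSocleElement K x g) ∣ t :=
    (List.dvd_prod (List.mem_map_of_mem (hL g))).mul_left _
  apply hH
  rw [← h3, hv, mul_left_comm (avg K H), ← mul_assoc, hwidem.mul_one_sub_self, zero_mul]

end SocleIdentity

/-! ### The inductive step -/

section Induction

variable {R : Type*} [Ring R] {K : Type*} [CommRing K] {D : Type*} [AddCommGroup D] [Module R D]

theorem act_mem_ptSpan {G G' : Type*} [AddCommGroup G] [AddCommGroup G'] {U : AddSubgroup G}
    {U' : AddSubgroup G'} {f : G →+ G'} (hf : ∀ u ∈ U, f u ∈ U') {z : AddMonoidAlgebra K G}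
    (hz : z ∈ ptSpan K U) : act K f z ∈ ptSpan K U' := by
  induction hz using Submodule.span_induction with
  | mem _ h =>
    obtain ⟨x, hx, rfl⟩ := h
    rw [act_pt]
    exact pt_mem_ptSpan (hf x hx)
  | zero => rw [map_zero]; exact zero_mem _
  | add a b _ _ ha hb => rw [map_add]; exact add_mem ha hb
  | smul c a _ ha => rw [map_smul]; exact Submodule.smul_mem _ _ ha

theorem ptSpan_mono {G : Type*} [AddCommGroup G] {U U' : AddSubgroup G} (h : U ≤ U') :
    ptSpan K U ≤ ptSpan K U' := Submodule.span_mono (Set.image_mono h)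

/-- If the factors of a product preserve `W` and one of them maps into `W`, then so does the
product. -/
theorem list_prod_apply_mem {V : Type*} [AddCommGroup V] [Module K V] {W : Submodule K V}
    {L : List (Module.End K V)} (hW : ∀ δ ∈ L, ∀ z ∈ W, δ z ∈ W) {δ : Module.End K V} (hδ : δ ∈ L)
    (h : ∀ z, δ z ∈ W) (z : V) : L.prod z ∈ W := by
  induction L with
  | nil => simp at hδ
  | cons a L ih =>
    rw [List.prod_cons, Module.End.mul_apply]
    rcases List.mem_cons.1 hδ with rfl | hδ
    · exact h _
    · exact hW a (by simp) _ (ih (fun b hb => hW b (by simp [hb])) hδ)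

theorem piSub_le {ι : Type*} {L X : Submodule R D} (h : L ≤ X) : piSub ι L ≤ piSub ι X :=
  fun _ hx i => h (hx i)

theorem isUnit_card_section (hD : IsUnit (Nat.card D : K)) (X N : Submodule R D) :
    IsUnit (Nat.card (X ⧸ N.comap X.subtype) : K) := by
  refine isUnit_of_dvd_unit (Nat.cast_dvd_cast ?_) (isUnit_card_submodule hD X)
  rw [Submodule.card_eq_card_quotient_mul_card (N.comap X.subtype)]
  exact dvd_mul_left _ _

variable [Finite D]

/-- A section `X / N` other than `D / 0` has fewer elements than `D`. -/
theorem natCard_section_lt {X N : Submodule R D} (hNX : N ≤ X) (h : X ≠ ⊤ ∨ N ≠ ⊥) :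
    Nat.card (X ⧸ N.comap X.subtype) < Nat.card D := by
  have h1 := Submodule.card_eq_card_quotient_mul_card (N.comap X.subtype)
  have h2 : Nat.card X ≤ Nat.card D := Nat.card_le_card_of_injective _ X.injective_subtype
  have := Finite.of_surjective _ (N.comap X.subtype).mkQ_surjective
  have h3 : 0 < Nat.card (X ⧸ N.comap X.subtype) := Nat.card_pos
  rcases h with h | h
  · refine lt_of_le_of_lt (Nat.card_le_card_of_surjective _ (N.comap X.subtype).mkQ_surjective)
      (lt_of_le_of_ne h2 fun h4 => h ?_)
    exact Submodule.toAddSubgroup_injective (AddSubgroup.eq_top_of_card_eq X.toAddSubgroup h4)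
  · have h5 : 1 < Nat.card (N.comap X.subtype) := by
      rw [Finite.one_lt_card_iff_nontrivial, Submodule.nontrivial_iff_ne_bot]
      refine fun h6 => h (le_bot_iff.1 fun x hx => ?_)
      have h7 : (⟨x, hNX hx⟩ : X) ∈ N.comap X.subtype := hx
      rw [h6, Submodule.mem_bot] at h7
      exact congrArg Subtype.val h7
    nlinarith

theorem socleElement_mem_ptSpan {ι : Type*} [Fintype ι] (S : Set ι) :
    socleElement K S (killedBy D (Ring.jacobson R)) ∈
      ptSpan K (piSub ι (killedBy D (Ring.jacobson R))) :=
  mul_mem_ptSpan (avg_mem_ptSpan fun _ hx => hx.1) <| prod_mem_ptSpan _ fun _ hL =>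
    sub_mem one_mem_ptSpan <| avg_mem_ptSpan fun _ hx i =>
      isAtom_le_killedBy (mem_minimalSubmodules.1 hL) (hx.1 i)

/-- The elements of the group algebra killed by the average over the tuples in a submodule are
preserved by matrices. -/
theorem act_mul_avg_piSub_eq_zero {ι : Type*} [Fintype ι] (hD : IsUnit (Nat.card D : K))
    (L : Submodule R D) (M : Matrix ι ι R) {z : AddMonoidAlgebra K (ι → D)}
    (hz : z * avg K (piSub ι L) = 0) : act K (matHom D M) z * avg K (piSub ι L) = 0 := by
  have hG : IsUnit (Nat.card (ι → D) : K) := isUnit_card_pi hD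
  have h1 : (piSub ι L).map (matHom D M) ≤ piSub ι L := by
    rintro _ ⟨x, hx, rfl⟩
    exact matHom_mem_pi L M hx
  rw [← avg_mul_avg_of_le hG h1, ← mul_assoc, ← act_avg hG hG, ← map_mul, hz, map_zero, zero_mul]

/-- The conjugates of the operator of `exists_socle_operator` by invertible matrices act on the
cosets of the tuples annihilated by the radical. -/
theorem actsBy_conj {m : ℕ}
    (hN : killedBy D (Ring.jacobson R) ≤ Ring.jacobson R • (⊤ : Submodule R D))
    {Φ : Module.End K (AddMonoidAlgebra K (Fin 2 ⊕ Fin m → D))}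
    (hΦ : ∀ x : Fin 2 ⊕ Fin m → D, (∀ X : Submodule R D, IsCoatom X → ∃ s, x s ∉ X) →
      ((∀ s, x (.inr s) ∈ Ring.jacobson R • (⊤ : Submodule R D)) →
        Φ (pt K x) = pt K x * socleElement K (Set.range .inl) (killedBy D (Ring.jacobson R))) ∧
      ((∃ s, x (.inr s) ∉ Ring.jacobson R • (⊤ : Submodule R D)) → Φ (pt K x) = 0))
    {x : Fin 2 ⊕ Fin m → D} (hx : ∀ X : Submodule R D, IsCoatom X → ∃ s, x s ∉ X)
    (g : (Matrix (Fin 2 ⊕ Fin m) (Fin 2 ⊕ Fin m) R)ˣ) :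
    ActsBy (piSub (Fin 2 ⊕ Fin m) (killedBy D (Ring.jacobson R)))
      ((act K (matHom D g⁻¹.val)).toLinearMap * Φ * (act K (matHom D g.val)).toLinearMap) x
      (conjSocleElement K x g) := by
  intro u hu
  have hinv : ∀ z, matHom D g⁻¹.val (matHom D g.val z) = z := by
    intro z
    rw [← matHom_units_mul, inv_mul_cancel, Units.val_one, matHom_one, AddMonoidHom.id_apply]
  have hgen : ∀ X : Submodule R D, IsCoatom X → ∃ s, matHom D g.val (x + u) s ∉ X := by
    intro X hX
    by_contra! h
    obtain ⟨s, hs⟩ := hx X hX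
    refine hs ?_
    have h1 := matHom_mem_pi X g⁻¹.val h s
    rw [hinv] at h1
    exact (Submodule.add_mem_iff_left X (smul_top_le_of_isCoatom hX (hN (hu s)))).1 h1
  have hmem : ∀ s, matHom D g.val (x + u) s ∈ Ring.jacobson R • (⊤ : Submodule R D) ↔
      matHom D g.val x s ∈ Ring.jacobson R • (⊤ : Submodule R D) := by
    intro s
    rw [map_add, Pi.add_apply]
    exact Submodule.add_mem_iff_left _ (hN (matHom_mem_pi _ g.val hu s))
  simp only [Module.End.mul_apply, AlgHom.toLinearMap_apply, act_pt, conjSocleElement]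
  split_ifs with h
  · rw [(hΦ _ hgen).1 fun s => (hmem _).2 (h s), map_mul, act_pt, hinv]
  · push Not at h
    obtain ⟨s, hs⟩ := h
    rw [(hΦ _ hgen).2 ⟨s, fun h => hs ((hmem _).1 h)⟩, map_zero, mul_zero]

theorem conjSocleElement_mem_ptSpan {m : ℕ} (x : Fin 2 ⊕ Fin m → D)
    (g : (Matrix (Fin 2 ⊕ Fin m) (Fin 2 ⊕ Fin m) R)ˣ) :
    conjSocleElement K x g ∈
      ptSpan K (piSub (Fin 2 ⊕ Fin m) (killedBy D (Ring.jacobson R))) := by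
  rw [conjSocleElement]
  split_ifs
  · exact act_mem_ptSpan (fun _ hu => mem_piSub.2 (matHom_mem_pi _ _ (mem_piSub.1 hu)))
      (socleElement_mem_ptSpan _)
  · exact zero_mem _

variable [Finite R]

/-- The inductive step in the case that the minimal submodules are contained in `J D`, which is
expressed by `hN`. -/
theorem one_mem_facSpan_of_sections (hR : IsUnit (Nat.card R : K)) (hD : IsUnit (Nat.card D : K))
    (hM : IsDistributiveModule R D) {l : ℕ}
    (hl : ∀ a ∈ Ring.jacobson R ^ l, ∀ m : D, a • m = 0)
    (hN : killedBy D (Ring.jacobson R) ≤ Ring.jacobson R • (⊤ : Submodule R D)) {k : ℕ}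
    (h : IsUniformlyGenerated R
      ((Ring.jacobson R • (⊤ : Submodule R D) : Submodule R D) ⧸
        (killedBy D (Ring.jacobson R)).comap (Ring.jacobson R • (⊤ : Submodule R D)).subtype) K k)
    (hX : ∀ X : Submodule R D, IsCoatom X →
      IsUniformlyGenerated R (X ⧸ (⊥ : Submodule R D).comap X.subtype) K (2 + k))
    (hL : ∀ L : Submodule R D, IsAtom L →
      IsUniformlyGenerated R ((⊤ : Submodule R D) ⧸ L.comap (⊤ : Submodule R D).subtype) K (2 + k))
    (m : ℕ) : 1 ∈ facSpan R (Fin 2 ⊕ Fin m) D K (2 + k) := by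
  classical
  obtain ⟨Φ, hΦmem, hΦ⟩ := exists_socle_operator hR hD hM hl hN h m
  set N := killedBy D (Ring.jacobson R) with hNdef
  have hG : IsUnit (Nat.card (Fin 2 ⊕ Fin m → D) : K) := isUnit_card_pi hD
  have := Fintype.ofFinite {X : Submodule R D // IsCoatom X}
  have := Fintype.ofFinite {L : Submodule R D // IsAtom L}
  have := Fintype.ofFinite (Matrix (Fin 2 ⊕ Fin m) (Fin 2 ⊕ Fin m) R)ˣ
  choose e he hex using fun X : {X : Submodule R D // IsCoatom X} =>
    exists_mem_facSpan_sub_mul_avg hD bot_le (hX X.1 X.2) (Fin 2 ⊕ Fin m)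
  choose e' he' hex' using fun L : {L : Submodule R D // IsAtom L} =>
    exists_mem_facSpan_sub_mul_avg hD le_top (hL L.1 L.2) (Fin 2 ⊕ Fin m)
  have hpib : piSub (Fin 2 ⊕ Fin m) (⊥ : Submodule R D) = ⊥ :=
    le_bot_iff.1 fun _ hx => funext hx
  simp only [hpib, avg_bot, mul_one] at hex
  let Ψ : (Matrix (Fin 2 ⊕ Fin m) (Fin 2 ⊕ Fin m) R)ˣ →
      Module.End K (AddMonoidAlgebra K (Fin 2 ⊕ Fin m → D)) := fun g =>
    (act K (matHom D g⁻¹.val)).toLinearMap * Φ * (act K (matHom D g.val)).toLinearMap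
  -- `δ₁` kills the nongenerating tuples, `δ₃` maps to the elements that the averages over the
  -- minimal submodules kill, and `δ₂` kills the generating tuples multiplied by such an element.
  set δ₁ := (Finset.univ.toList.map fun X => 1 - e X).prod with hδ₁
  set δ₂ := (Finset.univ.toList.map fun g => 1 - Ψ g).prod with hδ₂
  set δ₃ := (Finset.univ.toList.map fun L => 1 - e' L).prod with hδ₃
  have h₁ : 1 - δ₁ ∈ facSpan R (Fin 2 ⊕ Fin m) D K (2 + k) := by
    refine one_sub_prod_mem_facSpan _ fun δ hδ => ?_
    obtain ⟨X, -, rfl⟩ := List.mem_map.1 hδ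
    rw [sub_sub_cancel]; exact he X
  have h₂ : 1 - δ₂ ∈ facSpan R (Fin 2 ⊕ Fin m) D K (2 + k) := by
    refine one_sub_prod_mem_facSpan _ fun δ hδ => ?_
    obtain ⟨g, -, rfl⟩ := List.mem_map.1 hδ
    rw [sub_sub_cancel]; exact mul_act_mem_facSpan _ (act_mul_mem_facSpan _ hΦmem)
  have h₃ : 1 - δ₃ ∈ facSpan R (Fin 2 ⊕ Fin m) D K (2 + k) := by
    refine one_sub_prod_mem_facSpan _ fun δ hδ => ?_
    obtain ⟨L, -, rfl⟩ := List.mem_map.1 hδ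
    rw [sub_sub_cancel]; exact he' L
  set q := ((minimalSubmodules R D).map fun L => 1 - avg K (piSub (Fin 2 ⊕ Fin m) L)).prod with hq
  have hqU : q ∈ ptSpan K (piSub (Fin 2 ⊕ Fin m) N) := prod_mem_ptSpan _ fun L hL =>
    sub_mem one_mem_ptSpan <| avg_mem_ptSpan <|
      piSub_le (isAtom_le_killedBy (mem_minimalSubmodules.1 hL))
  have hδ₃q : ∀ z, δ₃ z * q = δ₃ z := by
    intro z
    rw [mul_comm]
    refine list_prod_mul_eq_self _ fun a ha => ?_
    obtain ⟨L, hL, rfl⟩ := List.mem_map.1 ha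
    let W : Submodule K (AddMonoidAlgebra K (Fin 2 ⊕ Fin m → D)) :=
      LinearMap.ker (LinearMap.mulRight K (avg K (piSub (Fin 2 ⊕ Fin m) L)))
    have hW : ∀ z, z ∈ W ↔ z * avg K (piSub (Fin 2 ⊕ Fin m) L) = 0 := fun z => Iff.rfl
    have hz : δ₃ z ∈ W := by
      refine list_prod_apply_mem (δ := 1 - e' ⟨L, mem_minimalSubmodules.1 hL⟩) ?_
        (List.mem_map.2 ⟨⟨L, mem_minimalSubmodules.1 hL⟩, by simp, rfl⟩) (fun z => ?_) z
      · intro δ hδ z hz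
        obtain ⟨L', -, rfl⟩ := List.mem_map.1 hδ
        exact sub_mem hz (facSpan_apply_mem
          (fun M z hz => act_mul_avg_piSub_eq_zero hD L M hz) (he' L') hz)
      · have h1 : LinearMap.mulRight K (avg K (piSub (Fin 2 ⊕ Fin m) L)) ∘ₗ
            (1 - e' ⟨L, mem_minimalSubmodules.1 hL⟩) = 0 := by
          refine ext_pt fun x => ?_
          have h2 := hex' ⟨L, mem_minimalSubmodules.1 hL⟩ x fun _ => trivial
          rw [LinearMap.comp_apply, LinearMap.mulRight_apply, LinearMap.sub_apply,
            Module.End.one_apply, ← neg_sub, neg_mul, h2, neg_zero, LinearMap.zero_apply]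
        exact LinearMap.congr_fun h1 z
    rw [sub_mul, one_mul, mul_comm (avg K _), (hW _).1 hz, sub_zero]
  have hker : ∀ x, δ₁ (δ₂ (pt K x * q)) = 0 := by
    intro x
    by_cases hx : ∀ X : Submodule R D, IsCoatom X → ∃ s, x s ∉ X
    · have h1 : ActsBy (piSub (Fin 2 ⊕ Fin m) N) δ₂ x
          (Finset.univ.toList.map fun g => 1 - conjSocleElement K x g).prod :=
        ActsBy.prod _ (fun g => (actsBy_conj hN hΦ hx g).one_sub) fun g =>
          sub_mem one_mem_ptSpan (conjSocleElement_mem_ptSpan x g)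
      rw [h1.pt_mul hqU, mul_assoc, prod_one_sub_conjSocleElement_eq_zero hD hM x _
        (fun g => by simp), mul_zero, map_zero]
    · push Not at hx
      obtain ⟨X, hX, hxX⟩ := hx
      have hinv : ∀ X : Submodule R D, ∀ e ∈ facSpan R (Fin 2 ⊕ Fin m) D K (2 + k),
          ∀ z ∈ ptSpan K (piSub (Fin 2 ⊕ Fin m) X), e z ∈ ptSpan K (piSub (Fin 2 ⊕ Fin m) X) :=
        fun X e he z hz => facSpan_apply_mem (fun M z hz =>
          act_mem_ptSpan (fun u hu => mem_piSub.2 (matHom_mem_pi X M (mem_piSub.1 hu))) hz) he hz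
      have hz : pt K x * q ∈ ptSpan K (piSub (Fin 2 ⊕ Fin m) X) :=
        mul_mem_ptSpan (pt_mem_ptSpan hxX)
          (ptSpan_mono (piSub_le (hN.trans (smul_top_le_of_isCoatom hX))) hqU)
      have hz' : δ₂ (pt K x * q) ∈ ptSpan K (piSub (Fin 2 ⊕ Fin m) X) := by
        have h1 := sub_mem hz (hinv X _ h₂ _ hz)
        rwa [LinearMap.sub_apply, Module.End.one_apply, sub_sub_cancel] at h1
      refine prod_map_apply_eq_zero (i := ⟨X, hX⟩) _ _
        (fun X : {X : Submodule R D // IsCoatom X} => ptSpan K (piSub (Fin 2 ⊕ Fin m) X.1))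
        (fun Y X z hz => sub_mem hz (hinv Y _ (he X) z hz)) (fun Y z hz => ?_)
        (by simp) hz'
      induction hz using Submodule.span_induction with
      | mem _ h =>
        obtain ⟨y, hy, rfl⟩ := h
        rw [LinearMap.sub_apply, Module.End.one_apply, ← neg_sub, hex Y y hy, neg_zero]
      | zero => rw [map_zero]
      | add a b _ _ ha hb => rw [map_add, ha, hb, add_zero]
      | smul c a _ ha => rw [map_smul, ha, smul_zero]
  have hzero : δ₁ * δ₂ * δ₃ = 0 := by
    refine LinearMap.ext fun z => ?_
    have h1 : δ₁ ∘ₗ δ₂ ∘ₗ LinearMap.mulRight K q = 0 := ext_pt hker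
    have h2 := LinearMap.congr_fun h1 (δ₃ z)
    rw [LinearMap.comp_apply, LinearMap.comp_apply, LinearMap.mulRight_apply, hδ₃q] at h2
    exact h2
  have h4 := one_sub_mul_mem_facSpan (one_sub_mul_mem_facSpan h₁ h₂) h₃
  rwa [hzero, sub_zero] at h4

end Induction

/-! ### Uniform generation of distributive modules -/

section DistributiveModules

variable {R : Type*} [Ring R] {K : Type*} [CommRing K] {D : Type*} [AddCommGroup D] [Module R D]

/-- If a minimal submodule is not contained in `J D`, then the module is simple or a direct sum of
two proper submodules. -/
theorem IsAtom.exists_isCompl [IsSemiprimaryRing R] {N : Submodule R D} (hN : IsAtom N)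
    (h : ¬ N ≤ Ring.jacobson R • (⊤ : Submodule R D)) :
    ∃ X : Submodule R D, IsCoatom X ∧ IsCompl N X := by
  obtain ⟨n, hn, hnP⟩ := SetLike.not_le_iff_exists.1 h
  obtain ⟨X, hX, hnX⟩ := exists_isCoatom_notMem hnP
  have hNX : ¬ N ≤ X := fun h => hnX (h hn)
  exact ⟨X, hX, hN.not_le_iff_disjoint.1 hNX, (hX.not_le_iff_codisjoint.1 hNX).symm⟩

theorem IsUniformlyGenerated.of_quotient_bot {X : Submodule R D} {k : ℕ}
    (h : IsUniformlyGenerated R (X ⧸ (⊥ : Submodule R D).comap X.subtype) K k) :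
    IsUniformlyGenerated R X K k := by
  have h1 : (⊥ : Submodule R D).comap X.subtype = ⊥ := by
    rw [Submodule.comap_bot, Submodule.ker_subtype]
  exact h.of_addEquiv (Submodule.quotEquivOfEqBot _ h1).toAddEquiv
    fun a => ⟨a, fun d => (Submodule.quotEquivOfEqBot _ h1).map_smul a d⟩

/-- A finite distributive module over a finite ring is uniformly generated by functions of arity
`l` if the `l`-th power of the Jacobson radical annihilates it. -/
theorem IsDistributiveModule.isUniformlyGenerated [Finite R] [Finite D]
    (hR : IsUnit (Nat.card R : K)) (hD : IsUnit (Nat.card D : K))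
    (hM : IsDistributiveModule R D) {l : ℕ}
    (hl : ∀ a ∈ Ring.jacobson R ^ l, ∀ m : D, a • m = 0) : IsUniformlyGenerated R D K l := by
  induction hn : Nat.card D using Nat.strong_induction_on generalizing D l with
  | _ n ih =>
    subst hn
    -- The induction hypothesis, for the proper sections of `D`.
    have hsec : ∀ (X N : Submodule R D), N ≤ X → (X ≠ ⊤ ∨ N ≠ ⊥) → ∀ k,
        (∀ a ∈ Ring.jacobson R ^ k, ∀ m ∈ X, a • m ∈ N) →
        IsUniformlyGenerated R (X ⧸ N.comap X.subtype) K k := by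
      intro X N hNX h k hk
      have := Finite.of_surjective _ (N.comap X.subtype).mkQ_surjective
      refine ih _ (natCard_section_lt hNX h) (isUnit_card_section hD X N)
        ((hM.submodule X).quotient _) (fun a ha m => ?_) rfl
      obtain ⟨m, rfl⟩ := (N.comap X.subtype).mkQ_surjective m
      rw [← map_smul, ← LinearMap.mem_ker, Submodule.ker_mkQ]
      exact hk a ha m m.2
    cases subsingleton_or_nontrivial D with
    | inl _ => exact isUniformlyGenerated_of_subsingleton l
    | inr _ =>
    have hl0 : 1 ≤ l := by
      by_contra! h0
      obtain ⟨d, hd⟩ := exists_ne (0 : D)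
      have h1 := hl 1 (by
        rw [Nat.lt_one_iff.1 h0, Submodule.pow_zero, Ideal.one_eq_top]
        exact Submodule.mem_top) d
      exact hd (by rwa [one_smul] at h1)
    by_cases hatom : ∃ N : Submodule R D, IsAtom N ∧ ¬ N ≤ Ring.jacobson R • (⊤ : Submodule R D)
    · obtain ⟨N, hN, hNP⟩ := hatom
      obtain ⟨X, hX, hNX⟩ := hN.exists_isCompl hNP
      by_cases hXbot : X = ⊥
      · have hNtop : N = ⊤ := by rw [hXbot] at hNX; exact eq_top_of_isCompl_bot hNX
        have : IsSimpleModule R D := by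
          rw [← (Submodule.topEquiv (R := R) (M := D)).isSimpleModule_iff, ← hNtop]
          exact isSimpleModule_iff_isAtom.2 hN
        exact (isUniformlyGenerated_one_of_isSimpleModule hD).mono hl0
      · have hNtop : N ≠ ⊤ := fun h => hXbot (by rw [h] at hNX; exact eq_bot_of_top_isCompl hNX)
        obtain ⟨r, hrN, hrX⟩ := hM.exists_smul_eq hNX.inf_eq_bot
        have hsub : ∀ Y : Submodule R D, Y ≠ ⊤ → IsUniformlyGenerated R Y K l := fun Y hY =>
          (hsec Y ⊥ bot_le (.inl hY) l fun a ha m _ => hl a ha m).of_quotient_bot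
        exact IsUniformlyGenerated.of_isCompl hNX hrN hrX (hsub N hNtop) (hsub X hX.1)
    · push Not at hatom
      have hN : killedBy D (Ring.jacobson R) ≤ Ring.jacobson R • (⊤ : Submodule R D) := by
        intro m hm
        by_contra h
        obtain ⟨N, hN, hNP⟩ := exists_isAtom_not_le hm h
        exact hNP (hatom N hN)
      obtain ⟨A, hA⟩ : ∃ A : Submodule R D, IsAtom A := IsAtomic.exists_atom _
      -- The radical acts nontrivially, since `J D` contains a minimal submodule.
      have hl1 : l ≠ 1 := by
        rintro rfl
        refine hA.1 (le_bot_iff.1 ((hatom A hA).trans ?_))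
        rw [Submodule.smul_le]
        intro a ha m _
        rw [Submodule.pow_one] at hl
        exact hl a ha m
      obtain ⟨k, rfl⟩ := Nat.exists_eq_add_of_le (show 2 ≤ l by omega)
      intro ι _ _
      -- The index set `ι` is enlarged to one with two distinguished coordinates.
      refine one_mem_facSpan_of_retract (R := R) (ι' := Fin 2 ⊕ Fin (Fintype.card ι))
        (A := Matrix.of fun i j => if j = .inr (Fintype.equivFin ι i) then 1 else 0)
        (B := Matrix.of fun j i => if j = .inr (Fintype.equivFin ι i) then 1 else 0) ?_
        (one_mem_facSpan_of_sections hR hD hM hl hN (hsec _ _ hN (.inr fun h => ?_) k ?_)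
          (fun X hX => hsec _ _ bot_le (.inl hX.1) _ fun a ha m _ => hl a ha m)
          (fun L hL => hsec _ _ le_top (.inr hL.1) _ fun a ha m _ => ?_) _)
      · ext i i'
        simp [Matrix.mul_apply, Matrix.one_apply, eq_comm]
      · exact hA.1 (le_bot_iff.1 (h ▸ isAtom_le_killedBy hA))
      · intro a ha m hm b hb
        rw [← mul_smul]
        refine Submodule.smul_induction_on hm (fun c hc d _ => ?_) fun x y hx hy => ?_
        · rw [← mul_smul]
          refine hl _ ?_ d
          have h1 : b * a * c ∈ Ring.jacobson R ^ (1 + k + 1) := by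
            rw [Ideal.IsTwoSided.pow_add, Submodule.pow_one, Ideal.IsTwoSided.pow_add,
              Submodule.pow_one]
            exact Ideal.mul_mem_mul (Ideal.mul_mem_mul hb ha) hc
          rwa [show 2 + k = 1 + k + 1 by ring]
        · rw [smul_add, hx, hy, add_zero]
      · rw [hl a ha m]; exact zero_mem _

end DistributiveModules

/-! ### Passage to the quotient by the annihilator -/

section Annihilator

variable {R : Type*} [Ring R] {K : Type*} [CommRing K] {D : Type*} [AddCommGroup D] [Module R D]

attribute [local instance] Module.quotientAnnihilator

variable (R D) in
/-- The action of `R / Ann(D)` on `D`, as a homomorphism into the functions `D → D`. -/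
def annihilatorQuotientHom : (R ⧸ Module.annihilator R D) →+ (D → D) where
  toFun a d := a • d
  map_zero' := funext fun _ => zero_smul _ _
  map_add' _ _ := funext fun _ => add_smul _ _ _

theorem annihilatorQuotientHom_injective : Function.Injective (annihilatorQuotientHom R D) := by
  refine (injective_iff_map_eq_zero _).2 fun a ha => ?_
  obtain ⟨a, rfl⟩ := Ideal.Quotient.mk_surjective a
  rw [Ideal.Quotient.eq_zero_iff_mem, Module.mem_annihilator]
  exact fun d => congrFun ha d

/-- The `R`-submodules and the `R / Ann(D)`-submodules of `D` are the same. -/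
theorem IsDistributiveModule.quotient_annihilator (h : IsDistributiveModule R D) :
    IsDistributiveModule (R ⧸ Module.annihilator R D) D := by
  let φ : Submodule (R ⧸ Module.annihilator R D) D → Submodule R D := fun X =>
    { X.toAddSubgroup with
      smul_mem' := fun a d hd => X.smul_mem (Ideal.Quotient.mk (Module.annihilator R D) a) hd }
  refine .of_le fun X Y Z x hx => ?_
  obtain ⟨hx, hyz⟩ := Submodule.mem_inf.1 hx
  obtain ⟨y, hy, z, hz, rfl⟩ := Submodule.mem_sup.1 hyz
  have h1 : y + z ∈ φ X ⊓ (φ Y ⊔ φ Z) := ⟨hx, Submodule.add_mem_sup hy hz⟩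
  rw [h] at h1
  obtain ⟨y', hy', z', hz', hyz'⟩ := Submodule.mem_sup.1 h1
  rw [← hyz']
  exact Submodule.add_mem_sup ⟨hy'.1, hy'.2⟩ ⟨hz'.1, hz'.2⟩

variable [Finite D]

theorem finite_quotient_annihilator : Finite (R ⧸ Module.annihilator R D) :=
  Finite.of_injective _ annihilatorQuotientHom_injective

theorem isUnit_card_quotient_annihilator (hD : IsUnit (Nat.card D : K)) :
    IsUnit (Nat.card (R ⧸ Module.annihilator R D) : K) := by
  refine isUnit_of_dvd_unit (Nat.cast_dvd_cast ((AddSubgroup.card_dvd_of_injective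
    (annihilatorQuotientHom R D) annihilatorQuotientHom_injective))) ?_
  rw [Nat.card_fun, Nat.cast_pow]
  exact hD.pow _

/-- A finite distributive module is uniformly generated by functions whose arity is the nilpotence
degree of the Jacobson radical of the ring modulo the annihilator. -/
theorem IsDistributiveModule.isUniformlyGenerated_of_nilpotenceDegree
    (hD : IsUnit (Nat.card D : K)) (hM : IsDistributiveModule R D) {l : ℕ}
    (hl : IsJacobsonNilpotenceDegree (R ⧸ Module.annihilator R D) l) :
    IsUniformlyGenerated R D K l := by
  have := finite_quotient_annihilator (R := R) (D := D)
  refine (hM.quotient_annihilator.isUniformlyGenerated (isUnit_card_quotient_annihilator hD) hD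
    (l := l) fun a ha m => ?_).of_addEquiv (AddEquiv.refl D) fun a => ?_
  · have h1 : Ring.jacobson (R ⧸ Module.annihilator R D) ^ l = ⊥ := hl.1
    rw [h1, Submodule.mem_bot] at ha
    rw [ha, zero_smul]
  · obtain ⟨a, rfl⟩ := Ideal.Quotient.mk_surjective a
    exact ⟨a, fun d => rfl⟩

end Annihilator

/-! ### Clonoids between modules -/

section Clonoids

theorem isClone_moduleClone (R : Type*) (M : Type*) [Ring R] [AddCommGroup M] [Module R M] :
    IsClone (moduleClone R M) where
  proj_mem n i _ hC _ := hC.proj_mem n i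
  comp_mem n k f g hf hg C hC hF := hC.comp_mem n k f g (hf C hC hF) fun i => hg i C hC hF

theorem moduleBasicOp_mem_moduleClone {R : Type*} {M : Type*} [Ring R] [AddCommGroup M]
    [Module R M] {n : ℕ} {f : (Fin n → M) → M} (hf : ModuleBasicOp R M n f) :
    f ∈ moduleClone R M n := fun _ _ hF => hF n hf

/-- Linear forms are term operations. -/
theorem sum_smul_mem_moduleClone {R : Type*} {M : Type*} [Ring R] [AddCommGroup M] [Module R M]
    {n : ℕ} (a : Fin n → R) : (fun x : Fin n → M => ∑ j, a j • x j) ∈ moduleClone R M n := by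
  have hC := isClone_moduleClone R M
  have h : ∀ s : Finset (Fin n), (fun x : Fin n → M => ∑ j ∈ s, a j • x j) ∈ moduleClone R M n := by
    intro s
    induction s using Finset.induction_on with
    | empty =>
      exact hC.comp_mem 0 n _ Fin.elim0 (moduleBasicOp_mem_moduleClone .zero) fun i => i.elim0
    | insert j s hj ih =>
      have h1 : (fun x : Fin n → M => a j • x j) ∈ moduleClone R M n :=
        hC.comp_mem 1 n _ (fun _ x => x j) (moduleBasicOp_mem_moduleClone (.smul (a j)))
          fun _ => hC.proj_mem n j
      have h2 := hC.comp_mem 2 n _ ![fun x : Fin n → M => a j • x j, fun x => ∑ j ∈ s, a j • x j]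
        (moduleBasicOp_mem_moduleClone .add) (Fin.forall_fin_two.2 ⟨h1, ih⟩)
      convert h2 using 1
      funext x
      rw [Finset.sum_insert hj]
      rfl
  exact h Finset.univ

variable {A : Type*} {S : Type*} [Ring S] {B : Type*} [AddCommGroup B] [Module S B]
  {𝒜 : OpSet A A} {C : OpSet A B}

theorem IsClonoid.zero_mem (hC : IsClonoid 𝒜 (moduleClone S B) C) (n : ℕ) : 0 ∈ C n :=
  hC.comp_left 0 n _ Fin.elim0 (moduleBasicOp_mem_moduleClone .zero) fun i => i.elim0

theorem IsClonoid.add_mem (hC : IsClonoid 𝒜 (moduleClone S B) C) {n : ℕ}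
    {f g : (Fin n → A) → B} (hf : f ∈ C n) (hg : g ∈ C n) : f + g ∈ C n :=
  hC.comp_left 2 n _ ![f, g] (moduleBasicOp_mem_moduleClone .add) (Fin.forall_fin_two.2 ⟨hf, hg⟩)

theorem IsClonoid.smul_mem (hC : IsClonoid 𝒜 (moduleClone S B) C) {n : ℕ} (s : S)
    {f : (Fin n → A) → B} (hf : f ∈ C n) : s • f ∈ C n :=
  hC.comp_left 1 n _ (fun _ => f) (moduleBasicOp_mem_moduleClone (.smul s)) fun _ => hf

variable {T : Type*} [Ring T] [AddCommGroup A] [Module T A]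

theorem IsClonoid.comp_matHom_mem (hC : IsClonoid (moduleClone T A) (moduleClone S B) C)
    {n k : ℕ} (M : Matrix (Fin k) (Fin n) T) {f : (Fin k → A) → B} (hf : f ∈ C k) :
    (fun x => f (matHom A M x)) ∈ C n :=
  hC.comp_right n k f (fun i x => ∑ j, M i j • x j) hf fun i => sum_smul_mem_moduleClone (M i)

variable {K : Type*} [CommRing K] [Module K B]

/-- A function on a uniformly generated module is a linear combination of substitution instances
of its `k`-ary minors. -/
theorem IsUniformlyGenerated.exists_eq_sum {k : ℕ} (h : IsUniformlyGenerated T A K k) (n : ℕ) :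
    ∃ c : (Matrix (Fin n) (Fin k) T × Matrix (Fin k) (Fin n) T) →₀ K, ∀ f : (Fin n → A) → B,
      f = ∑ QP ∈ c.support, c QP • fun x => f (matHom A QP.1 (matHom A QP.2 x)) := by
  obtain ⟨c, hc⟩ := exists_facComb_eq (h (Fin n))
  refine ⟨c, fun f => funext fun x => ?_⟩
  let ev : AddMonoidAlgebra K (Fin n → A) →ₗ[K] B :=
    (Finsupp.lsum K fun y => LinearMap.toSpanSingleton K B (f y)) ∘ₗ
      (AddMonoidAlgebra.coeffLinearEquiv K).toLinearMap
  have hev : ∀ y, ev (pt K y) = f y := fun y => by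
    simp [ev, pt, AddMonoidAlgebra.coeffLinearEquiv]
  have h1 := congrArg ev (LinearMap.congr_fun hc (pt K x))
  rw [facComb_apply, Module.End.one_apply, hev, Finsupp.sum, map_sum] at h1
  rw [← h1, Finset.sum_apply]
  refine Finset.sum_congr rfl fun QP _ => ?_
  rw [map_smul, act_pt, hev, matHom_mul_apply, Pi.smul_apply]

end Clonoids

/-! ### Generation of clonoids -/

section Generation

variable {S : Type*} [Ring S]

/-- A natural number that is invertible in a ring is invertible in its center. -/
theorem isUnit_natCast_center {n : ℕ} (h : IsUnit (n : S)) :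
    IsUnit (n : Subring.center S) := by
  obtain ⟨u, hu⟩ := h
  have hc : ((u⁻¹ : Sˣ) : S) ∈ Subring.center S := Subring.mem_center_iff.2 fun s => by
    have h1 : Commute (u : S) s := by rw [hu]; exact Nat.cast_commute n s
    exact h1.units_inv_left.symm
  refine IsUnit.of_mul_eq_one ⟨_, hc⟩ (Subtype.ext ?_)
  change ((n : Subring.center S) : S) * ((u⁻¹ : Sˣ) : S) = 1
  rw [Subring.coe_natCast, ← hu, Units.mul_inv]

variable {T : Type*} [Ring T] {A : Type*} [AddCommGroup A] [Module T A] {B : Type*}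
  [AddCommGroup B] [Module S B]

/-- Over a uniformly generated module, every clonoid is generated by its `k`-ary part. -/
theorem IsUniformlyGenerated.eq_generatedClonoid {k : ℕ}
    (h : IsUniformlyGenerated T A (Subring.center S) k) {C : OpSet A B}
    (hC : IsClonoid (moduleClone T A) (moduleClone S B) C) :
    C = generatedClonoid (moduleClone T A) (moduleClone S B) (aryPart C k) := by
  funext n
  refine Set.Subset.antisymm (fun f hf C' hC' hsub => ?_) fun f hf => hf C hC fun m g hg => hg.1
  obtain ⟨c, hc⟩ := h.exists_eq_sum (B := B) n
  rw [hc f]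
  refine Finset.sum_induction _ (· ∈ C' n) (fun _ _ => hC'.add_mem) (hC'.zero_mem n) fun QP _ => ?_
  exact hC'.smul_mem ((c QP : Subring.center S) : S) (hC'.comp_matHom_mem QP.2
    (hsub k ⟨hC.comp_matHom_mem QP.1 hf, rfl⟩))

end Generation

theorem mainTheorem7 {n : ℕ} (F : Fin n → Type*) [∀ i, Field (F i)] [∀ i, Finite (F i)]
    (k : Fin n → ℕ)
    (R : Type*) [Ring R] (D : Type*) [AddCommGroup D] [Module R D] [Finite D]
    (hD : IsDistributiveModule R D)
    (l : ℕ) (hl : IsJacobsonNilpotenceDegree (R ⧸ Module.annihilator R D) l)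
    (S : Type*) [Ring S] (B : Type*) [AddCommGroup B] [Module S B]
    (hS : IsUnit ((Nat.card ((∀ i, Fin (k i) → F i) × D) : ℕ) : S)) :
    (∀ C : OpSet ((∀ i, Fin (k i) → F i) × D) B,
      IsClonoid (moduleClone ((∀ i, F i) × R) ((∀ i, Fin (k i) → F i) × D)) (moduleClone S B) C →
        C = generatedClonoid
          (moduleClone ((∀ i, F i) × R) ((∀ i, Fin (k i) → F i) × D)) (moduleClone S B)
          (aryPart C (max (Finset.univ.sup k) l))) ∧
    (Finite B →
      {C : OpSet ((∀ i, Fin (k i) → F i) × D) B |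
        IsClonoid (moduleClone ((∀ i, F i) × R) ((∀ i, Fin (k i) → F i) × D))
          (moduleClone S B) C}.Finite) := by
  set K := Subring.center S
  have hA : IsUnit (Nat.card ((∀ i, Fin (k i) → F i) × D) : K) := isUnit_natCast_center hS
  rw [Nat.card_prod, Nat.cast_mul] at hA
  have hF : ∀ i, IsUniformlyGenerated (F i) (Fin (k i) → F i) K (max (Finset.univ.sup k) l) := by
    intro i
    cases nonempty_fintype (F i)
    refine IsUniformlyGenerated.mono
      ((Finset.le_sup (Finset.mem_univ i)).trans (le_max_left (Finset.univ.sup k) l)) ?_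
    rcases Nat.eq_zero_or_pos (k i) with hi | hi
    -- If `k i = 0`, then `|F i|` need not be invertible, but the factor is trivial.
    · have : IsEmpty (Fin (k i)) := by rw [hi]; infer_instance
      exact isUniformlyGenerated_of_subsingleton _
    · refine isUniformlyGenerated_field
        (isUnit_of_dvd_unit (Nat.cast_dvd_cast ?_) (isUnit_of_mul_isUnit_left hA)) _
      rw [Nat.card_pi, ← Nat.card_eq_fintype_card]
      refine dvd_trans ?_ (Finset.dvd_prod_of_mem _ (Finset.mem_univ i))
      rw [Nat.card_fun, Nat.card_fin]
      exact dvd_pow_self _ hi.ne'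
  have hgen : IsUniformlyGenerated ((∀ i, F i) × R) ((∀ i, Fin (k i) → F i) × D) K
      (max (Finset.univ.sup k) l) :=
    (IsUniformlyGenerated.pi hF).prod
      ((hD.isUniformlyGenerated_of_nilpotenceDegree (isUnit_of_mul_isUnit_right hA) hl).mono
        (le_max_right _ _))
  refine ⟨fun C hC => hgen.eq_generatedClonoid hC, fun _ => ?_⟩
  -- A clonoid is determined by its part of arity `max (sup k) l`, a subset of a finite set.
  refine Set.Finite.of_injOn (f := fun C => C (max (Finset.univ.sup k) l)) (Set.mapsTo_univ _ _)
    (fun C hC C' hC' h => ?_) (Set.toFinite Set.univ)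
  rw [hgen.eq_generatedClonoid hC, hgen.eq_generatedClonoid hC']
  congr 1
  funext m
  ext f
  constructor
  · rintro ⟨hf, rfl⟩
    exact ⟨(Set.ext_iff.1 h f).1 hf, rfl⟩
  · rintro ⟨hf, rfl⟩
    exact ⟨(Set.ext_iff.1 h f).2 hf, rfl⟩
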